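/- Let $1<p\le q<\infty$, let $m,n_1,\dots,n_m$ be positive integers, and for $1\le i\le m$ let $\alpha_i,\beta_i,\gamma_i$ be real numbers with $0\le\beta_i<n_i$, $\gamma_i<n_i(p-1)$ and $$\beta_i+\frac{\alpha_i+n_i}{q}=\frac{\gamma_i+n_i}{p}.$$ Write $X=\mathbb R^{n_1}\times\cdots\times\mathbb R^{n_m}$. For $\delta\in\mathbb R^m$ put $|x|^{\delta}=\prod_{i=1}^m|x_i|^{\delta_i}$, and let $L^r(X,|x|^{\delta})$ be the $L^r$ space of the measure $|x|^{\delta}dx$ on $X$. Define $$\mathscr H_{\beta_1,\dots,\beta_m}(f)(x)=\prod_{i=1}^m\frac{1}{|B(0,|x_i|)|^{1-\beta_i/n_i}}\int_{|y_1|<|x_1|}\cdots\int_{|y_m|<|x_m|}f(y_1,\dots,y_m)\,dy_1\cdots dy_m$$ for $x\in X$ with $\prod_i|x_i|\ne0$, where $|B(0,r)|$ is the volume of the ball of radius $r$. Then for every real- or complex-valued $f\in L^p(X,|x|^{\gamma})$ the integral exists for every such $x$, the function $\mathscr H_{\beta_1,\dots,\beta_m}(f)$ belongs to $L^q(X,|x|^{\alpha})$,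 and $$\|\mathscr H_{\beta_1,\dots,\beta_m}(f)\|_{L^q(X,|x|^{\alpha})}\le C^*\,\|f\|_{L^p(X,|x|^{\gamma})}.$$ Moreover, the operator norm is exactly $$\|\mathscr H_{\beta_1,\dots,\beta_m}\|_{L^p(X,|x|^{\gamma})\to L^q(X,|x|^{\alpha})}=\sup_{\|f\|_{L^p(X,|x|^{\gamma})}\ne0}\frac{\|\mathscr H_{\beta_1,\dots,\beta_m}(f)\|_{L^q(X,|x|^{\alpha})}}{\|f\|_{L^p(X,|x|^{\gamma})}}=C^*,$$ and the supremum is the same if it is taken over non-negative $f$ only. Here $$C^*=\prod_{i=1}^m|S^{n_i-1}|^{\frac1q-\frac1p+\frac{\beta_i}{n_i}}\,n_i^{\frac1p-\frac1q-\frac{\beta_i}{n_i}}\left(\frac{n_i(p-1)}{n_i(p-1)-\gamma_i}\right)^{\frac1{p'}+\frac1q}A_{p,q},$$ where $|S^{n-1}|=2\pi^{n/2}/\Gamma(n/2)$ is the surface area of the unit sphere, $p'=p/(p-1)$, $q'=q/(q-1)$, and, with the beta function $B(z,w)=\int_0^1t^{z-1}(1-t)^{w-1}\,dt$, $$A_{p,q}=\left(\frac{p'}{q}\right)^{1/q}\left(\frac{p}{q-p}\,B\left(\frac{p}{q-p},\frac{pq}{q'(q-p)}\right)\right)^{\frac1q-\frac1p}\quad(p<q),\qquad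 A_{p,p}=\lim_{q\downarrow p}A_{p,q}=\frac{p}{p-1}.$$ -/

import Mathlib

open MeasureTheory
open scoped ENNReal

noncomputable section

/-- The product space `ℝ^{n₁} × ⋯ × ℝ^{n_m}`, with the product of the Lebesgue measures as `volume`. -/
abbrev ProdSpace {m : ℕ} (n : Fin m → ℕ) : Type :=
  (i : Fin m) → EuclideanSpace ℝ (Fin (n i))

/-- The product of the open balls `B(0,|x_i|)`. -/
def ballBox {m : ℕ} {n : Fin m → ℕ} (x : ProdSpace n) : Set (ProdSpace n) :=
  {y | ∀ i, ‖y i‖ < ‖x i‖}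

/-- The fractional Hardy type operator `𝓗_{β₁,…,β_m}`. -/
def hardyOp {𝕜 : Type*} [RCLike 𝕜] {m : ℕ} {n : Fin m → ℕ} (β : Fin m → ℝ)
    (f : ProdSpace n → 𝕜) (x : ProdSpace n) : 𝕜 :=
  (∏ i, 1 / (volume (Metric.ball (0 : EuclideanSpace ℝ (Fin (n i))) ‖x i‖)).toReal
      ^ (1 - β i / (n i : ℝ))) • ∫ y in ballBox x, f y

/-- The measure `|x|^γ dx`, where `|x|^γ = ∏ i, |x_i|^{γ_i}`. -/
def powerMeasure {m : ℕ} (n : Fin m → ℕ) (γ : Fin m → ℝ) : Measure (ProdSpace n) :=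
  volume.withDensity fun x => ENNReal.ofReal (∏ i, ‖x i‖ ^ γ i)

/-- The norm of `f` in `L^p(|x|^γ)`, with values in `[0,∞]`. -/
def weightedNorm {𝕜 : Type*} [RCLike 𝕜] {m : ℕ} {n : Fin m → ℕ} (p : ℝ) (γ : Fin m → ℝ)
    (f : ProdSpace n → 𝕜) : ℝ≥0∞ :=
  eLpNorm f (ENNReal.ofReal p) (powerMeasure n γ)

/-- Membership in `L^p(|x|^γ)`. -/
def MemWeightedLp {𝕜 : Type*} [RCLike 𝕜] {m : ℕ} {n : Fin m → ℕ} (p : ℝ) (γ : Fin m → ℝ)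
    (f : ProdSpace n → 𝕜) : Prop :=
  MemLp f (ENNReal.ofReal p) (powerMeasure n γ)

/-- The operator norm of `𝓗_{β₁,…,β_m}` from `L^p(|x|^γ)` to `L^q(|x|^α)`, for functions with
values in `𝕜`. -/
def hardyNorm (𝕜 : Type*) [RCLike 𝕜] {m : ℕ} (n : Fin m → ℕ) (β : Fin m → ℝ)
    (p : ℝ) (γ : Fin m → ℝ) (q : ℝ) (α : Fin m → ℝ) : ℝ≥0∞ :=
  ⨆ f ∈ {f : ProdSpace n → 𝕜 | MemWeightedLp p γ f ∧ weightedNorm p γ f ≠ 0},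
    weightedNorm q α (hardyOp β f) / weightedNorm p γ f

/-- The same supremum over the non-negative functions only. -/
def hardyNormNonneg {m : ℕ} (n : Fin m → ℕ) (β : Fin m → ℝ)
    (p : ℝ) (γ : Fin m → ℝ) (q : ℝ) (α : Fin m → ℝ) : ℝ≥0∞ :=
  ⨆ f ∈ {f : ProdSpace n → ℝ |
      (∀ x, 0 ≤ f x) ∧ MemWeightedLp p γ f ∧ weightedNorm p γ f ≠ 0},
    weightedNorm q α (hardyOp β f) / weightedNorm p γ f

/-- The surface area `|S^{n-1}|` of the unit sphere of `ℝ^n`. -/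
def sphereArea (n : ℕ) : ℝ :=
  ((volume : Measure (EuclideanSpace ℝ (Fin n))).toSphere Set.univ).toReal

/-- The beta function (for positive real arguments). -/
def betaFn (z w : ℝ) : ℝ :=
  ∫ t in (0 : ℝ)..1, t ^ (z - 1) * (1 - t) ^ (w - 1)

/-- The Bliss factor. For `p = q` the formula makes no sense as written, and it is read as its
limit for `q → p`, which is `p / (p - 1)`. -/
def blissFactor (p q : ℝ) : ℝ :=
  if p = q then p / (p - 1)
  else (p.conjExponent / q) ^ (1 / q) *
    (p / (q - p) * betaFn (p / (q - p)) (p * q / (q.conjExponent * (q - p)))) ^ (1 / q - 1 / p)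

/-- The constant `C*`. -/
def sharpConst {m : ℕ} (n : Fin m → ℕ) (β γ : Fin m → ℝ) (p q : ℝ) : ℝ :=
  ∏ i, sphereArea (n i) ^ (1 / q - 1 / p + β i / (n i : ℝ)) *
    (n i : ℝ) ^ (1 / p - 1 / q - β i / (n i : ℝ)) *
    ((n i : ℝ) * (p - 1) / ((n i : ℝ) * (p - 1) - γ i)) ^ (1 / p.conjExponent + 1 / q) *
    blissFactor p q

end

/-! The operator factors over the variables, and in one variable it becomes the one-dimensional
Hardy operator in a suitable radial coordinate. With `c = n - γ / (p - 1)` and `u = ‖x‖ ^ c`, the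
integral of `f` over a ball is `∫ t in (0, u)` of `radialDensity c f`. This choice of `c` removes
the weight `‖x‖ ^ γ` from the source norm. The balance condition then forces the weight `u ^ (-1 - q
(p - 1) / p)` in the target norm. Hölder's inequality on the sphere bounds the `L^p` norm of the
radial density, with equality for radial `f`, so no constant is lost
(`lintegral_hardyWeight_mul_rpow_le`).

What remains is the sharp inequality for `x ↦ ∫ t in (0, x), f t` on the half-line
(`lintegral_primitive_rpow_le`). For `p = q` it is Hardy's inequality. For `p < q`, written `q = p
(1 + l)` with `l > 0`, it is Bliss' inequality, with extremal `(1 + t ^ l) ^ (-(1 + l) / l)`. It is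
proved by mass transport. Let `h` be normalized so that the left-hand integrand of Bliss' inequality
has the same mass for `h` as for the extremal, and let `y` be the monotone map carrying the first
density to the second. A weighted AM-GM inequality for `y' / y` and `1 / x`, and Young's inequality
for `h`, bound the derivative of an explicit boundary term `Q` by the integrands of the two sides
(`transport_derivative_le`). Both are equalities for the extremal, where `y x = x`. Integrating over
the half-line, where `Q` starts at `0` and stays non-negative, gives the sharp bound for functions
comparable to the extremal; density and Fatou's lemma give it for all measurable functions.

Several variables: since `p ≤ q`, Minkowski's integral inequality with exponent `q / p` lets the
bound be applied in one variable at a time, and the constants multiply (`lintegral_tensor_rpow_le`,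
`lintegral_pi_rpow_le`). Conversely, products of one-variable near extremals are near extremal by
Tonelli, and they are non-negative, so both suprema equal the product (`le_hardyNormNonneg`). -/

noncomputable section

open Set Filter Topology

/-! ### Pointwise inequality for the transport argument -/

/-- The pointwise differential inequality behind the mass transport proof of Bliss' inequality. -/
lemma transport_derivative_le {p l F h x y : ℝ} (hp : 1 < p) (hl : 0 < l) (hF : 0 < F)
    (hh : 0 ≤ h) (hx : 0 < x) (hy : 0 < y) :
    y ^ (-(l * (p - 1) / p)) * (F * x ^ (-((p - 1) / p))) ^ (p * (1 + l) - l) *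
      (-(l * (p - 1) / p) * (F ^ (p * (1 + l)) * x ^ (-1 - (p - 1) * (1 + l)) * y ^ (-l - 1) *
        (1 + y ^ l) ^ (p * (1 + l) / l)) + (p * (1 + l) - l) * (h / F - (p - 1) / p / x)) ≤
    (p * (1 + l) - l) / p * h ^ p
      - (p - 1) * (1 + l) * (F ^ (p * (1 + l)) * x ^ (-1 - (p - 1) * (1 + l)))
      - l * (p - 1) / p * (y ^ (-l) * (F ^ (p * (1 + l)) * x ^ (-1 - (p - 1) * (1 + l)))) := by
  have hp0 : 0 < p := by linarith
  have hq : 0 < p * (1 + l) := by positivity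
  have hql : 0 < p * (1 + l) - l := by nlinarith
  -- In logarithmic coordinates every identity between powers becomes a linear identity between
  -- exponents.
  obtain ⟨a, rfl⟩ : ∃ a, F = Real.exp a := ⟨Real.log F, (Real.exp_log hF).symm⟩
  obtain ⟨b, rfl⟩ : ∃ b, x = Real.exp b := ⟨Real.log x, (Real.exp_log hx).symm⟩
  obtain ⟨c, rfl⟩ : ∃ c, y = Real.exp c := ⟨Real.log y, (Real.exp_log hy).symm⟩
  obtain ⟨d, hd⟩ : ∃ d, 1 + Real.exp c ^ l = Real.exp d :=
    ⟨Real.log (1 + Real.exp c ^ l), (Real.exp_log (by positivity)).symm⟩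
  -- The variable `d` is tied to `c` by `exp d = 1 + y ^ l`; this is the only place where that
  -- relation enters.
  have key : Real.exp (d - l * c) = 1 + Real.exp (-(l * c)) := by
    rw [sub_eq_add_neg, Real.exp_add, ← hd, add_mul, ← Real.exp_mul, ← Real.exp_add]
    rw [show c * l + -(l * c) = 0 by ring]; simp [add_comm]
  rw [hd]
  simp only [← Real.exp_mul, ← Real.exp_add, div_eq_mul_inv h, ← Real.exp_neg,
    div_eq_mul_inv ((p - 1) / p)]
  set P := Real.exp (a * (p * (1 + l)) + b * (-1 - (p - 1) * (1 + l))) with hP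
  set Q := Real.exp (c * -(l * (p - 1) / p) + (a + b * -((p - 1) / p)) * (p * (1 + l) - l)) with hQ
  -- Along the transport the first entry is `y' / y`; the second is `1 / x`. The weights make `Q`
  -- times the geometric mean equal to `P * (1 + y ^ (-l))` (see `hA`). Equality holds when `y' / y
  -- = 1 / x`.
  have amgm := Real.geom_mean_le_arith_mean2_weighted (w₁ := l / (p * (1 + l)))
    (w₂ := (p * (1 + l) - l) / (p * (1 + l)))
    (p₁ := Real.exp (a * (p * (1 + l)) + b * (-1 - (p - 1) * (1 + l)) + c * (-l - 1) +
        d * (p * (1 + l) / l))) (p₂ := Real.exp (-b)) (by positivity) (by positivity)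
    (Real.exp_pos _).le (Real.exp_pos _).le (by field_simp; ring)
  -- The second factor is `Q / F`, and its conjugate power is `y ^ (-l) * P`.
  have young := Real.young_inequality_of_nonneg (a := h)
    (b := Real.exp ((c * -l + (a * (p * (1 + l)) + b * (-1 - (p - 1) * (1 + l)))) * ((p - 1) / p)))
    hh (Real.exp_pos _).le (Real.HolderConjugate.conjExponent hp)
  have hQh : Q * Real.exp (-a) = Real.exp ((c * -l + (a * (p * (1 + l)) +
      b * (-1 - (p - 1) * (1 + l)))) * ((p - 1) / p)) := by
    rw [hQ, ← Real.exp_add]; congr 1; field_simp; ring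
  rw [← hQh] at young
  have hb : (Q * Real.exp (-a)) ^ (p.conjExponent) = Real.exp (c * -l) * P := by
    rw [hQh, ← Real.exp_mul, hP, ← Real.exp_add]
    have : p - 1 ≠ 0 := by linarith
    congr 1; unfold Real.conjExponent; field_simp
  rw [hb] at young
  have hA : Q * (Real.exp (a * (p * (1 + l)) + b * (-1 - (p - 1) * (1 + l)) + c * (-l - 1) +
        d * (p * (1 + l) / l)) ^ (l / (p * (1 + l))) *
        Real.exp (-b) ^ ((p * (1 + l) - l) / (p * (1 + l)))) = P * (1 + Real.exp (c * -l)) := by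
    rw [show c * -l = -(l * c) by ring, ← key, hQ, hP, ← Real.exp_mul, ← Real.exp_mul,
      ← Real.exp_add, ← Real.exp_add, ← Real.exp_add]
    congr 1; field_simp; ring
  have hQ0 : 0 < Q := Real.exp_pos _
  have amgm' := mul_le_mul_of_nonneg_left amgm hQ0.le
  rw [hA] at amgm'
  set Y := Real.exp (a * (p * (1 + l)) + b * (-1 - (p - 1) * (1 + l)) + c * (-l - 1) +
        d * (p * (1 + l) / l)) with hY
  set B := Real.exp (-b)
  have h1 : (p - 1) * (1 + l) * (P * (1 + Real.exp (c * -l))) ≤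
      Q * (l * (p - 1) / p * Y + (p * (1 + l) - l) * ((p - 1) / p) * B) := by
    calc _ ≤ (p - 1) * (1 + l) * (Q * (l / (p * (1 + l)) * Y +
        (p * (1 + l) - l) / (p * (1 + l)) * B)) :=
          mul_le_mul_of_nonneg_left amgm' (mul_nonneg (by linarith) (by linarith))
      _ = _ := by field_simp
  have h2 : (p * (1 + l) - l) * (h * (Q * Real.exp (-a))) ≤ (p * (1 + l) - l) *
      (h ^ p / p + Real.exp (c * -l) * P / p.conjExponent) :=
    mul_le_mul_of_nonneg_left young hql.le
  have h3 : (p * (1 + l) - l) * (h ^ p / p + Real.exp (c * -l) * P / p.conjExponent) =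
      (p * (1 + l) - l) / p * h ^ p + (p * (1 + l) - l) * ((p - 1) / p) *
      (Real.exp (c * -l) * P) := by
    have : p - 1 ≠ 0 := by linarith
    unfold Real.conjExponent; field_simp
  have h4 : (p - 1) * (1 + l) - (p * (1 + l) - l) * ((p - 1) / p) = l * (p - 1) / p := by
    field_simp; ring
  have h5 : ((p - 1) * (1 + l) - (p * (1 + l) - l) * ((p - 1) / p)) * (Real.exp (c * -l) * P) =
      l * (p - 1) / p * (Real.exp (c * -l) * P) := by rw [h4]
  rw [Real.exp_add (c * -l)]
  linear_combination h1 + h2 + h3 - h5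

/-! ### Integrals of the extremal density -/

/-- The `p`-th power of the extremal function `(1 + t ^ l) ^ (-(1 + l) / l)` of Bliss. -/
def blissDensity (p l t : ℝ) : ℝ := (1 + t ^ l) ^ (-(p * (1 + l) / l))

lemma blissDensity_pos {p l t : ℝ} (ht : 0 ≤ t) : 0 < blissDensity p l t := by
  unfold blissDensity; positivity

lemma blissDensity_le_one {p l t : ℝ} (hp : 1 < p) (hl : 0 < l) (ht : 0 ≤ t) :
    blissDensity p l t ≤ 1 := by
  unfold blissDensity
  apply Real.rpow_le_one_of_one_le_of_nonpos
  · have := Real.rpow_nonneg ht l; linarith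
  · rw [neg_nonpos]; positivity

lemma continuousOn_blissDensity {p l : ℝ} (hl : 0 < l) :
    ContinuousOn (blissDensity p l) (Set.Ici 0) := by
  unfold blissDensity
  apply ContinuousOn.rpow_const
  · exact (continuous_const.add (Real.continuous_rpow_const hl.le)).continuousOn
  · intro x hx
    have := Real.rpow_nonneg (Set.mem_Ici.1 hx) l
    left; linarith

lemma blissDensity_le_rpow {p l t : ℝ} (hp : 1 < p) (hl : 0 < l) (ht : 0 < t) :
    blissDensity p l t ≤ t ^ (-(p * (1 + l))) := by
  have h1 : (0 : ℝ) < t ^ l := by positivity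
  calc blissDensity p l t ≤ (t ^ l) ^ (-(p * (1 + l) / l)) := by
        unfold blissDensity
        apply Real.rpow_le_rpow_of_nonpos h1 (by linarith)
        rw [neg_nonpos]; positivity
    _ = _ := by rw [← Real.rpow_mul ht.le]; congr 1; field_simp

/-- Near infinity the integrand is at most `t ^ (s - p (1 + l))`, and `s ≤ l` with `p > 1` puts the
exponent below `-1`. The cases `s = 0` and `s = l` are the two sides of Bliss' inequality for the
extremal. -/
lemma integrableOn_rpow_mul_blissDensity {p l s : ℝ} (hp : 1 < p) (hl : 0 < l) (hs : 0 ≤ s)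
    (hsl : s ≤ l) : IntegrableOn (fun t => t ^ s * blissDensity p l t) (Set.Ioi 0) := by
  have hc : ContinuousOn (fun t => t ^ s * blissDensity p l t) (Set.Ici 0) :=
    (Real.continuous_rpow_const hs).continuousOn.mul (continuousOn_blissDensity hl)
  rw [← Set.Ioc_union_Ioi_eq_Ioi zero_le_one]
  apply IntegrableOn.union
  · exact ((hc.mono Set.Icc_subset_Ici_self).integrableOn_Icc).mono_set Set.Ioc_subset_Icc_self
  · apply Integrable.mono' (g := fun t => t ^ (s - p * (1 + l)))
    · apply integrableOn_Ioi_rpow_of_lt _ one_pos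
      nlinarith
    · exact (hc.mono ((Set.Ioi_subset_Ici_self).trans (Set.Ici_subset_Ici.2 zero_le_one))).aestronglyMeasurable
        measurableSet_Ioi
    · filter_upwards [ae_restrict_mem measurableSet_Ioi] with t ht
      have ht0 : 0 < t := one_pos.trans ht
      have := blissDensity_pos (p := p) (l := l) ht0.le
      rw [Real.norm_of_nonneg (by positivity), sub_eq_add_neg, Real.rpow_add ht0]
      gcongr
      exact blissDensity_le_rpow hp hl ht0

lemma integrableOn_blissDensity {p l : ℝ} (hp : 1 < p) (hl : 0 < l) :
    IntegrableOn (blissDensity p l) (Set.Ioi 0) := by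
  simpa using integrableOn_rpow_mul_blissDensity hp hl le_rfl hl.le

/-- Both sides of Bliss' inequality for the extremal function are proportional. -/
lemma integral_blissDensity_eq {p l : ℝ} (hp : 1 < p) (hl : 0 < l) :
    ∫ t in Set.Ioi 0, blissDensity p l t =
      (p - 1) * (1 + l) * ∫ t in Set.Ioi 0, t ^ l * blissDensity p l t := by
  have hi1 := integrableOn_blissDensity hp hl
  have hi2 := integrableOn_rpow_mul_blissDensity hp hl hl.le le_rfl
  -- The difference of the two integrands is an exact derivative, and the primitive vanishes at both
  -- ends of the half-line.
  have hd : ∀ t ∈ Set.Ioi (0 : ℝ), HasDerivAt (fun t => t * (1 + t ^ l) ^ (1 - p * (1 + l) / l))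
      (blissDensity p l t - (p - 1) * (1 + l) * (t ^ l * blissDensity p l t)) t := by
    intro t ht
    have ht0 : (0 : ℝ) < t := ht
    have hpos : (0 : ℝ) < 1 + t ^ l := by positivity
    have h1 := ((Real.hasDerivAt_rpow_const (x := t) (p := l) (Or.inl ht0.ne')).const_add 1).rpow_const
      (p := 1 - p * (1 + l) / l) (Or.inl hpos.ne')
    refine ((hasDerivAt_id' t).mul h1).congr_deriv ?_
    unfold blissDensity
    rw [show (1 : ℝ) - p * (1 + l) / l - 1 = -(p * (1 + l) / l) by ring,
      show (1 : ℝ) - p * (1 + l) / l = -(p * (1 + l) / l) + 1 by ring, Real.rpow_add hpos,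
      Real.rpow_one, Real.rpow_sub_one ht0.ne']
    field_simp
    ring
  have hzero : Filter.Tendsto (fun t : ℝ => t * (1 + t ^ l) ^ (1 - p * (1 + l) / l))
      Filter.atTop (nhds 0) := by
    have hneg : 0 < (p - 1) * (1 + l) := mul_pos (by linarith) (by linarith)
    apply squeeze_zero' (g := fun t => t ^ (-((p - 1) * (1 + l))))
    · filter_upwards [Filter.eventually_gt_atTop 0] with t ht
      positivity
    · filter_upwards [Filter.eventually_gt_atTop 0] with t ht
      have h1 : (0 : ℝ) < t ^ l := by positivity
      calc t * (1 + t ^ l) ^ (1 - p * (1 + l) / l) ≤ t * (t ^ l) ^ (1 - p * (1 + l) / l) := by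
            gcongr ?_ * ?_
            apply Real.rpow_le_rpow_of_nonpos h1 (by linarith)
            rw [sub_nonpos, le_div_iff₀ hl]; nlinarith
        _ = t ^ (-((p - 1) * (1 + l))) := by
            rw [← Real.rpow_mul ht.le]
            nth_rw 1 [← Real.rpow_one t]
            rw [← Real.rpow_add ht]; congr 1; field_simp; ring
    · exact tendsto_rpow_neg_atTop hneg
  have hcont : ContinuousWithinAt (fun t : ℝ => t * (1 + t ^ l) ^ (1 - p * (1 + l) / l))
      (Set.Ici 0) 0 := by
    apply ContinuousAt.continuousWithinAt
    apply continuousAt_id.mul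
    apply ContinuousAt.rpow_const
    · exact (continuous_const.add (Real.continuous_rpow_const hl.le)).continuousAt
    · left; simp [Real.zero_rpow hl.ne']
  have := integral_Ioi_of_hasDerivAt_of_tendsto hcont hd (hi1.sub (hi2.const_mul _)) hzero
  rw [integral_sub hi1 (hi2.const_mul _), integral_const_mul] at this
  simp at this
  linarith

/-! ### Primitives and quantile functions on the half-line -/

section Primitive
variable {φ : ℝ → ℝ}

lemma intervalIntegrable_zero_of_integrableOn_Ioi (hi : IntegrableOn φ (Ioi 0)) {x : ℝ}
    (hx : 0 ≤ x) : IntervalIntegrable φ volume 0 x := by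
  rw [intervalIntegrable_iff_integrableOn_Ioc_of_le hx]
  exact hi.mono_set Ioc_subset_Ioi_self

lemma hasDerivAt_primitive (hc : ContinuousOn φ (Ioi 0)) (hi : IntegrableOn φ (Ioi 0)) {x : ℝ}
    (hx : 0 < x) : HasDerivAt (fun x => ∫ t in (0 : ℝ)..x, φ t) (φ x) x := by
  apply intervalIntegral.integral_hasDerivAt_right
    (intervalIntegrable_zero_of_integrableOn_Ioi hi hx.le)
  · exact hc.stronglyMeasurableAtFilter isOpen_Ioi x hx
  · exact hc.continuousAt (Ioi_mem_nhds hx)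

lemma tendsto_primitive_atTop (hi : IntegrableOn φ (Ioi 0)) :
    Tendsto (fun x => ∫ t in (0 : ℝ)..x, φ t) atTop (𝓝 (∫ t in Ioi 0, φ t)) :=
  intervalIntegral_tendsto_integral_Ioi 0 hi tendsto_id

lemma tendsto_primitive_zero (hi : IntegrableOn φ (Ioi 0)) :
    Tendsto (fun x => ∫ t in (0 : ℝ)..x, φ t) (𝓝[>] 0) (𝓝 0) := by
  have h := intervalIntegral.continuousOn_primitive_interval (a := 0) (b := 1) (f := φ) (μ := volume)
    (by rw [uIcc_of_le zero_le_one, integrableOn_Icc_iff_integrableOn_Ioc]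
        exact hi.mono_set Ioc_subset_Ioi_self)
  rw [uIcc_of_le zero_le_one] at h
  have h0 := (h 0 (by simp)).tendsto
  rw [intervalIntegral.integral_same] at h0
  exact h0.mono_left (nhdsWithin_le_of_mem (Icc_mem_nhdsGT zero_lt_one))

lemma primitive_mono (hi : IntegrableOn φ (Ioi 0)) (hpos : ∀ x, 0 < x → 0 ≤ φ x) {x y : ℝ}
    (hx : 0 ≤ x) (hxy : x ≤ y) : ∫ t in (0 : ℝ)..x, φ t ≤ ∫ t in (0 : ℝ)..y, φ t := by
  rw [intervalIntegral.integral_of_le hx, intervalIntegral.integral_of_le (hx.trans hxy)]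
  apply setIntegral_mono_set (hi.mono_set Ioc_subset_Ioi_self)
  · filter_upwards [ae_restrict_mem measurableSet_Ioc] with t ht using hpos t ht.1
  · exact (Ioc_subset_Ioc_right hxy).eventuallyLE

lemma primitive_strictMono (hi : IntegrableOn φ (Ioi 0))
    (hpos : ∀ x, 0 < x → 0 < φ x) {x y : ℝ} (hx : 0 ≤ x) (hxy : x < y) :
    ∫ t in (0 : ℝ)..x, φ t < ∫ t in (0 : ℝ)..y, φ t := by
  have h1 := intervalIntegrable_zero_of_integrableOn_Ioi hi hx
  have h2 := intervalIntegrable_zero_of_integrableOn_Ioi hi (hx.trans hxy.le)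
  have h3 := intervalIntegral.intervalIntegral_pos_of_pos_on (h1.symm.trans h2)
    (fun t ht => hpos t (hx.trans_lt ht.1)) hxy
  rw [← intervalIntegral.integral_interval_sub_left h2 h1] at h3
  linarith

lemma primitive_pos (hi : IntegrableOn φ (Ioi 0))
    (hpos : ∀ x, 0 < x → 0 < φ x) {x : ℝ} (hx : 0 < x) : 0 < ∫ t in (0 : ℝ)..x, φ t := by
  simpa using primitive_strictMono hi hpos le_rfl hx

lemma primitive_lt_integral (hi : IntegrableOn φ (Ioi 0))
    (hpos : ∀ x, 0 < x → 0 < φ x) {x : ℝ} (hx : 0 ≤ x) :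
    ∫ t in (0 : ℝ)..x, φ t < ∫ t in Ioi 0, φ t := by
  refine (primitive_strictMono hi hpos hx (lt_add_one x)).trans_le ?_
  apply ge_of_tendsto (tendsto_primitive_atTop hi)
  filter_upwards [eventually_ge_atTop (x + 1)] with y hy
  exact primitive_mono hi (fun x hx => (hpos x hx).le) (by linarith) hy

/-- A positive continuous integrable function on the half-line has a differentiable quantile
function. -/
lemma exists_quantile (hc : ContinuousOn φ (Ioi 0)) (hi : IntegrableOn φ (Ioi 0))
    (hpos : ∀ x, 0 < x → 0 < φ x) :
    ∃ θ : ℝ → ℝ, ∀ v ∈ Ioo 0 (∫ t in Ioi 0, φ t),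
      0 < θ v ∧ ∫ t in (0 : ℝ)..(θ v), φ t = v ∧ HasDerivAt θ (φ (θ v))⁻¹ v := by
  set Φ : ℝ → ℝ := fun x => ∫ t in (0 : ℝ)..x, φ t with hΦ
  have hex : ∀ v ∈ Ioo 0 (∫ t in Ioi 0, φ t), ∃ y, 0 < y ∧ Φ y = v := by
    intro v hv
    obtain ⟨a, ha, ha0⟩ := (((tendsto_primitive_zero hi).eventually_lt_const hv.1).and
      self_mem_nhdsWithin).exists
    obtain ⟨b, hb, hb0⟩ := (((tendsto_primitive_atTop hi).eventually_const_lt hv.2).and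
      (eventually_gt_atTop 0)).exists
    obtain ⟨y, hy, hyv⟩ := isPreconnected_Ioi.intermediate_value (mem_Ioi.2 ha0) (mem_Ioi.2 hb0)
      (fun x hx => (hasDerivAt_primitive hc hi hx).continuousAt.continuousWithinAt)
      ⟨ha.le, hb.le⟩
    exact ⟨y, hy, hyv⟩
  choose! θ hθ using hex
  have hlt : ∀ {x y : ℝ}, 0 < x → 0 < y → Φ x < Φ y → x < y := by
    intro x y hx hy h
    by_contra! hle
    exact absurd (primitive_mono hi (fun x hx => (hpos x hx).le) hy.le hle) (not_le.2 h)
  refine ⟨θ, fun v hv => ⟨(hθ v hv).1, (hθ v hv).2, ?_⟩⟩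
  have hmem : ∀ᶠ w in 𝓝 v, w ∈ Ioo 0 (∫ t in Ioi 0, φ t) := Ioo_mem_nhds hv.1 hv.2
  -- The inverse function rule needs continuity of `θ` at `v`; it follows from the order alone, by
  -- comparing `Φ a` with `v`.
  refine HasDerivAt.of_local_left_inverse (f := Φ) ?_ (hasDerivAt_primitive hc hi (hθ v hv).1)
    (hpos _ (hθ v hv).1).ne' ?_
  · rw [ContinuousAt, tendsto_order]
    constructor
    · intro a ha
      rcases le_or_gt a 0 with ha0 | ha0
      · filter_upwards [hmem] with w hw using ha0.trans_lt (hθ w hw).1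
      · have : Φ a < v := by
          rw [← (hθ v hv).2]; exact primitive_strictMono hi hpos ha0.le ha
        filter_upwards [hmem, lt_mem_nhds this] with w hw hw2
        exact hlt ha0 (hθ w hw).1 (by rwa [(hθ w hw).2])
    · intro a ha
      have ha0 : 0 < a := (hθ v hv).1.trans ha
      have : v < Φ a := by
        rw [← (hθ v hv).2]; exact primitive_strictMono hi hpos (hθ v hv).1.le ha
      filter_upwards [hmem, gt_mem_nhds this] with w hw hw2
      exact hlt (hθ w hw).1 ha0 (by rwa [(hθ w hw).2])
  · filter_upwards [hmem] with w hw using (hθ w hw).2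

end Primitive

/-! ### The extremal function and functions comparable to it -/

/-- The extremal function of Bliss. -/
def blissExtremal (l t : ℝ) : ℝ := (1 + t ^ l) ^ (-((1 + l) / l))

lemma blissExtremal_pos {l t : ℝ} (ht : 0 ≤ t) : 0 < blissExtremal l t := by
  unfold blissExtremal; positivity

lemma blissExtremal_rpow {p l t : ℝ} (ht : 0 ≤ t) :
    blissExtremal l t ^ p = blissDensity p l t := by
  unfold blissExtremal blissDensity
  rw [← Real.rpow_mul (by positivity)]; congr 1; ring

lemma blissExtremal_eq_blissDensity (l : ℝ) : blissExtremal l = blissDensity 1 l := by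
  ext t; unfold blissExtremal blissDensity; simp

lemma continuousOn_blissExtremal {l : ℝ} (hl : 0 < l) :
    ContinuousOn (blissExtremal l) (Ici 0) := by
  rw [blissExtremal_eq_blissDensity]; exact continuousOn_blissDensity hl

lemma integral_blissExtremal {l x : ℝ} (hl : 0 < l) (hx : 0 ≤ x) :
    ∫ t in (0 : ℝ)..x, blissExtremal l t = x * (1 + x ^ l) ^ (-(1 / l)) := by
  have key : ∀ t ∈ Ioo 0 x, HasDerivAt (fun t => t * (1 + t ^ l) ^ (-(1 / l)))
      (blissExtremal l t) t := by
    intro t ht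
    have ht0 : (0 : ℝ) < t := ht.1
    have hpos : (0 : ℝ) < 1 + t ^ l := by positivity
    have h1 := ((Real.hasDerivAt_rpow_const (x := t) (p := l) (Or.inl ht0.ne')).const_add 1).rpow_const
      (p := -(1 / l)) (Or.inl hpos.ne')
    refine ((hasDerivAt_id' t).mul h1).congr_deriv ?_
    unfold blissExtremal
    rw [show -((1 + l) / l) = -(1 / l) - 1 by field_simp; ring, Real.rpow_sub_one hpos.ne',
      Real.rpow_sub_one ht0.ne']
    field_simp
    ring
  have hcont : ContinuousOn (fun t : ℝ => t * (1 + t ^ l) ^ (-(1 / l))) (Icc 0 x) := by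
    apply continuousOn_id.mul
    apply ContinuousOn.rpow_const
    · exact (continuous_const.add (Real.continuous_rpow_const hl.le)).continuousOn
    · intro t ht
      have := Real.rpow_nonneg ht.1 l
      left; linarith
  rw [intervalIntegral.integral_eq_sub_of_hasDerivAt_of_le hx hcont key]
  · simp
  · apply ContinuousOn.intervalIntegrable
    rw [uIcc_of_le hx]
    exact (continuousOn_blissExtremal hl).mono Icc_subset_Ici_self

/-- The primitive `x * (1 + x ^ l) ^ (-1 / l)` is explicit. The result identifies the target density
of the transport as the left-hand integrand of Bliss' inequality for the extremal itself. -/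
lemma integral_blissExtremal_rpow_mul {p l x : ℝ} (hl : 0 < l) (hx : 0 < x) :
    (∫ t in (0 : ℝ)..x, blissExtremal l t) ^ (p * (1 + l)) * x ^ (-1 - (p - 1) * (1 + l)) =
      x ^ l * blissDensity p l x := by
  have hpos : (0 : ℝ) < 1 + x ^ l := by positivity
  rw [integral_blissExtremal hl hx.le, Real.mul_rpow hx.le (by positivity), blissDensity,
    ← Real.rpow_mul hpos.le, mul_right_comm, ← Real.rpow_add hx]
  congr 2 <;> ring

/-- The integrand of the left-hand side of Bliss' inequality. -/
def blissIntegrand (p l : ℝ) (h : ℝ → ℝ) (x : ℝ) : ℝ :=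
  (∫ t in (0 : ℝ)..x, h t) ^ (p * (1 + l)) * x ^ (-1 - (p - 1) * (1 + l))

/-- Continuous functions on the half-line comparable to the extremal function. -/
structure ComparableToExtremal (l ε M : ℝ) (h : ℝ → ℝ) : Prop where
  cont : ContinuousOn h (Ioi 0)
  le : ∀ x, 0 < x → ε * blissExtremal l x ≤ h x
  ge : ∀ x, 0 < x → h x ≤ M * blissExtremal l x

namespace ComparableToExtremal
variable {p l ε M : ℝ} {h : ℝ → ℝ}

lemma pos (H : ComparableToExtremal l ε M h) (hε : 0 < ε) {x : ℝ} (hx : 0 < x) : 0 < h x :=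
  (mul_pos hε (blissExtremal_pos hx.le)).trans_le (H.le x hx)

lemma const_pos (H : ComparableToExtremal l ε M h) (hε : 0 < ε) : 0 < M :=
  pos_of_mul_pos_left ((H.pos hε one_pos).trans_le (H.ge 1 one_pos))
    (blissExtremal_pos zero_le_one).le

lemma intervalIntegrable_extremal (hl : 0 < l) {x : ℝ} (hx : 0 ≤ x) :
    IntervalIntegrable (blissExtremal l) volume 0 x := by
  apply ContinuousOn.intervalIntegrable
  rw [uIcc_of_le hx]
  exact (continuousOn_blissExtremal hl).mono Icc_subset_Ici_self

lemma intervalIntegrable (H : ComparableToExtremal l ε M h) (hl : 0 < l) (hε : 0 < ε) {x : ℝ}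
    (hx : 0 ≤ x) : IntervalIntegrable h volume 0 x := by
  have h1 := (intervalIntegrable_extremal hl hx).const_mul M
  rw [intervalIntegrable_iff_integrableOn_Ioc_of_le hx] at h1 ⊢
  apply Integrable.mono' h1
  · exact (H.cont.mono Ioc_subset_Ioi_self).aestronglyMeasurable measurableSet_Ioc
  · filter_upwards [ae_restrict_mem measurableSet_Ioc] with t ht
    rw [Real.norm_of_nonneg (H.pos hε ht.1).le]
    exact H.ge t ht.1

lemma le_primitive (H : ComparableToExtremal l ε M h) (hl : 0 < l) (hε : 0 < ε) {x : ℝ}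
    (hx : 0 ≤ x) : ε * ∫ t in (0 : ℝ)..x, blissExtremal l t ≤ ∫ t in (0 : ℝ)..x, h t := by
  rw [← intervalIntegral.integral_const_mul]
  apply intervalIntegral.integral_mono_on_of_le_Ioo hx
    ((intervalIntegrable_extremal hl hx).const_mul _) (H.intervalIntegrable hl hε hx)
  intro t ht
  exact H.le t ht.1

lemma primitive_le (H : ComparableToExtremal l ε M h) (hl : 0 < l) (hε : 0 < ε) {x : ℝ}
    (hx : 0 ≤ x) : ∫ t in (0 : ℝ)..x, h t ≤ M * ∫ t in (0 : ℝ)..x, blissExtremal l t := by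
  rw [← intervalIntegral.integral_const_mul]
  apply intervalIntegral.integral_mono_on_of_le_Ioo hx (H.intervalIntegrable hl hε hx)
    ((intervalIntegrable_extremal hl hx).const_mul _)
  intro t ht
  exact H.ge t ht.1

lemma primitive_extremal_pos (hl : 0 < l) {x : ℝ} (hx : 0 < x) :
    0 < ∫ t in (0 : ℝ)..x, blissExtremal l t := by
  rw [integral_blissExtremal hl hx.le]; positivity

lemma primitive_pos (H : ComparableToExtremal l ε M h) (hl : 0 < l) (hε : 0 < ε) {x : ℝ}
    (hx : 0 < x) : 0 < ∫ t in (0 : ℝ)..x, h t :=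
  (mul_pos hε (primitive_extremal_pos hl hx)).trans_le (H.le_primitive hl hε hx.le)

lemma hasDerivAt_primitive (H : ComparableToExtremal l ε M h) (hl : 0 < l) (hε : 0 < ε) {x : ℝ}
    (hx : 0 < x) : HasDerivAt (fun x => ∫ t in (0 : ℝ)..x, h t) (h x) x := by
  apply intervalIntegral.integral_hasDerivAt_right (H.intervalIntegrable hl hε hx.le)
  · exact H.cont.stronglyMeasurableAtFilter isOpen_Ioi x hx
  · exact H.cont.continuousAt (Ioi_mem_nhds hx)

lemma continuousOn_rpow (H : ComparableToExtremal l ε M h) (hε : 0 < ε) :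
    ContinuousOn (fun x => h x ^ p) (Ioi 0) :=
  H.cont.rpow_const fun _ hx => Or.inl (H.pos hε hx).ne'

lemma integrableOn_rpow (H : ComparableToExtremal l ε M h) (hp : 1 < p) (hl : 0 < l) (hε : 0 < ε) :
    IntegrableOn (fun x => h x ^ p) (Ioi 0) := by
  apply Integrable.mono' ((integrableOn_blissDensity hp hl).const_mul (M ^ p))
  · exact (H.continuousOn_rpow hε).aestronglyMeasurable measurableSet_Ioi
  · filter_upwards [ae_restrict_mem measurableSet_Ioi] with t ht
    have := H.pos hε ht
    have ht' : (0 : ℝ) ≤ t := le_of_lt ht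
    rw [Real.norm_of_nonneg (by positivity), ← blissExtremal_rpow ht',
      ← Real.mul_rpow (H.const_pos hε).le (blissExtremal_pos ht').le]
    exact Real.rpow_le_rpow this.le (H.ge t ht) (by linarith)

lemma continuousOn_blissIntegrand (H : ComparableToExtremal l ε M h) (hl : 0 < l) (hε : 0 < ε) :
    ContinuousOn (blissIntegrand p l h) (Ioi 0) := by
  apply ContinuousOn.mul
  · apply ContinuousOn.rpow_const
    · intro x hx
      exact (H.hasDerivAt_primitive hl hε hx).continuousAt.continuousWithinAt
    · intro x hx
      exact Or.inl (H.primitive_pos hl hε hx).ne'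
  · exact continuousOn_id.rpow_const fun x hx => Or.inl (ne_of_gt hx)

lemma blissIntegrand_pos (H : ComparableToExtremal l ε M h) (hl : 0 < l) (hε : 0 < ε) {x : ℝ}
    (hx : 0 < x) : 0 < blissIntegrand p l h x := by
  have := H.primitive_pos hl hε hx
  unfold blissIntegrand; positivity

lemma blissIntegrand_le (H : ComparableToExtremal l ε M h) (hp : 1 < p) (hl : 0 < l) (hε : 0 < ε)
    {x : ℝ} (hx : 0 < x) :
    blissIntegrand p l h x ≤ M ^ (p * (1 + l)) * (x ^ l * blissDensity p l x) := by
  have h1 := H.primitive_pos hl hε hx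
  rw [← integral_blissExtremal_rpow_mul hl hx, ← mul_assoc,
    ← Real.mul_rpow (H.const_pos hε).le (primitive_extremal_pos hl hx).le, blissIntegrand]
  gcongr
  exact H.primitive_le hl hε hx.le

lemma le_blissIntegrand (H : ComparableToExtremal l ε M h) (hp : 1 < p) (hl : 0 < l) (hε : 0 < ε)
    {x : ℝ} (hx : 0 < x) :
    ε ^ (p * (1 + l)) * (x ^ l * blissDensity p l x) ≤ blissIntegrand p l h x := by
  have h1 := primitive_extremal_pos hl hx
  rw [← integral_blissExtremal_rpow_mul hl hx, ← mul_assoc,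
    ← Real.mul_rpow hε.le h1.le, blissIntegrand]
  gcongr
  exact H.le_primitive hl hε hx.le

lemma integrableOn_blissIntegrand (H : ComparableToExtremal l ε M h) (hp : 1 < p) (hl : 0 < l)
    (hε : 0 < ε) : IntegrableOn (blissIntegrand p l h) (Ioi 0) := by
  apply Integrable.mono' ((integrableOn_rpow_mul_blissDensity hp hl hl.le le_rfl).const_mul
    (M ^ (p * (1 + l))))
  · exact (H.continuousOn_blissIntegrand hl hε).aestronglyMeasurable measurableSet_Ioi
  · filter_upwards [ae_restrict_mem measurableSet_Ioi] with t ht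
    rw [Real.norm_of_nonneg (H.blissIntegrand_pos hl hε ht).le]
    exact H.blissIntegrand_le hp hl hε ht

lemma const_mul (H : ComparableToExtremal l ε M h) {c : ℝ} (hc : 0 < c) :
    ComparableToExtremal l (c * ε) (c * M) (fun x => c * h x) where
  cont := H.cont.const_mul c
  le x hx := by rw [mul_assoc]; exact mul_le_mul_of_nonneg_left (H.le x hx) hc.le
  ge x hx := by rw [mul_assoc]; exact mul_le_mul_of_nonneg_left (H.ge x hx) hc.le

end ComparableToExtremal

/-- Together with the lower bound that follows, this shows that the target mass of `(0, x)` is of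
order `x ^ (1 + l)` for small `x`, which bounds the transport map from below by a multiple of `x`.
-/
lemma primitive_rpow_mul_blissDensity_le {p l x : ℝ} (hp : 1 < p) (hl : 0 < l) (hx : 0 < x) :
    ∫ t in (0 : ℝ)..x, t ^ l * blissDensity p l t ≤ x ^ (1 + l) := by
  have hi := integrableOn_rpow_mul_blissDensity hp hl hl.le le_rfl
  calc ∫ t in (0 : ℝ)..x, t ^ l * blissDensity p l t ≤ ∫ t in (0 : ℝ)..x, x ^ l := by
        apply intervalIntegral.integral_mono_on_of_le_Ioo hx.le
          (intervalIntegrable_zero_of_integrableOn_Ioi hi hx.le) (by simp)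
        intro t ht
        have ht0 : 0 < t := ht.1
        calc t ^ l * blissDensity p l t ≤ t ^ l * 1 := by
              gcongr; exact blissDensity_le_one hp hl ht.1.le
          _ ≤ x ^ l := by rw [mul_one]; exact Real.rpow_le_rpow ht.1.le ht.2.le hl.le
    _ = x ^ (1 + l) := by
        rw [intervalIntegral.integral_const, Real.rpow_add hx]; simp

lemma le_primitive_rpow_mul_blissDensity {p l x : ℝ} (hp : 1 < p) (hl : 0 < l) (hx : 0 < x)
    (hx1 : x ≤ 1) : blissDensity p l 1 / (1 + l) * x ^ (1 + l) ≤
      ∫ t in (0 : ℝ)..x, t ^ l * blissDensity p l t := by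
  have hi := integrableOn_rpow_mul_blissDensity hp hl hl.le le_rfl
  calc _ = ∫ t in (0 : ℝ)..x, t ^ l * blissDensity p l 1 := by
        rw [intervalIntegral.integral_mul_const, integral_rpow (Or.inl (by linarith)),
          Real.zero_rpow (by linarith), add_comm l]; ring
    _ ≤ _ := by
        apply intervalIntegral.integral_mono_on_of_le_Ioo hx.le
        · exact (intervalIntegral.intervalIntegrable_rpow (Or.inl hl.le)).mul_const _
        · exact intervalIntegrable_zero_of_integrableOn_Ioi hi hx.le
        intro t ht
        have ht0 : 0 < t := ht.1
        gcongr
        unfold blissDensity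
        apply Real.rpow_le_rpow_of_nonpos (by positivity)
        · gcongr; linarith [ht.2]
        · rw [neg_nonpos]; positivity

/-! ### Bliss' inequality for comparable functions, by mass transport -/

namespace ComparableToExtremal
variable {p l ε M : ℝ} {h : ℝ → ℝ}

/-- Bliss' inequality for nice functions, normalized. -/
theorem integral_blissDensity_le (H : ComparableToExtremal l ε M h) (hp : 1 < p) (hl : 0 < l)
    (hε : 0 < ε)
    (hN : ∫ x in Ioi 0, blissIntegrand p l h x = ∫ x in Ioi 0, x ^ l * blissDensity p l x) :
    ∫ x in Ioi 0, blissDensity p l x ≤ ∫ x in Ioi 0, h x ^ p := by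
  have hp0 : 0 < p := by linarith
  have hq : 0 < p * (1 + l) := by positivity
  have hql : 0 < p * (1 + l) - l := by nlinarith
  have hM := H.const_pos hε
  have hGi := integrableOn_rpow_mul_blissDensity hp hl hl.le le_rfl
  have hGc : ContinuousOn (fun t => t ^ l * blissDensity p l t) (Ioi 0) :=
    ((Real.continuous_rpow_const hl.le).continuousOn.mul (continuousOn_blissDensity hl)).mono
      Ioi_subset_Ici_self
  have hGpos : ∀ x, 0 < x → 0 < x ^ l * blissDensity p l x := fun x hx =>
    mul_pos (by positivity) (blissDensity_pos hx.le)
  have hEi := integrableOn_blissDensity hp hl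
  have hEc : ContinuousOn (blissDensity p l) (Ioi 0) :=
    (continuousOn_blissDensity hl).mono Ioi_subset_Ici_self
  have hJi := H.integrableOn_blissIntegrand hp hl hε
  have hJc : ContinuousOn (blissIntegrand p l h) (Ioi 0) := H.continuousOn_blissIntegrand hl hε
  have hJpos : ∀ x, 0 < x → 0 < blissIntegrand p l h x := fun x hx => H.blissIntegrand_pos hl hε hx
  obtain ⟨θ, hθ⟩ := exists_quantile hGc hGi hGpos
  set Φ : ℝ → ℝ := fun x => ∫ t in (0 : ℝ)..x, t ^ l * blissDensity p l t with hΦ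
  set J : ℝ → ℝ := fun x => ∫ t in (0 : ℝ)..x, blissIntegrand p l h t with hJ
  set F : ℝ → ℝ := fun x => ∫ t in (0 : ℝ)..x, h t with hF
  set E : ℝ → ℝ := fun x => ∫ t in (0 : ℝ)..x, h t ^ p with hE
  set A : ℝ → ℝ := fun x => ∫ t in (0 : ℝ)..x, blissDensity p l t with hA
  -- By the normalization `hN`, the mass of `(0, x)` never exceeds the total target mass, so the
  -- quantile function applies to it.
  have hJmem : ∀ x, 0 < x → J x ∈ Ioo 0 (∫ t in Ioi 0, t ^ l * blissDensity p l t) := by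
    intro x hx
    exact ⟨_root_.primitive_pos hJi hJpos hx, hN ▸ primitive_lt_integral hJi hJpos hx.le⟩
  have hΦlt : ∀ {x y : ℝ}, 0 < y → Φ x < Φ y → x < y := by
    intro x y hy h
    by_contra! hle
    exact absurd (primitive_mono hGi (fun x hx => (hGpos x hx).le) hy.le hle) (not_le.2 h)
  -- The monotone transport map from the density `blissIntegrand p l h` to `t ^ l * blissDensity p l
  -- t`.
  set y : ℝ → ℝ := fun x => θ (J x) with hy
  have hy0 : ∀ x, 0 < x → 0 < y x := fun x hx => (hθ _ (hJmem x hx)).1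
  have hΦy : ∀ x, 0 < x → Φ (y x) = J x := fun x hx => (hθ _ (hJmem x hx)).2.1
  have hyd : ∀ x, 0 < x → HasDerivAt y
      ((y x ^ l * blissDensity p l (y x))⁻¹ * blissIntegrand p l h x) x := fun x hx =>
    (hθ _ (hJmem x hx)).2.2.comp x (_root_.hasDerivAt_primitive hJc hJi hx)
  set Q : ℝ → ℝ := fun x => y x ^ (-(l * (p - 1) / p)) *
    (F x * x ^ (-((p - 1) / p))) ^ (p * (1 + l) - l) with hQ
  -- By `transport_derivative_le`, `Q'` is at most the derivative of the other terms, so `Ψ`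
  -- increases. The term `A (y x)` appears because the change of variables turns `y ^ (-l) *
  -- blissIntegrand` into `blissDensity` at `y`.
  set Ψ : ℝ → ℝ := fun x => (p * (1 + l) - l) / p * E x - (p - 1) * (1 + l) * J x -
    l * (p - 1) / p * A (y x) - Q x with hΨ
  have hQd : ∀ x, 0 < x → HasDerivAt Q (Q x * (-(l * (p - 1) / p) * (blissIntegrand p l h x *
      y x ^ (-l - 1) * (1 + y x ^ l) ^ (p * (1 + l) / l)) +
      (p * (1 + l) - l) * (h x / F x - (p - 1) / p / x))) x := by
    intro x hx
    have hyx := hy0 x hx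
    have hFx : 0 < F x := H.primitive_pos hl hε hx
    have h1 := (hyd x hx).rpow_const (p := -(l * (p - 1) / p)) (Or.inl hyx.ne')
    have h2 : HasDerivAt (fun x => (F x * x ^ (-((p - 1) / p))) ^ (p * (1 + l) - l))
        ((h x * x ^ (-((p - 1) / p)) + F x * (1 * -((p - 1) / p) * x ^ (-((p - 1) / p) - 1))) *
        (p * (1 + l) - l) * (F x * x ^ (-((p - 1) / p))) ^ (p * (1 + l) - l - 1)) x :=
      ((H.hasDerivAt_primitive hl hε hx).mul
      ((hasDerivAt_id' x).rpow_const (p := -((p - 1) / p)) (Or.inl hx.ne'))).rpow_const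
      (p := p * (1 + l) - l) (Or.inl (by simp only [Pi.mul_apply]; positivity))
    refine (h1.mul h2).congr_deriv ?_
    have e1 : (y x ^ l * blissDensity p l (y x))⁻¹ =
        y x ^ (-l - 1) * (1 + y x ^ l) ^ (p * (1 + l) / l) * y x := by
      have : (0 : ℝ) < 1 + y x ^ l := by positivity
      rw [mul_inv, blissDensity, Real.rpow_neg this.le, inv_inv, ← Real.rpow_neg hyx.le,
        Real.rpow_sub_one hyx.ne']
      field_simp
    rw [e1, Real.rpow_sub_one hyx.ne' (-(l * (p - 1) / p)), Real.rpow_sub_one (x := x) hx.ne',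
      Real.rpow_sub_one (x := F x * x ^ (-((p - 1) / p))) (by positivity)]
    simp only [hQ]
    have hX : (0 : ℝ) < x ^ (-((p - 1) / p)) := by positivity
    generalize x ^ (-((p - 1) / p)) = X at *
    field_simp
    ring
  have hAd : ∀ x, 0 < x → HasDerivAt (fun x => A (y x))
      (y x ^ (-l) * blissIntegrand p l h x) x := by
    intro x hx
    refine ((_root_.hasDerivAt_primitive hEc hEi (hy0 x hx)).comp x (hyd x hx)).congr_deriv ?_
    have := blissDensity_pos (p := p) (l := l) (hy0 x hx).le
    have := hy0 x hx
    rw [Real.rpow_neg this.le]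
    field_simp
  have hΨd : ∀ x, 0 < x → HasDerivAt Ψ ((p * (1 + l) - l) / p * h x ^ p -
      (p - 1) * (1 + l) * blissIntegrand p l h x -
      l * (p - 1) / p * (y x ^ (-l) * blissIntegrand p l h x) -
      Q x * (-(l * (p - 1) / p) * (blissIntegrand p l h x *
      y x ^ (-l - 1) * (1 + y x ^ l) ^ (p * (1 + l) / l)) +
      (p * (1 + l) - l) * (h x / F x - (p - 1) / p / x))) x := by
    intro x hx
    exact ((((_root_.hasDerivAt_primitive (H.continuousOn_rpow hε) (H.integrableOn_rpow hp hl hε) hx).const_mul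
      _).sub ((_root_.hasDerivAt_primitive hJc hJi hx).const_mul _)).sub
      ((hAd x hx).const_mul _)).sub (hQd x hx)
  have hΨmono : MonotoneOn Ψ (Ioi 0) := by
    apply monotoneOn_of_deriv_nonneg (convex_Ioi 0)
    · exact fun x hx => (hΨd x hx).continuousAt.continuousWithinAt
    · rw [interior_Ioi]
      exact fun x hx => (hΨd x hx).differentiableAt.differentiableWithinAt
    · rw [interior_Ioi]
      intro x hx
      rw [(hΨd x hx).deriv, sub_nonneg]
      exact transport_derivative_le hp hl (H.primitive_pos hl hε hx) (H.pos hε hx).le hx (hy0 x hx)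
  have hy_zero : Tendsto y (𝓝[>] 0) (𝓝[>] 0) := by
    rw [tendsto_nhdsWithin_iff]
    refine ⟨?_, by filter_upwards [self_mem_nhdsWithin] with x hx using hy0 x hx⟩
    rw [tendsto_order]
    constructor
    · intro a ha
      filter_upwards [self_mem_nhdsWithin] with x hx using ha.trans (hy0 x hx)
    · intro a ha
      filter_upwards [self_mem_nhdsWithin, (tendsto_primitive_zero hJi).eventually_lt_const
        (_root_.primitive_pos hGi hGpos ha)] with x hx hx2
      exact hΦlt ha (by rw [hΦy x hx]; exact hx2)
  have hQ_zero : Tendsto Q (𝓝[>] 0) (𝓝 0) := by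
    -- For small `x`, the lower bound `ε * blissExtremal l ≤ h` gives `J x ≥ c * x ^ (1 + l)`, while
    -- `Φ (y x) ≤ y x ^ (1 + l)`. Hence `y` is at least a multiple of `x`, as needed for the
    -- negative power of `y` in `Q`.
    set c : ℝ := ε ^ (p * (1 + l)) * (blissDensity p l 1 / (1 + l)) with hc
    have hc0 : 0 < c := by
      have := blissDensity_pos (p := p) (l := l) zero_le_one
      positivity
    have hy_ge : ∀ x, 0 < x → x ≤ 1 → c ^ (1 / (1 + l)) * x ≤ y x := by
      intro x hx hx1
      have h1 : c * x ^ (1 + l) ≤ y x ^ (1 + l) := by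
        calc c * x ^ (1 + l) = ε ^ (p * (1 + l)) * (blissDensity p l 1 / (1 + l) * x ^ (1 + l)) := by
              rw [hc]; ring
          _ ≤ ε ^ (p * (1 + l)) * Φ x := by
              gcongr; exact le_primitive_rpow_mul_blissDensity hp hl hx hx1
          _ ≤ J x := by
              rw [hΦ, hJ]; simp only
              rw [← intervalIntegral.integral_const_mul]
              apply intervalIntegral.integral_mono_on_of_le_Ioo hx.le
                ((intervalIntegrable_zero_of_integrableOn_Ioi hGi hx.le).const_mul _)
                (intervalIntegrable_zero_of_integrableOn_Ioi hJi hx.le)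
              exact fun t ht => H.le_blissIntegrand hp hl hε ht.1
          _ = Φ (y x) := (hΦy x hx).symm
          _ ≤ _ := primitive_rpow_mul_blissDensity_le hp hl (hy0 x hx)
      have h2 := Real.rpow_le_rpow (by positivity) h1 (z := 1 / (1 + l)) (by positivity)
      rwa [Real.mul_rpow hc0.le (by positivity), ← Real.rpow_mul hx.le,
        ← Real.rpow_mul (hy0 x hx).le, mul_one_div_cancel (by positivity), Real.rpow_one,
        Real.rpow_one] at h2
    apply squeeze_zero' (g := fun x => ((c ^ (1 / (1 + l))) ^ (-(l * (p - 1) / p)) *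
      M ^ (p * (1 + l) - l)) * x)
    · filter_upwards [self_mem_nhdsWithin] with x hx
      have := hy0 x hx
      have hFx : 0 < F x := H.primitive_pos hl hε hx
      have : (0 : ℝ) < x := hx
      positivity
    · filter_upwards [self_mem_nhdsWithin, Ioc_mem_nhdsGT zero_lt_one] with x hx hx1
      have hx0 : (0 : ℝ) < x := hx
      have hyx := hy0 x hx
      have hFx : 0 < F x := H.primitive_pos hl hε hx
      have hFle : F x ≤ M * x := by
        refine (H.primitive_le hl hε hx0.le).trans ?_
        gcongr
        rw [integral_blissExtremal hl hx0.le]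
        apply mul_le_of_le_one_right hx0.le
        apply Real.rpow_le_one_of_one_le_of_nonpos
        · have := Real.rpow_nonneg hx0.le l; linarith
        · rw [neg_nonpos]; positivity
      have hl0 : 0 ≤ l * (p - 1) / p := div_nonneg (mul_nonneg hl.le (by linarith)) hp0.le
      -- With `F x ≤ M * x` and the lower bound on `y`, all powers of `x` combine to the first
      -- power, so `Q` tends to `0`.
      calc Q x ≤ (c ^ (1 / (1 + l)) * x) ^ (-(l * (p - 1) / p)) *
            (M * x * x ^ (-((p - 1) / p))) ^ (p * (1 + l) - l) := by
              simp only [hQ]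
              gcongr ?_ * ?_
              · exact Real.rpow_le_rpow_of_nonpos (by positivity) (hy_ge x hx0 hx1.2)
                  (neg_nonpos.2 hl0)
              · gcongr
        _ = _ := by
              rw [mul_assoc M, Real.mul_rpow (by positivity) hx0.le,
                Real.mul_rpow hM.le (by positivity)]
              have e1 : x * x ^ (-((p - 1) / p)) = x ^ (1 / p) := by
                nth_rw 1 [← Real.rpow_one x]
                rw [← Real.rpow_add hx0]; congr 1; field_simp; ring
              have e2 : x ^ (-(l * (p - 1) / p)) * (x ^ (1 / p)) ^ (p * (1 + l) - l) = x := by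
                rw [← Real.rpow_mul hx0.le, ← Real.rpow_add hx0]
                conv_rhs => rw [← Real.rpow_one x]
                congr 1; field_simp; ring
              rw [e1]
              calc _ = (c ^ (1 / (1 + l))) ^ (-(l * (p - 1) / p)) * M ^ (p * (1 + l) - l) *
                  (x ^ (-(l * (p - 1) / p)) * (x ^ (1 / p)) ^ (p * (1 + l) - l)) := by ring
                _ = _ := by rw [e2]
    · have : Tendsto (fun x : ℝ => ((c ^ (1 / (1 + l))) ^ (-(l * (p - 1) / p)) *
        M ^ (p * (1 + l) - l)) * x) (𝓝 0) (𝓝 (((c ^ (1 / (1 + l))) ^ (-(l * (p - 1) / p)) *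
        M ^ (p * (1 + l) - l)) * 0)) := tendsto_id.const_mul _
      rw [mul_zero] at this
      exact this.mono_left nhdsWithin_le_nhds
  have hΨ_zero : Tendsto Ψ (𝓝[>] 0) (𝓝 0) := by
    have := ((((tendsto_primitive_zero (H.integrableOn_rpow hp hl hε)).const_mul
      ((p * (1 + l) - l) / p)).sub ((tendsto_primitive_zero hJi).const_mul
      ((p - 1) * (1 + l)))).sub (((tendsto_primitive_zero hEi).comp hy_zero).const_mul
      (l * (p - 1) / p))).sub hQ_zero
    simpa using this
  have hΨ_nonneg : ∀ x, 0 < x → 0 ≤ Ψ x := by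
    intro x hx
    apply le_of_tendsto hΨ_zero
    filter_upwards [self_mem_nhdsWithin, Ioc_mem_nhdsGT hx] with t ht htx
    exact hΨmono ht hx htx.2
  have hy_top : Tendsto y atTop atTop := by
    rw [tendsto_atTop]
    intro b
    have hb : 0 < max b 1 := lt_max_of_lt_right one_pos
    have := (tendsto_primitive_atTop hJi).eventually_const_lt
      (u := Φ (max b 1)) (by rw [hN]; exact primitive_lt_integral hGi hGpos hb.le)
    filter_upwards [this, eventually_gt_atTop 0] with x hx hx0
    exact (le_max_left b 1).trans (hΦlt (hy0 x hx0) (by rw [hΦy x hx0]; exact hx)).le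
  have hlim := (((tendsto_primitive_atTop (H.integrableOn_rpow hp hl hε)).const_mul
      ((p * (1 + l) - l) / p)).sub ((tendsto_primitive_atTop hJi).const_mul
      ((p - 1) * (1 + l)))).sub (((tendsto_primitive_atTop hEi).comp hy_top).const_mul
      (l * (p - 1) / p))
  -- At infinity only `Q ≥ 0` is used, so no asymptotics of `Q` are needed there.
  have hfin := ge_of_tendsto hlim (b := 0) (by
    filter_upwards [eventually_gt_atTop 0] with x hx
    have h1 := hΨ_nonneg x hx
    have h2 : 0 ≤ Q x := by
      have := hy0 x hx
      have hFx : 0 < F x := H.primitive_pos hl hε hx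
      positivity
    simp only [hΨ] at h1
    simp only [Function.comp]
    linarith)
  rw [hN, ← integral_blissDensity_eq hp hl] at hfin
  -- By `integral_blissDensity_eq` the `J` term is the integral of `blissDensity`; adding it to the
  -- `A` term gives exactly the coefficient of the `E` term.
  have h3 : (p * (1 + l) - l) / p * ∫ x in Ioi 0, blissDensity p l x ≤
      (p * (1 + l) - l) / p * ∫ x in Ioi 0, h x ^ p := by
    have : (p * (1 + l) - l) / p = 1 + l * (p - 1) / p := by field_simp; ring
    nth_rw 1 [this]
    linarith
  exact le_of_mul_le_mul_left h3 (by positivity)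

/-- Bliss' inequality for nice functions. -/
theorem integral_blissIntegrand_le (H : ComparableToExtremal l ε M h) (hp : 1 < p) (hl : 0 < l)
    (hε : 0 < ε) :
    ∫ x in Ioi 0, blissIntegrand p l h x ≤ (∫ x in Ioi 0, x ^ l * blissDensity p l x) /
      (∫ x in Ioi 0, blissDensity p l x) ^ (1 + l) * (∫ x in Ioi 0, h x ^ p) ^ (1 + l) := by
  have hq : 0 < p * (1 + l) := by positivity
  have hGi := integrableOn_rpow_mul_blissDensity hp hl hl.le le_rfl
  have hGpos : ∀ x, 0 < x → 0 < x ^ l * blissDensity p l x := fun x hx =>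
    mul_pos (by positivity) (blissDensity_pos hx.le)
  have hJ := (_root_.primitive_pos (H.integrableOn_blissIntegrand hp hl hε)
    (fun x hx => H.blissIntegrand_pos hl hε hx) one_pos).trans (primitive_lt_integral
    (H.integrableOn_blissIntegrand hp hl hε) (fun x hx => H.blissIntegrand_pos hl hε hx) zero_le_one)
  have hG := (_root_.primitive_pos hGi hGpos one_pos).trans (primitive_lt_integral hGi hGpos zero_le_one)
  have hE := (_root_.primitive_pos (integrableOn_blissDensity hp hl)
    (fun x hx => blissDensity_pos hx.le) one_pos).trans (primitive_lt_integral
    (integrableOn_blissDensity hp hl) (fun x hx => blissDensity_pos hx.le) zero_le_one)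
  set N := ∫ x in Ioi 0, blissIntegrand p l h x
  set G := ∫ x in Ioi 0, x ^ l * blissDensity p l x
  set E₀ := ∫ x in Ioi 0, blissDensity p l x
  -- The left-hand side is homogeneous of degree `p * (1 + l)`, so scaling `h` by `c` achieves the
  -- normalization.
  set c := (G / N) ^ (1 / (p * (1 + l))) with hc
  have hc0 : 0 < c := by positivity
  have hcq : c ^ (p * (1 + l)) = G / N := by
    rw [hc, ← Real.rpow_mul (by positivity), one_div_mul_cancel hq.ne', Real.rpow_one]
  have h1 := (H.const_mul hc0).integral_blissDensity_le hp hl (mul_pos hc0 hε) (by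
    have : ∀ x ∈ Ioi (0 : ℝ), blissIntegrand p l (fun x => c * h x) x =
        c ^ (p * (1 + l)) * blissIntegrand p l h x := by
      intro x hx
      unfold blissIntegrand
      rw [intervalIntegral.integral_const_mul, Real.mul_rpow hc0.le (H.primitive_pos hl hε hx).le,
        mul_assoc]
    rw [setIntegral_congr_fun measurableSet_Ioi this, integral_const_mul, hcq]
    exact div_mul_cancel₀ _ hJ.ne')
  have h2 : ∫ x in Ioi 0, (c * h x) ^ p = c ^ p * ∫ x in Ioi 0, h x ^ p := by
    rw [← integral_const_mul]
    apply setIntegral_congr_fun measurableSet_Ioi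
    intro x hx
    exact Real.mul_rpow hc0.le (H.pos hε hx).le
  rw [h2] at h1
  have hEh : 0 ≤ ∫ x in Ioi 0, h x ^ p := by
    apply setIntegral_nonneg measurableSet_Ioi
    intro x hx
    have := H.pos hε hx
    positivity
  have h3 := Real.rpow_le_rpow hE.le h1 (z := 1 + l) (by linarith)
  rw [Real.mul_rpow (by positivity) hEh, ← Real.rpow_mul hc0.le, hcq] at h3
  rw [div_mul_eq_mul_div, le_div_iff₀ (by positivity)]
  calc _ ≤ N * (G / N * (∫ x in Ioi 0, h x ^ p) ^ (1 + l)) := by gcongr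
    _ = _ := by field_simp

end ComparableToExtremal

/-! ### Bliss' inequality for measurable functions -/

/-- The sharp constant (to the power `q = p (1 + l)`) in Bliss' inequality. -/
def blissConst (p l : ℝ) : ℝ :=
  (∫ x in Ioi 0, x ^ l * blissDensity p l x) / (∫ x in Ioi 0, blissDensity p l x) ^ (1 + l)

lemma integral_blissDensity_pos {p l : ℝ} (hp : 1 < p) (hl : 0 < l) :
    0 < ∫ x in Ioi 0, blissDensity p l x :=
  (primitive_pos (integrableOn_blissDensity hp hl) (fun _ hx => blissDensity_pos hx.le)
    one_pos).trans (primitive_lt_integral (integrableOn_blissDensity hp hl)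
    (fun _ hx => blissDensity_pos hx.le) zero_le_one)

lemma blissConst_pos {p l : ℝ} (hp : 1 < p) (hl : 0 < l) : 0 < blissConst p l := by
  have h1 := integral_blissDensity_pos hp hl
  have h2 := integral_blissDensity_eq hp hl
  have h3 : 0 < (p - 1) * (1 + l) := mul_pos (by linarith) (by linarith)
  have h4 : 0 < ∫ x in Ioi 0, x ^ l * blissDensity p l x := by
    rw [h2] at h1
    exact (pos_iff_pos_of_mul_pos h1).1 h3
  unfold blissConst; positivity

lemma eLpNorm_rpow_eq_lintegral {α E : Type*} [MeasurableSpace α] [NormedAddCommGroup E]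
    {μ : Measure α} {p : ℝ} (hp : 0 < p) (f : α → E) (r : ℝ) :
    eLpNorm f (ENNReal.ofReal p) μ ^ r = (∫⁻ x, ‖f x‖ₑ ^ p ∂μ) ^ (r / p) := by
  rw [eLpNorm_eq_lintegral_rpow_enorm_toReal (by simpa using hp) ENNReal.ofReal_ne_top,
    ENNReal.toReal_ofReal hp.le, ← ENNReal.rpow_mul]
  congr 1; ring

namespace ComparableToExtremal
variable {p l ε M : ℝ} {h : ℝ → ℝ}

lemma lintegral_Ioo (H : ComparableToExtremal l ε M h) (hl : 0 < l) (hε : 0 < ε)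
    {x : ℝ} (hx : 0 < x) :
    ∫⁻ t in Ioo 0 x, ‖h t‖ₑ = ENNReal.ofReal (∫ t in (0 : ℝ)..x, h t) := by
  rw [intervalIntegral.integral_of_le hx.le, integral_Ioc_eq_integral_Ioo,
    ofReal_integral_eq_lintegral_ofReal]
  · apply setLIntegral_congr_fun measurableSet_Ioo
    intro t ht
    exact Real.enorm_of_nonneg (H.pos hε ht.1).le
  · exact ((intervalIntegrable_iff_integrableOn_Ioc_of_le hx.le).1
      (H.intervalIntegrable hl hε hx.le)).mono_set Ioo_subset_Ioc_self
  · filter_upwards [ae_restrict_mem measurableSet_Ioo] with t ht using (H.pos hε ht.1).le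

lemma lintegral_blissIntegrand (H : ComparableToExtremal l ε M h) (hp : 1 < p) (hl : 0 < l)
    (hε : 0 < ε) :
    ∫⁻ x in Ioi 0, (∫⁻ t in Ioo 0 x, ‖h t‖ₑ) ^ (p * (1 + l)) *
      ENNReal.ofReal (x ^ (-1 - (p - 1) * (1 + l))) =
    ENNReal.ofReal (∫ x in Ioi 0, blissIntegrand p l h x) := by
  rw [ofReal_integral_eq_lintegral_ofReal (H.integrableOn_blissIntegrand hp hl hε)]
  · apply setLIntegral_congr_fun measurableSet_Ioi
    intro x hx
    have := H.primitive_pos hl hε hx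
    simp only [blissIntegrand]
    rw [H.lintegral_Ioo hl hε hx, ENNReal.ofReal_rpow_of_pos this,
      ← ENNReal.ofReal_mul (by positivity)]
  · filter_upwards [ae_restrict_mem measurableSet_Ioi] with t ht
      using (H.blissIntegrand_pos hl hε ht).le

lemma lintegral_rpow (H : ComparableToExtremal l ε M h) (hp : 1 < p) (hl : 0 < l)
    (hε : 0 < ε) :
    ∫⁻ x in Ioi 0, ‖h x‖ₑ ^ p = ENNReal.ofReal (∫ x in Ioi 0, h x ^ p) := by
  rw [ofReal_integral_eq_lintegral_ofReal (H.integrableOn_rpow hp hl hε)]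
  · apply setLIntegral_congr_fun measurableSet_Ioi
    intro x hx
    simp only
    rw [Real.enorm_of_nonneg (H.pos hε hx).le, ENNReal.ofReal_rpow_of_pos (H.pos hε hx)]
  · filter_upwards [ae_restrict_mem measurableSet_Ioi] with t ht
    have := H.pos hε ht
    simp only [Pi.zero_apply]; positivity

lemma lintegral_bliss_le (H : ComparableToExtremal l ε M h) (hp : 1 < p) (hl : 0 < l)
    (hε : 0 < ε) :
    ∫⁻ x in Ioi 0, (∫⁻ t in Ioo 0 x, ‖h t‖ₑ) ^ (p * (1 + l)) *
      ENNReal.ofReal (x ^ (-1 - (p - 1) * (1 + l))) ≤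
    ENNReal.ofReal (blissConst p l) *
      eLpNorm h (ENNReal.ofReal p) (volume.restrict (Ioi 0)) ^ (p * (1 + l)) := by
  have hp0 : 0 < p := by linarith
  have h0 : 0 ≤ ∫ x in Ioi 0, h x ^ p := by
    apply setIntegral_nonneg measurableSet_Ioi
    intro x hx
    have := H.pos hε hx
    positivity
  rw [H.lintegral_blissIntegrand hp hl hε, eLpNorm_rpow_eq_lintegral hp0,
    H.lintegral_rpow hp hl hε, show p * (1 + l) / p = 1 + l by field_simp,
    ENNReal.ofReal_rpow_of_nonneg h0 (by linarith), ← ENNReal.ofReal_mul (blissConst_pos hp hl).le]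
  exact ENNReal.ofReal_le_ofReal (H.integral_blissIntegrand_le hp hl hε)

end ComparableToExtremal

lemma comparableToExtremal_extremal {l : ℝ} (hl : 0 < l) :
    ComparableToExtremal l 1 1 (blissExtremal l) where
  cont := (continuousOn_blissExtremal hl).mono Ioi_subset_Ici_self
  le x _ := by simp
  ge x _ := by simp

/-- On a compact interval containing the non-negative part of the support, `|k| / blissExtremal l`
is continuous, hence bounded. The added multiple of the extremal supplies the lower bound. -/
lemma comparableToExtremal_abs_add {l δ : ℝ} (hl : 0 < l) {k : ℝ → ℝ} (hk : Continuous k)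
    (hks : HasCompactSupport k) :
    ∃ M, ComparableToExtremal l δ M (fun t => |k t| + δ * blissExtremal l t) := by
  obtain ⟨C, hC⟩ : ∃ C, ∀ x, 0 ≤ x → |k x| ≤ C * blissExtremal l x := by
    obtain ⟨R, hR0, hR⟩ := hks.isCompact.isBounded.subset_closedBall_lt 0 0
    have hcont : ContinuousOn (fun t => |k t| / blissExtremal l t) (Icc 0 R) :=
      hk.abs.continuousOn.div ((continuousOn_blissExtremal hl).mono Icc_subset_Ici_self)
        fun x hx => (blissExtremal_pos hx.1).ne'
    obtain ⟨C, hC⟩ := isCompact_Icc.bddAbove_image hcont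
    have hC' : ∀ x ∈ Icc 0 R, |k x| / blissExtremal l x ≤ C := fun x hx => hC ⟨x, hx, rfl⟩
    refine ⟨C, fun x hx => ?_⟩
    have hC0 : 0 ≤ C := (div_nonneg (abs_nonneg _)
      (blissExtremal_pos (l := l) le_rfl).le).trans (hC' 0 ⟨le_rfl, hR0.le⟩)
    rcases le_or_gt x R with hxR | hxR
    · rw [← div_le_iff₀ (blissExtremal_pos hx)]
      exact hC' x ⟨hx, hxR⟩
    · have : k x = 0 := by
        by_contra hne
        have := hR (subset_tsupport k hne)
        rw [mem_closedBall_zero_iff, Real.norm_of_nonneg hx] at this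
        linarith
      rw [this, abs_zero]
      exact mul_nonneg hC0 (blissExtremal_pos hx).le
  refine ⟨C + δ, ⟨?_, ?_, ?_⟩⟩
  · exact hk.abs.continuousOn.add ((continuousOn_const.mul (continuousOn_blissExtremal hl)).mono
      Ioi_subset_Ici_self)
  · intro x hx
    have := abs_nonneg (k x)
    linarith
  · intro x hx
    have := hC x (le_of_lt hx)
    linarith

/-- Hölder's inequality against `1` on `(0, x)`. It turns an `L^p` approximation error into a
pointwise error for the primitives. -/
lemma lintegral_Ioo_enorm_le {p x : ℝ} (hp : 1 ≤ p) {f : ℝ → ℝ}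
    (hf : AEStronglyMeasurable f (volume.restrict (Ioi 0))) :
    ∫⁻ t in Ioo 0 x, ‖f t‖ₑ ≤ eLpNorm f (ENNReal.ofReal p) (volume.restrict (Ioi 0)) *
      ENNReal.ofReal x ^ (1 - 1 / p) := by
  have h1 : volume.restrict (Ioo 0 x) ≤ volume.restrict (Ioi 0) :=
    Measure.restrict_mono Ioo_subset_Ioi_self le_rfl
  rw [← eLpNorm_one_eq_lintegral_enorm]
  refine (eLpNorm_le_eLpNorm_mul_rpow_measure_univ (q := ENNReal.ofReal p)
    (by simpa using hp) (hf.mono_measure h1)).trans ?_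
  rw [ENNReal.toReal_ofReal (by linarith), Measure.restrict_apply_univ, Real.volume_Ioo, sub_zero]
  simp only [ENNReal.toReal_one, div_one]
  gcongr

lemma measurable_lintegral_Ioo {f : ℝ → ℝ≥0∞} (hf : Measurable f) :
    Measurable fun x => ∫⁻ t in Ioo 0 x, f t := by
  have : (fun x => ∫⁻ t in Ioo 0 x, f t) = fun x => ∫⁻ t, {z : ℝ × ℝ | 0 < z.2 ∧ z.2 < z.1}.indicator
      (fun z => f z.2) (x, t) := by
    ext x
    rw [← lintegral_indicator measurableSet_Ioo]
    rfl
  rw [this]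
  apply Measurable.lintegral_prod_right'
  exact (hf.comp measurable_snd).indicator ((measurableSet_lt measurable_const measurable_snd).inter
    (measurableSet_lt measurable_snd measurable_fst))

/-- **Bliss' inequality** for real functions. -/
theorem lintegral_bliss_le_eLpNorm {p l : ℝ} (hp : 1 < p) (hl : 0 < l) {f : ℝ → ℝ}
    (hfm : Measurable f) (hf : MemLp f (ENNReal.ofReal p) (volume.restrict (Ioi 0))) :
    ∫⁻ x in Ioi 0, (∫⁻ t in Ioo 0 x, ‖f t‖ₑ) ^ (p * (1 + l)) *
      ENNReal.ofReal (x ^ (-1 - (p - 1) * (1 + l))) ≤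
    ENNReal.ofReal (blissConst p l) *
      eLpNorm f (ENNReal.ofReal p) (volume.restrict (Ioi 0)) ^ (p * (1 + l)) := by
  have hp0 : 0 < p := by linarith
  have hq : 0 < p * (1 + l) := by positivity
  have hp1 : 1 ≤ ENNReal.ofReal p := by simpa using hp.le
  set μ : Measure ℝ := volume.restrict (Ioi 0) with hμ
  set g := blissExtremal l
  have hgm : MemLp g (ENNReal.ofReal p) μ := by
    refine ⟨((continuousOn_blissExtremal hl).mono Ioi_subset_Ici_self).aestronglyMeasurable
      measurableSet_Ioi, ?_⟩
    rw [← ENNReal.rpow_lt_top_iff_of_pos hp0, eLpNorm_rpow_eq_lintegral hp0,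
      (comparableToExtremal_extremal hl).lintegral_rpow hp hl one_pos]
    exact ENNReal.rpow_lt_top_of_nonneg (by positivity) ENNReal.ofReal_ne_top
  set δ : ℕ → ℝ := fun n => 1 / (n + 1) with hδ
  have hδ0 : ∀ n, 0 < δ n := fun n => by positivity
  have hδlim : Tendsto δ atTop (𝓝 0) := tendsto_one_div_add_atTop_nhds_zero_nat
  have hδlim' : Tendsto (fun n => ENNReal.ofReal (δ n)) atTop (𝓝 0) := by
    simpa [Function.comp_def] using (ENNReal.continuous_ofReal.tendsto 0).comp hδlim
  have hfi : MemLp ((Ioi (0 : ℝ)).indicator f) (ENNReal.ofReal p) volume :=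
    (memLp_indicator_iff_restrict measurableSet_Ioi).2 hf
  have hex : ∀ n, ∃ k : ℝ → ℝ, HasCompactSupport k ∧ Continuous k ∧
      eLpNorm (f - k) (ENNReal.ofReal p) μ ≤ ENNReal.ofReal (δ n) := by
    intro n
    obtain ⟨k, hks, hk, hkc, -⟩ := hfi.exists_hasCompactSupport_eLpNorm_sub_le
      ENNReal.ofReal_ne_top (ε := ENNReal.ofReal (δ n)) (by simpa using hδ0 n)
    refine ⟨k, hks, hkc, le_trans (le_of_eq_of_le ?_ (eLpNorm_mono_measure _
      (Measure.restrict_le_self (s := Ioi 0)))) hk⟩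
    apply eLpNorm_congr_ae
    filter_upwards [ae_restrict_mem measurableSet_Ioi] with t ht
    simp [indicator_of_mem ht]
  choose k hks hkc hkn using hex
  -- Compactly supported approximations of `f`, made comparable to the extremal at a cost that
  -- vanishes with `δ n`.
  set h : ℕ → ℝ → ℝ := fun n t => |k n t| + δ n * g t with hh
  have hcomp : ∀ n, ∃ M, ComparableToExtremal l (δ n) M (h n) := fun n =>
    comparableToExtremal_abs_add hl (hkc n) (hks n)
  choose M hM using hcomp
  set N := eLpNorm f (ENNReal.ofReal p) μ with hN
  have hnorm : ∀ n, eLpNorm (h n) (ENNReal.ofReal p) μ ≤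
      N + ENNReal.ofReal (δ n) * (1 + eLpNorm g (ENNReal.ofReal p) μ) := by
    intro n
    have hkm : AEStronglyMeasurable (k n) μ := (hkc n).aestronglyMeasurable
    have h1 : eLpNorm (k n) (ENNReal.ofReal p) μ ≤ N + ENNReal.ofReal (δ n) := by
      have : k n = f - (f - k n) := by simp
      rw [this]
      exact (eLpNorm_sub_le hf.1 (hf.1.sub hkm) hp1).trans (by gcongr; exact hkn n)
    have h2 : h n = (fun t => ‖k n t‖) + δ n • g := by
      ext t; simp [hh]
    rw [h2]
    refine (eLpNorm_add_le hkm.norm (hgm.1.const_smul _) hp1).trans ?_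
    rw [eLpNorm_norm, eLpNorm_const_smul, Real.enorm_of_nonneg (hδ0 n).le]
    calc _ ≤ N + ENNReal.ofReal (δ n) + ENNReal.ofReal (δ n) * eLpNorm g (ENNReal.ofReal p) μ := by
          gcongr
      _ = _ := by ring
  have hF : ∀ n x, ∫⁻ t in Ioo 0 x, ‖f t‖ₑ ≤ (∫⁻ t in Ioo 0 x, ‖h n t‖ₑ) +
      ENNReal.ofReal (δ n) * ENNReal.ofReal x ^ (1 - 1 / p) := by
    intro n x
    calc ∫⁻ t in Ioo 0 x, ‖f t‖ₑ ≤ ∫⁻ t in Ioo 0 x, (‖(f - k n) t‖ₑ + ‖h n t‖ₑ) := by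
          apply setLIntegral_mono' measurableSet_Ioo
          intro t ht
          calc ‖f t‖ₑ = ‖(f t - k n t) + k n t‖ₑ := by rw [sub_add_cancel]
            _ ≤ ‖f t - k n t‖ₑ + ‖k n t‖ₑ := enorm_add_le _ _
            _ ≤ _ := by
              gcongr
              · rfl
              · rw [enorm_le_iff_norm_le]
                have h1 : 0 < g t := blissExtremal_pos ht.1.le
                have h2 := mul_pos (hδ0 n) h1
                rw [Real.norm_eq_abs, Real.norm_eq_abs]
                refine le_trans ?_ (le_abs_self _)
                simp only [hh]; linarith
      _ = (∫⁻ t in Ioo 0 x, ‖(f - k n) t‖ₑ) + ∫⁻ t in Ioo 0 x, ‖h n t‖ₑ :=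
          lintegral_add_left (hfm.sub (hkc n).measurable).enorm _
      _ ≤ _ := by
          rw [add_comm]
          gcongr
          refine (lintegral_Ioo_enorm_le hp.le (hf.1.sub (hkc n).aestronglyMeasurable)).trans ?_
          gcongr
          exact hkn n
  set c := ENNReal.ofReal (blissConst p l)
  -- Truncated subtraction of the pointwise error keeps `G n` below the Bliss integrand of `h n`,
  -- while `G n` still converges to the integrand of `f`; Fatou's lemma then passes to the limit.
  set G : ℕ → ℝ → ℝ≥0∞ := fun n x => ((∫⁻ t in Ioo 0 x, ‖f t‖ₑ) -
      ENNReal.ofReal (δ n) * ENNReal.ofReal x ^ (1 - 1 / p)) ^ (p * (1 + l)) *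
      ENNReal.ofReal (x ^ (-1 - (p - 1) * (1 + l))) with hG
  have hGle : ∀ n, ∫⁻ x in Ioi 0, G n x ≤
      c * (N + ENNReal.ofReal (δ n) * (1 + eLpNorm g (ENNReal.ofReal p) μ)) ^ (p * (1 + l)) := by
    intro n
    calc ∫⁻ x in Ioi 0, G n x ≤ ∫⁻ x in Ioi 0, (∫⁻ t in Ioo 0 x, ‖h n t‖ₑ) ^ (p * (1 + l)) *
          ENNReal.ofReal (x ^ (-1 - (p - 1) * (1 + l))) := by
          apply lintegral_mono
          intro x
          simp only [hG]
          gcongr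
          exact tsub_le_iff_right.2 (hF n x)
      _ ≤ _ := (hM n).lintegral_bliss_le hp hl (hδ0 n)
      _ ≤ _ := by gcongr; exact hnorm n
  have hGlim : ∀ x, Tendsto (fun n => G n x) atTop (𝓝 ((∫⁻ t in Ioo 0 x, ‖f t‖ₑ) ^ (p * (1 + l)) *
      ENNReal.ofReal (x ^ (-1 - (p - 1) * (1 + l))))) := by
    intro x
    have hx : ENNReal.ofReal x ^ (1 - 1 / p) ≠ ⊤ :=
      ENNReal.rpow_ne_top_of_nonneg (by rw [sub_nonneg, div_le_one hp0]; exact hp.le)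
        ENNReal.ofReal_ne_top
    have h1 : Tendsto (fun n => ENNReal.ofReal (δ n) * ENNReal.ofReal x ^ (1 - 1 / p)) atTop
        (𝓝 0) := by
      simpa using ENNReal.Tendsto.mul_const hδlim' (Or.inr hx)
    have h2 := ENNReal.Tendsto.sub (tendsto_const_nhds (x := ∫⁻ t in Ioo 0 x, ‖f t‖ₑ)
      (f := (atTop : Filter ℕ))) h1 (Or.inr ENNReal.zero_ne_top)
    rw [tsub_zero] at h2
    exact ENNReal.Tendsto.mul_const ((ENNReal.continuous_rpow_const.tendsto _).comp h2)
      (Or.inr ENNReal.ofReal_ne_top)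
  have hGm : ∀ n, Measurable (G n) := by
    intro n
    have := measurable_lintegral_Ioo hfm.enorm
    simp only [hG]
    fun_prop
  calc _ = ∫⁻ x in Ioi 0, liminf (fun n => G n x) atTop := by
        simp_rw [fun x => (hGlim x).liminf_eq]; rfl
    _ ≤ liminf (fun n => ∫⁻ x in Ioi 0, G n x) atTop := lintegral_liminf_le hGm
    _ ≤ liminf (fun n => c * (N + ENNReal.ofReal (δ n) *
        (1 + eLpNorm g (ENNReal.ofReal p) μ)) ^ (p * (1 + l))) atTop :=
      liminf_le_liminf (Eventually.of_forall hGle)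
    _ = c * N ^ (p * (1 + l)) := by
      apply Tendsto.liminf_eq
      apply ENNReal.Tendsto.const_mul _ (Or.inr ENNReal.ofReal_ne_top)
      apply (ENNReal.continuous_rpow_const.tendsto _).comp
      have h1 : Tendsto (fun n => ENNReal.ofReal (δ n) * (1 + eLpNorm g (ENNReal.ofReal p) μ)) atTop
          (𝓝 0) := by
        simpa using ENNReal.Tendsto.mul_const hδlim'
          (Or.inr (ENNReal.add_ne_top.2 ⟨ENNReal.one_ne_top, hgm.2.ne⟩))
      simpa using h1.const_add N

/-- **Bliss' inequality**. -/
theorem lintegral_bliss_le {p l : ℝ} (hp : 1 < p) (hl : 0 < l) {f : ℝ → ℝ≥0∞}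
    (hf : Measurable f) :
    ∫⁻ x in Ioi 0, (∫⁻ t in Ioo 0 x, f t) ^ (p * (1 + l)) *
      ENNReal.ofReal (x ^ (-1 - (p - 1) * (1 + l))) ≤
    ENNReal.ofReal (blissConst p l) * (∫⁻ x in Ioi 0, f x ^ p) ^ (1 + l) := by
  have hp0 : 0 < p := by linarith
  by_cases hfin : ∫⁻ x in Ioi 0, f x ^ p = ⊤
  · rw [hfin, ENNReal.top_rpow_of_pos (by linarith), ENNReal.mul_top]
    · exact le_top
    · simpa using blissConst_pos hp hl
  have hae : ∀ᵐ x ∂(volume.restrict (Ioi (0 : ℝ))), ‖(f x).toReal‖ₑ = f x := by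
    filter_upwards [ae_lt_top (hf.pow_const p) hfin] with x hx
    rw [Real.enorm_of_nonneg ENNReal.toReal_nonneg, ENNReal.ofReal_toReal]
    rw [ENNReal.rpow_lt_top_iff_of_pos hp0] at hx
    exact hx.ne
  have h1 : ∫⁻ x in Ioi 0, ‖(f x).toReal‖ₑ ^ p = ∫⁻ x in Ioi 0, f x ^ p :=
    lintegral_congr_ae (by filter_upwards [hae] with x hx; rw [hx])
  have h2 : ∀ x, ∫⁻ t in Ioo 0 x, ‖(f t).toReal‖ₑ = ∫⁻ t in Ioo 0 x, f t := fun x =>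
    lintegral_congr_ae (ae_restrict_of_ae_restrict_of_subset Ioo_subset_Ioi_self hae)
  have h3 := lintegral_bliss_le_eLpNorm hp hl hf.ennreal_toReal
    ⟨hf.ennreal_toReal.aestronglyMeasurable, by
      rw [← ENNReal.rpow_lt_top_iff_of_pos hp0, eLpNorm_rpow_eq_lintegral hp0, h1]
      exact ENNReal.rpow_lt_top_of_nonneg (by positivity) hfin⟩
  rw [eLpNorm_rpow_eq_lintegral hp0, h1, show p * (1 + l) / p = 1 + l by field_simp] at h3
  simpa only [h2] using h3

/-! ### Hardy's inequality -/

lemma lintegral_Ioo_rpow {a x : ℝ} (ha : 0 < a) (hx : 0 < x) :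
    ∫⁻ t in Ioo 0 x, ENNReal.ofReal (t ^ (a - 1)) = ENNReal.ofReal (x ^ a / a) := by
  have h1 := integral_rpow (a := 0) (b := x) (r := a - 1) (Or.inl (by linarith))
  rw [sub_add_cancel, Real.zero_rpow ha.ne', sub_zero] at h1
  rw [← h1, intervalIntegral.integral_of_le hx.le, integral_Ioc_eq_integral_Ioo,
    ofReal_integral_eq_lintegral_ofReal]
  · rw [← IntegrableOn, ← integrableOn_Ioc_iff_integrableOn_Ioo,
      ← intervalIntegrable_iff_integrableOn_Ioc_of_le hx.le]
    exact intervalIntegral.intervalIntegrable_rpow' (by linarith)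
  · filter_upwards [ae_restrict_mem measurableSet_Ioo] with t ht
    exact Real.rpow_nonneg ht.1.le _

lemma lintegral_Ioi_rpow {a x : ℝ} (ha : 0 < a) (hx : 0 < x) :
    ∫⁻ t in Ioi x, ENNReal.ofReal (t ^ (-a - 1)) = ENNReal.ofReal (x ^ (-a) / a) := by
  have h1 := integral_Ioi_rpow_of_lt (a := -a - 1) (by linarith) hx
  rw [sub_add_cancel, neg_div_neg_eq] at h1
  rw [← h1, ofReal_integral_eq_lintegral_ofReal]
  · exact integrableOn_Ioi_rpow_of_lt (by linarith) hx
  · filter_upwards [ae_restrict_mem measurableSet_Ioi] with t ht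
    exact Real.rpow_nonneg (hx.le.trans (le_of_lt ht)) _

/-- **Hardy's inequality**. -/
theorem lintegral_hardy_le {p : ℝ} (hp : 1 < p) {f : ℝ → ℝ≥0∞} (hf : Measurable f) :
    ∫⁻ x in Ioi 0, (∫⁻ t in Ioo 0 x, f t) ^ p * ENNReal.ofReal (x ^ (-1 - (p - 1))) ≤
    ENNReal.ofReal (p / (p - 1)) ^ p * ∫⁻ x in Ioi 0, f x ^ p := by
  have hp0 : 0 < p := by linarith
  have hp1 : 0 < p - 1 := by linarith
  -- Hölder is applied to `f t * t ^ (e / p)` and `t ^ (-(e / p))`. The conjugate power of the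
  -- latter is `t ^ (e - 1)`, whose integral brings a factor `e⁻¹` to the power `p - 1`; the
  -- integral in `x` after Tonelli brings one more, for `(p / (p - 1)) ^ p` in total.
  set e := (p - 1) / p with he
  have he0 : 0 < e := by positivity
  have hconj : p.HolderConjugate (p / (p - 1)) := Real.HolderConjugate.conjExponent hp
  have hpt : ∀ x, 0 < x → (∫⁻ t in Ioo 0 x, f t) ^ p * ENNReal.ofReal (x ^ (-1 - (p - 1))) ≤
      ENNReal.ofReal (e⁻¹ ^ (p - 1)) *
        ((∫⁻ t in Ioo 0 x, f t ^ p * ENNReal.ofReal (t ^ e)) * ENNReal.ofReal (x ^ (-e - 1))) := by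
    intro x hx
    have h1 : ∫⁻ t in Ioo 0 x, f t ≤ (∫⁻ t in Ioo 0 x, f t ^ p * ENNReal.ofReal (t ^ e)) ^ (1 / p) *
        (ENNReal.ofReal (x ^ e / e)) ^ e := by
      calc ∫⁻ t in Ioo 0 x, f t = ∫⁻ t in Ioo 0 x, ((fun t => f t * ENNReal.ofReal (t ^ (e / p))) *
            fun t => ENNReal.ofReal (t ^ (-(e / p)))) t := by
            apply setLIntegral_congr_fun measurableSet_Ioo
            intro t ht
            have ht0 : 0 < t := ht.1
            simp only [Pi.mul_apply]
            rw [mul_assoc, ← ENNReal.ofReal_mul (by positivity), ← Real.rpow_add ht0]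
            simp
        _ ≤ _ := ENNReal.lintegral_mul_le_Lp_mul_Lq _ hconj (by fun_prop) (by fun_prop)
        _ = _ := by
            congr 1
            · congr 1
              apply setLIntegral_congr_fun measurableSet_Ioo
              intro t ht
              have ht0 : 0 < t := ht.1
              simp only
              rw [ENNReal.mul_rpow_of_nonneg _ _ hp0.le, ENNReal.ofReal_rpow_of_pos (by positivity),
                ← Real.rpow_mul ht0.le, div_mul_cancel₀ _ hp0.ne']
            · rw [← lintegral_Ioo_rpow he0 hx]
              congr 1
              · apply setLIntegral_congr_fun measurableSet_Ioo
                intro t ht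
                have ht0 : 0 < t := ht.1
                simp only
                rw [ENNReal.ofReal_rpow_of_pos (by positivity), ← Real.rpow_mul ht0.le]
                congr 2; rw [he]; field_simp; ring
              · rw [he]; field_simp
    calc _ ≤ ((∫⁻ t in Ioo 0 x, f t ^ p * ENNReal.ofReal (t ^ e)) ^ (1 / p) *
        (ENNReal.ofReal (x ^ e / e)) ^ e) ^ p * ENNReal.ofReal (x ^ (-1 - (p - 1))) := by gcongr
      _ = (∫⁻ t in Ioo 0 x, f t ^ p * ENNReal.ofReal (t ^ e)) *
          (ENNReal.ofReal ((x ^ e / e) ^ (p - 1) * x ^ (-1 - (p - 1)))) := by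
          rw [ENNReal.mul_rpow_of_nonneg _ _ hp0.le, ← ENNReal.rpow_mul, ← ENNReal.rpow_mul,
            one_div_mul_cancel hp0.ne', ENNReal.rpow_one, mul_assoc,
            show e * p = p - 1 by rw [he]; field_simp, ENNReal.ofReal_rpow_of_pos (by positivity),
            ← ENNReal.ofReal_mul (by positivity)]
      _ = _ := by
          have : (x ^ e / e) ^ (p - 1) * x ^ (-1 - (p - 1)) = e⁻¹ ^ (p - 1) * x ^ (-e - 1) := by
            rw [div_eq_mul_inv, Real.mul_rpow (by positivity) (by positivity),
              ← Real.rpow_mul hx.le, mul_right_comm, ← Real.rpow_add hx, mul_comm]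
            congr 2; rw [he]; field_simp; ring
          rw [this, ENNReal.ofReal_mul (by positivity)]; ring
  calc _ ≤ ∫⁻ x in Ioi 0, ENNReal.ofReal (e⁻¹ ^ (p - 1)) *
        ((∫⁻ t in Ioo 0 x, f t ^ p * ENNReal.ofReal (t ^ e)) * ENNReal.ofReal (x ^ (-e - 1))) :=
      setLIntegral_mono' measurableSet_Ioi hpt
    _ = ENNReal.ofReal (e⁻¹ ^ (p - 1)) * ∫⁻ x in Ioi 0,
        ((∫⁻ t in Ioo 0 x, f t ^ p * ENNReal.ofReal (t ^ e)) * ENNReal.ofReal (x ^ (-e - 1))) :=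
      lintegral_const_mul' _ _ ENNReal.ofReal_ne_top
    _ = ENNReal.ofReal (e⁻¹ ^ (p - 1)) * ∫⁻ t in Ioi 0, f t ^ p * ENNReal.ofReal (t ^ e) *
        ∫⁻ x in Ioi t, ENNReal.ofReal (x ^ (-e - 1)) := by
      congr 1
      have hS : MeasurableSet {z : ℝ × ℝ | 0 < z.2 ∧ z.2 < z.1} :=
        (measurableSet_lt measurable_const measurable_snd).inter
          (measurableSet_lt measurable_snd measurable_fst)
      set K : ℝ → ℝ → ℝ≥0∞ := fun x t => {z : ℝ × ℝ | 0 < z.2 ∧ z.2 < z.1}.indicator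
        (fun z => f z.2 ^ p * ENNReal.ofReal (z.2 ^ e) * ENNReal.ofReal (z.1 ^ (-e - 1))) (x, t)
        with hK
      have h1 : ∀ x ∈ Ioi (0 : ℝ), (∫⁻ t in Ioo 0 x, f t ^ p * ENNReal.ofReal (t ^ e)) *
          ENNReal.ofReal (x ^ (-e - 1)) = ∫⁻ t in Ioi 0, K x t := by
        intro x hx
        rw [← lintegral_mul_const' _ _ ENNReal.ofReal_ne_top, ← lintegral_indicator measurableSet_Ioo,
          ← lintegral_indicator measurableSet_Ioi]
        apply lintegral_congr
        intro t
        by_cases ht : 0 < t <;> by_cases htx : t < x <;> simp [hK, indicator, ht, htx]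
      have h2 : ∀ t ∈ Ioi (0 : ℝ), f t ^ p * ENNReal.ofReal (t ^ e) *
          ∫⁻ x in Ioi t, ENNReal.ofReal (x ^ (-e - 1)) = ∫⁻ x in Ioi 0, K x t := by
        intro t ht
        have ht0 : 0 < t := ht
        rw [← lintegral_const_mul _ (by fun_prop), ← lintegral_indicator measurableSet_Ioi,
          ← lintegral_indicator measurableSet_Ioi]
        apply lintegral_congr
        intro x
        by_cases htx : t < x
        · simp [hK, indicator, ht0, htx, ht0.trans htx]
        · simp [hK, indicator, htx]
      rw [setLIntegral_congr_fun measurableSet_Ioi h1, setLIntegral_congr_fun measurableSet_Ioi h2]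
      apply lintegral_lintegral_swap
      apply Measurable.aemeasurable
      apply Measurable.indicator _ hS
      fun_prop
    _ = ENNReal.ofReal (e⁻¹ ^ (p - 1)) * ∫⁻ t in Ioi 0, ENNReal.ofReal e⁻¹ * f t ^ p := by
      congr 1
      apply setLIntegral_congr_fun measurableSet_Ioi
      intro t ht
      have ht0 : 0 < t := ht
      simp only
      rw [lintegral_Ioi_rpow he0 ht0, mul_assoc, ← ENNReal.ofReal_mul (by positivity), mul_comm,
        Real.rpow_neg ht0.le]
      congr 2
      field_simp
    _ = _ := by
      rw [lintegral_const_mul' _ _ ENNReal.ofReal_ne_top, ← mul_assoc,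
        ← ENNReal.ofReal_mul (by positivity), show p / (p - 1) = e⁻¹ by rw [he, inv_div],
        ENNReal.ofReal_rpow_of_pos (by positivity), Real.rpow_sub_one (by positivity)]
      congr 2
      field_simp

/-! ### The constant in terms of the beta function -/

/-- The substitution `t = x ^ l / (1 + x ^ l)`, written as `1 - (1 + x ^ l)⁻¹`, carries the
half-line onto `(0, 1)`. -/
lemma integral_blissDensity_eq_betaFn {p l : ℝ} (hl : 0 < l) :
    ∫ x in Ioi 0, blissDensity p l x = 1 / l * betaFn (1 / l) ((p * (1 + l) - 1) / l) := by
  have hd : ∀ x ∈ Ioi (0 : ℝ), HasDerivWithinAt (fun x : ℝ => 1 - (1 + x ^ l)⁻¹)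
      (l * x ^ (l - 1) / (1 + x ^ l) ^ 2) (Ioi 0) x := by
    intro x hx
    have hx0 : (0 : ℝ) < x := hx
    have hpos : (0 : ℝ) < 1 + x ^ l := by positivity
    have h1 := ((Real.hasDerivAt_rpow_const (x := x) (p := l) (Or.inl hx0.ne')).const_add 1).inv
      hpos.ne'
    refine ((h1.const_sub 1).congr_deriv ?_).hasDerivWithinAt
    ring
  have hinj : InjOn (fun x : ℝ => 1 - (1 + x ^ l)⁻¹) (Ioi 0) := by
    intro x hx y hy hxy
    have hx0 : (0 : ℝ) < x := hx
    have hy0 : (0 : ℝ) < y := hy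
    simp only [sub_right_inj, inv_inj, add_right_inj] at hxy
    exact (Real.rpow_left_inj hx0.le hy0.le hl.ne').1 hxy
  have himg : (fun x : ℝ => 1 - (1 + x ^ l)⁻¹) '' Ioi 0 = Ioo 0 1 := by
    ext t
    constructor
    · rintro ⟨x, hx, rfl⟩
      have hx0 : (0 : ℝ) < x := hx
      have h1 : (0 : ℝ) < x ^ l := by positivity
      constructor
      · simp only [sub_pos]; exact inv_lt_one_of_one_lt₀ (by linarith)
      · simp only [sub_lt_self_iff]; positivity
    · intro ht
      have h1 : 0 < 1 - t := by linarith [ht.2]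
      have ht0 := ht.1
      refine ⟨(t / (1 - t)) ^ (1 / l), ?_, ?_⟩
      · simp only [mem_Ioi]; positivity
      · simp only
        rw [← Real.rpow_mul (by positivity), one_div_mul_cancel hl.ne', Real.rpow_one]
        field_simp
        ring
  have key := integral_image_eq_integral_abs_deriv_smul measurableSet_Ioi hd hinj
    (fun t => t ^ (1 / l - 1) * (1 - t) ^ ((p * (1 + l) - 1) / l - 1))
  rw [himg] at key
  rw [betaFn, intervalIntegral.integral_of_le zero_le_one, integral_Ioc_eq_integral_Ioo, key,
    ← integral_const_mul]
  apply setIntegral_congr_fun measurableSet_Ioi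
  intro x hx
  have hx0 : (0 : ℝ) < x := hx
  have hpos : (0 : ℝ) < 1 + x ^ l := by positivity
  have h1 : 1 - (1 + x ^ l)⁻¹ = x ^ l * (1 + x ^ l)⁻¹ := by field_simp; ring
  simp only [smul_eq_mul]
  rw [abs_of_nonneg (by positivity), h1, show 1 - x ^ l * (1 + x ^ l)⁻¹ = (1 + x ^ l)⁻¹ by
    rw [← h1]; ring, Real.mul_rpow (by positivity) (by positivity), ← Real.rpow_mul hx0.le,
    Real.inv_rpow hpos.le, Real.inv_rpow hpos.le, ← Real.rpow_neg hpos.le, ← Real.rpow_neg hpos.le,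
    show l * (1 / l - 1) = -(l - 1) by field_simp; ring, Real.rpow_neg hx0.le, blissDensity]
  have h2 : (1 + x ^ l) ^ (-(p * (1 + l) / l)) = (1 + x ^ l) ^ (-(1 / l - 1)) *
      (1 + x ^ l) ^ (-((p * (1 + l) - 1) / l - 1)) / (1 + x ^ l) ^ 2 := by
    rw [← Real.rpow_natCast, ← Real.rpow_add hpos, ← Real.rpow_sub hpos]
    congr 1; push_cast; field_simp; ring
  rw [h2]
  have : 0 < x ^ (l - 1) := by positivity
  field_simp

/-- By `integral_blissDensity_eq` the numerator of `blissConst` is `p' / q` times the integral of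
the density, for `q = p (1 + l)`. Only the power `-l` of that integral is left, and the integral is
a beta value. -/
lemma blissFactor_rpow {p l : ℝ} (hp : 1 < p) (hl : 0 < l) :
    blissFactor p (p * (1 + l)) ^ (p * (1 + l)) = blissConst p l := by
  have hp0 : 0 < p := by linarith
  have hp1 : 0 < p - 1 := by linarith
  have hE := integral_blissDensity_pos hp hl
  have hE2 := integral_blissDensity_eq hp hl
  have hne : p ≠ p * (1 + l) := by nlinarith
  have hq1 : p * (1 + l) - 1 ≠ 0 := by nlinarith
  have e1 : p / (p * (1 + l) - p) = 1 / l := by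
    rw [show p * (1 + l) - p = p * l by ring]; field_simp
  have e2 : p * (p * (1 + l)) / ((p * (1 + l)).conjExponent * (p * (1 + l) - p)) =
      (p * (1 + l) - 1) / l := by
    rw [show p * (1 + l) - p = p * l by ring, Real.conjExponent]; field_simp
  rw [blissFactor, if_neg hne, e1, e2, ← integral_blissDensity_eq_betaFn hl, blissConst]
  have hG : ∫ x in Ioi 0, x ^ l * blissDensity p l x =
      p.conjExponent / (p * (1 + l)) * ∫ x in Ioi 0, blissDensity p l x := by
    rw [hE2, Real.conjExponent]; field_simp
  set E := ∫ x in Ioi 0, blissDensity p l x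
  have hc : 0 < p.conjExponent := by unfold Real.conjExponent; positivity
  rw [hG, Real.mul_rpow (by positivity) (by positivity), ← Real.rpow_mul (by positivity),
    ← Real.rpow_mul (by positivity), one_div_mul_cancel (by positivity), Real.rpow_one, mul_div_assoc]
  congr 1
  rw [show (1 / (p * (1 + l)) - 1 / p) * (p * (1 + l)) = 1 - (1 + l) by field_simp,
    Real.rpow_sub hE, Real.rpow_one]

lemma blissFactor_pos {p q : ℝ} (hp : 1 < p) (hpq : p ≤ q) : 0 < blissFactor p q := by
  rcases hpq.eq_or_lt with rfl | h
  · rw [blissFactor, if_pos rfl]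
    have : 0 < p - 1 := by linarith
    positivity
  · have hp0 : 0 < p := by linarith
    have hl : 0 < q / p - 1 := by rw [sub_pos, one_lt_div hp0]; exact h
    have hp1 : 0 < p - 1 := by linarith
    have hE := integral_blissDensity_pos hp hl
    rw [integral_blissDensity_eq_betaFn hl] at hE
    have hq1 : q - 1 ≠ 0 := by linarith
    have hq0 : q ≠ 0 := by linarith
    have hqp : 0 < q - p := by linarith
    have e0 : p * (1 + (q / p - 1)) = q := by field_simp; ring
    have e1 : 1 / (q / p - 1) = p / (q - p) := by field_simp
    have e2 : (q - 1) / (q / p - 1) = p * q / (q.conjExponent * (q - p)) := by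
      rw [Real.conjExponent]; field_simp
    rw [e0, e2, e1] at hE
    rw [blissFactor, if_neg h.ne]
    have hc : 0 < p.conjExponent := by unfold Real.conjExponent; positivity
    have : 0 < q := by linarith
    positivity

/-! ### The sharp inequality on the half-line -/

/-- The sharp one-dimensional inequality, for `p ≤ q`. -/
theorem lintegral_primitive_rpow_le {p q : ℝ} (hp : 1 < p) (hpq : p ≤ q) {f : ℝ → ℝ≥0∞}
    (hf : Measurable f) :
    ∫⁻ x in Ioi 0, (∫⁻ t in Ioo 0 x, f t) ^ q * ENNReal.ofReal (x ^ (-1 - q * ((p - 1) / p))) ≤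
    ENNReal.ofReal (blissFactor p q) ^ q * (∫⁻ x in Ioi 0, f x ^ p) ^ (q / p) := by
  have hp0 : 0 < p := by linarith
  rcases hpq.eq_or_lt with rfl | h
  · rw [blissFactor, if_pos rfl, div_self hp0.ne', ENNReal.rpow_one, mul_div_cancel₀ _ hp0.ne']
    exact lintegral_hardy_le hp hf
  · obtain ⟨l, rfl⟩ : ∃ l, q = p * (1 + l) := ⟨q / p - 1, by field_simp; ring⟩
    have hl : 0 < l := by nlinarith
    rw [ENNReal.ofReal_rpow_of_pos (blissFactor_pos hp hpq), blissFactor_rpow hp hl,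
      show p * (1 + l) / p = 1 + l by field_simp,
      show p * (1 + l) * ((p - 1) / p) = (p - 1) * (1 + l) by field_simp]
    exact lintegral_bliss_le hp hl hf

/-- Sharpness of the one-dimensional inequality. -/
theorem exists_le_lintegral_primitive_rpow {p q c : ℝ} (hp : 1 < p) (hpq : p ≤ q) (hc0 : 0 < c)
    (hc : c < blissFactor p q) :
    ∃ f : ℝ → ℝ, Measurable f ∧ (∀ x, 0 ≤ f x) ∧
      ∫⁻ x in Ioi 0, ENNReal.ofReal (f x) ^ p ≠ 0 ∧ ∫⁻ x in Ioi 0, ENNReal.ofReal (f x) ^ p ≠ ⊤ ∧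
      ENNReal.ofReal c ^ q * (∫⁻ x in Ioi 0, ENNReal.ofReal (f x) ^ p) ^ (q / p) ≤
      ∫⁻ x in Ioi 0, (∫⁻ t in Ioo 0 x, ENNReal.ofReal (f t)) ^ q *
        ENNReal.ofReal (x ^ (-1 - q * ((p - 1) / p))) := by
  have hp0 : 0 < p := by linarith
  have hp1 : 0 < p - 1 := by linarith
  rcases hpq.eq_or_lt with rfl | h
  · rw [blissFactor, if_pos rfl] at hc
    -- For `p = q` the test function is `t ^ (1 / c - 1)` on `(0, 1)`. Its `p`-th power is `t ^ (p *
    -- ε - 1)`, integrable exactly because `c < p / (p - 1)`. Its primitive at `x < 1` is `c * x`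
    -- times the function, so the part of the left-hand side over `(0, 1)` already has ratio `c`.
    set ε := 1 / c - (p - 1) / p with hε
    have hε0 : 0 < ε := by
      rw [hε, sub_pos, div_lt_div_iff₀ hp0 hc0]
      rw [lt_div_iff₀ hp1] at hc
      linarith
    have hnorm : ∫⁻ x in Ioi 0, ENNReal.ofReal ((Ioo 0 1).indicator (fun t => t ^ (1 / c - 1)) x) ^ p =
        ENNReal.ofReal (1 / (p * ε)) := by
      have h1 : ∀ x, ENNReal.ofReal ((Ioo 0 1).indicator (fun t => t ^ (1 / c - 1)) x) ^ p =
          (Ioo 0 1).indicator (fun t => ENNReal.ofReal (t ^ (p * ε - 1))) x := by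
        intro x
        by_cases hx : x ∈ Ioo (0 : ℝ) 1
        · have hx0 : 0 < x := hx.1
          rw [indicator_of_mem hx, indicator_of_mem hx, ENNReal.ofReal_rpow_of_pos (by positivity),
            ← Real.rpow_mul hx.1.le]
          congr 2; rw [hε]; field_simp; ring
        · simp [indicator_of_notMem hx, hp0]
      simp_rw [h1]
      rw [lintegral_indicator measurableSet_Ioo, Measure.restrict_restrict measurableSet_Ioo,
        inter_eq_left.2 Ioo_subset_Ioi_self, lintegral_Ioo_rpow (by positivity) one_pos, Real.one_rpow]
    refine ⟨(Ioo 0 1).indicator (fun t => t ^ (1 / c - 1)), ?_, ?_, ?_, ?_, ?_⟩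
    · exact (measurable_id.pow_const _).indicator measurableSet_Ioo
    · intro x
      exact indicator_nonneg (fun t ht => Real.rpow_nonneg ht.1.le _) x
    · rw [hnorm]; simp; positivity
    · rw [hnorm]; exact ENNReal.ofReal_ne_top
    · rw [div_self hp0.ne', ENNReal.rpow_one, hnorm]
      have h2 : ∀ x ∈ Ioo (0 : ℝ) 1, ENNReal.ofReal c ^ p * ENNReal.ofReal (x ^ (p * ε - 1)) ≤
          (∫⁻ t in Ioo 0 x, ENNReal.ofReal ((Ioo 0 1).indicator (fun t => t ^ (1 / c - 1)) t)) ^ p *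
          ENNReal.ofReal (x ^ (-1 - p * ((p - 1) / p))) := by
        intro x hx
        have hx0 : 0 < x := hx.1
        have h3 : ∫⁻ t in Ioo 0 x, ENNReal.ofReal ((Ioo 0 1).indicator (fun t => t ^ (1 / c - 1)) t) =
            ENNReal.ofReal (x ^ (1 / c) / (1 / c)) := by
          rw [← lintegral_Ioo_rpow (by positivity) hx.1]
          apply setLIntegral_congr_fun measurableSet_Ioo
          intro t ht
          simp only
          rw [indicator_of_mem (show t ∈ Ioo (0 : ℝ) 1 from ⟨ht.1, ht.2.trans hx.2⟩)]
        rw [h3, ENNReal.ofReal_rpow_of_pos hc0, ENNReal.ofReal_rpow_of_pos (by positivity),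
          ← ENNReal.ofReal_mul (by positivity), ← ENNReal.ofReal_mul (by positivity)]
        apply le_of_eq
        congr 1
        rw [div_div_eq_mul_div, div_one, Real.mul_rpow (by positivity) hc0.le, ← Real.rpow_mul hx0.le,
          mul_right_comm, ← Real.rpow_add hx0, mul_comm]
        congr 2; rw [hε]; field_simp; ring
      calc _ = ∫⁻ x in Ioo 0 1, ENNReal.ofReal c ^ p * ENNReal.ofReal (x ^ (p * ε - 1)) := by
            rw [lintegral_const_mul _ (by fun_prop), lintegral_Ioo_rpow (by positivity) one_pos,
              Real.one_rpow]
        _ ≤ _ := setLIntegral_mono' measurableSet_Ioo h2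
        _ ≤ _ := lintegral_mono_set Ioo_subset_Ioi_self
  · obtain ⟨l, rfl⟩ : ∃ l, q = p * (1 + l) := ⟨q / p - 1, by field_simp; ring⟩
    have hl : 0 < l := by nlinarith
    have H := comparableToExtremal_extremal hl
    have hE := integral_blissDensity_pos hp hl
    have heq : ∀ x ∈ Ioi (0 : ℝ), blissExtremal l |x| = blissExtremal l x := fun x hx => by
      rw [abs_of_pos hx]
    have hm : Measurable fun x => blissExtremal l |x| := by
      unfold blissExtremal; fun_prop
    have hen : ∀ x ∈ Ioi (0 : ℝ), ENNReal.ofReal (blissExtremal l |x|) = ‖blissExtremal l x‖ₑ := by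
      intro x hx
      rw [heq x hx, Real.enorm_of_nonneg (blissExtremal_pos (le_of_lt hx)).le]
    have hnorm : ∫⁻ x in Ioi 0, ENNReal.ofReal (blissExtremal l |x|) ^ p =
        ENNReal.ofReal (∫ x in Ioi 0, blissDensity p l x) := by
      rw [setLIntegral_congr_fun (g := fun x => ‖blissExtremal l x‖ₑ ^ p) measurableSet_Ioi
        (fun x hx => by simp only; rw [hen x hx]), H.lintegral_rpow hp hl one_pos]
      congr 1
      exact setIntegral_congr_fun measurableSet_Ioi fun x hx => blissExtremal_rpow (le_of_lt hx)
    -- The absolute value secures non-negativity on the whole line; only positive arguments enter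
    -- the integrals.
    refine ⟨fun x => blissExtremal l |x|, hm, fun x => (blissExtremal_pos (abs_nonneg x)).le,
      ?_, ?_, ?_⟩
    · rw [hnorm]; simpa using hE
    · rw [hnorm]; exact ENNReal.ofReal_ne_top
    · have h4 : ∫⁻ x in Ioi 0, (∫⁻ t in Ioo 0 x, ENNReal.ofReal (blissExtremal l |t|)) ^ (p * (1 + l)) *
          ENNReal.ofReal (x ^ (-1 - p * (1 + l) * ((p - 1) / p))) =
          ENNReal.ofReal (∫ x in Ioi 0, x ^ l * blissDensity p l x) := by
        rw [show p * (1 + l) * ((p - 1) / p) = (p - 1) * (1 + l) by field_simp]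
        have h5 : ∀ x, ∫⁻ t in Ioo 0 x, ENNReal.ofReal (blissExtremal l |t|) =
            ∫⁻ t in Ioo 0 x, ‖blissExtremal l t‖ₑ := fun x =>
          setLIntegral_congr_fun measurableSet_Ioo fun t ht => hen t ht.1
        simp_rw [h5]
        rw [H.lintegral_blissIntegrand hp hl one_pos]
        congr 1
        exact setIntegral_congr_fun measurableSet_Ioi fun x hx =>
          integral_blissExtremal_rpow_mul hl hx
      rw [hnorm, h4, show p * (1 + l) / p = 1 + l by field_simp]
      have hq : 0 < p * (1 + l) := by positivity
      calc _ ≤ ENNReal.ofReal (blissFactor p (p * (1 + l))) ^ (p * (1 + l)) *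
            ENNReal.ofReal (∫ x in Ioi 0, blissDensity p l x) ^ (1 + l) := by gcongr
        _ = _ := by
          rw [ENNReal.ofReal_rpow_of_pos (blissFactor_pos hp hpq), blissFactor_rpow hp hl,
            ENNReal.ofReal_rpow_of_pos hE, ← ENNReal.ofReal_mul (blissConst_pos hp hl).le, blissConst]
          congr 1
          field_simp

/-! ### Minkowski's integral inequality -/

section Minkowski
variable {X Y : Type*} [MeasurableSpace X] [MeasurableSpace Y] {μ : Measure X} {ν : Measure Y}
  [SFinite ν]

/-- Duality: one factor of `φ ^ s` is replaced by the integral of `G`, and Hölder pairs `φ ^ (s -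
1)` with each slice. Finiteness of the left side permits cancelling the factor `A ^ (1 - 1 / s)`,
which is why `φ` may lie below the full integral of `G`. -/
lemma lintegral_rpow_le_of_le_lintegral [SFinite μ] {s : ℝ} (hs : 1 < s) {G : X → Y → ℝ≥0∞}
    (hG : Measurable (Function.uncurry G)) {φ : X → ℝ≥0∞} (hφ : Measurable φ)
    (hφG : ∀ x, φ x ≤ ∫⁻ y, G x y ∂ν) (hfin : ∫⁻ x, φ x ^ s ∂μ ≠ ⊤) :
    (∫⁻ x, φ x ^ s ∂μ) ^ (1 / s) ≤ ∫⁻ y, (∫⁻ x, G x y ^ s ∂μ) ^ (1 / s) ∂ν := by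
  have hs0 : 0 < s := by linarith
  have hs1 : 0 < s - 1 := by linarith
  have hconj : s.HolderConjugate (s / (s - 1)) := Real.HolderConjugate.conjExponent hs
  set A := ∫⁻ x, φ x ^ s ∂μ with hA
  rcases eq_or_ne A 0 with h0 | h0
  · rw [h0, ENNReal.zero_rpow_of_pos (by positivity)]; exact zero_le
  have h1 : A ≤ A ^ (1 - 1 / s) * ∫⁻ y, (∫⁻ x, G x y ^ s ∂μ) ^ (1 / s) ∂ν := by
    calc A ≤ ∫⁻ x, φ x ^ (s - 1) * ∫⁻ y, G x y ∂ν ∂μ := by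
          apply lintegral_mono
          intro x
          calc φ x ^ s = φ x ^ (s - 1) * φ x := by
                nth_rw 3 [← ENNReal.rpow_one (φ x)]
                rw [← ENNReal.rpow_add_of_nonneg _ _ hs1.le zero_le_one, sub_add_cancel]
            _ ≤ _ := mul_le_mul' le_rfl (hφG x)
      _ = ∫⁻ x, ∫⁻ y, φ x ^ (s - 1) * G x y ∂ν ∂μ := by
          apply lintegral_congr
          intro x
          rw [lintegral_const_mul _ (hG.of_uncurry_left)]
      _ = ∫⁻ y, ∫⁻ x, φ x ^ (s - 1) * G x y ∂μ ∂ν := by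
          apply lintegral_lintegral_swap
          exact (((hφ.comp measurable_fst).pow_const _).mul hG).aemeasurable
      _ ≤ ∫⁻ y, A ^ (1 - 1 / s) * (∫⁻ x, G x y ^ s ∂μ) ^ (1 / s) ∂ν := by
          apply lintegral_mono
          intro y
          refine (ENNReal.lintegral_mul_le_Lp_mul_Lq μ hconj.symm (hφ.pow_const _).aemeasurable
            hG.of_uncurry_right.aemeasurable).trans_eq ?_
          congr 1
          simp_rw [← ENNReal.rpow_mul]
          rw [show (s - 1) * (s / (s - 1)) = s by field_simp,
            show 1 / (s / (s - 1)) = 1 - 1 / s by field_simp]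
      _ = _ := lintegral_const_mul' _ _ (ENNReal.rpow_ne_top_of_ne_zero h0 hfin)
  have h2 : A ^ (1 - 1 / s) * A ^ (1 / s) = A := by
    rw [← ENNReal.rpow_add _ _ h0 hfin, sub_add_cancel, ENNReal.rpow_one]
  nth_rw 1 [← h2] at h1
  exact (ENNReal.mul_le_mul_iff_right (by simp [h0, hfin])
    (ENNReal.rpow_ne_top_of_ne_zero h0 hfin)).1 h1

/-- **Minkowski's integral inequality**. -/
theorem lintegral_lintegral_rpow_le [SigmaFinite μ] {s : ℝ} (hs : 1 ≤ s) {G : X → Y → ℝ≥0∞}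
    (hG : Measurable (Function.uncurry G)) :
    (∫⁻ x, (∫⁻ y, G x y ∂ν) ^ s ∂μ) ^ (1 / s) ≤ ∫⁻ y, (∫⁻ x, G x y ^ s ∂μ) ^ (1 / s) ∂ν := by
  rcases hs.eq_or_lt with rfl | hs
  · simp only [ENNReal.rpow_one, div_one]
    exact (lintegral_lintegral_swap hG.aemeasurable).le
  have hs0 : 0 < s := by linarith
  set g : X → ℝ≥0∞ := fun x => ∫⁻ y, G x y ∂ν with hg
  have hgm : Measurable g := hG.lintegral_prod_right
  set S := spanningSets μ
  -- Truncation in height and to sets of finite measure gives the finiteness required for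
  -- cancellation; monotone convergence removes it.
  set φ : ℕ → X → ℝ≥0∞ := fun n => (S n).indicator (fun x => min (g x) n) with hφ
  have hφm : ∀ n, Measurable (φ n) := fun n =>
    (hgm.min measurable_const).indicator (measurableSet_spanningSets μ n)
  have hφg : ∀ n x, φ n x ≤ g x := fun n x => by
    by_cases hx : x ∈ S n
    · simp [hφ, indicator_of_mem hx]
    · simp [hφ, indicator_of_notMem hx]
  have hmono : Monotone φ := by
    intro n k hnk x
    simp only [hφ]
    by_cases hx : x ∈ S n
    · rw [indicator_of_mem hx, indicator_of_mem (monotone_spanningSets μ hnk hx)]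
      gcongr
    · rw [indicator_of_notMem hx]; exact zero_le
  have hsup : ∀ x, ⨆ n, φ n x ^ s = g x ^ s := by
    intro x
    have : ⨆ n, φ n x = g x := by
      apply le_antisymm (iSup_le fun n => hφg n x)
      apply le_of_forall_lt
      intro c hc
      obtain ⟨n, hn⟩ := ENNReal.exists_nat_gt (ne_top_of_lt hc)
      have hx : x ∈ S (max n (spanningSetsIndex μ x)) :=
        monotone_spanningSets μ (le_max_right _ _) (mem_spanningSetsIndex μ x)
      refine lt_of_lt_of_le ?_ (le_iSup _ (max n (spanningSetsIndex μ x)))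
      simp only [hφ]
      rw [indicator_of_mem hx]
      refine lt_min hc (hn.trans_le ?_)
      exact_mod_cast le_max_left _ _
    rw [← this]
    exact ((ENNReal.orderIsoRpow s hs0).map_iSup (fun n => φ n x)).symm
  have hmct : ∫⁻ x, g x ^ s ∂μ = ⨆ n, ∫⁻ x, φ n x ^ s ∂μ := by
    simp_rw [← hsup]
    apply lintegral_iSup (fun n => (hφm n).pow_const _)
    intro n k hnk x
    exact ENNReal.rpow_le_rpow (hmono hnk x) hs0.le
  rw [one_div, ENNReal.rpow_inv_le_iff hs0, hmct]
  apply iSup_le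
  intro n
  rw [← ENNReal.rpow_inv_le_iff hs0, ← one_div]
  apply lintegral_rpow_le_of_le_lintegral hs hG (hφm n) (hφg n)
  apply ne_of_lt
  calc ∫⁻ x, φ n x ^ s ∂μ ≤ ∫⁻ x, (S n).indicator (fun _ => (n : ℝ≥0∞) ^ s) x ∂μ := by
        apply lintegral_mono
        intro x
        by_cases hx : x ∈ S n
        · simp only [hφ, indicator_of_mem hx]
          gcongr
          exact min_le_right _ _
        · simp [hφ, indicator_of_notMem hx, hs0]
    _ = (n : ℝ≥0∞) ^ s * μ (S n) := by
        rw [lintegral_indicator_const (measurableSet_spanningSets μ n)]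
    _ < ⊤ := ENNReal.mul_lt_top (ENNReal.rpow_lt_top_of_nonneg hs0.le (ENNReal.natCast_ne_top n))
        (measure_spanningSets_lt_top μ n)

end Minkowski

/-! ### Tensorization over the variables -/

section Tensor

/-- Bounds for positive integral operators from `L^p` to `L^q`, `p ≤ q`, tensorize. -/
theorem lintegral_tensor_rpow_le {X₁ X₂ Y₁ Y₂ : Type*} [MeasurableSpace X₁] [MeasurableSpace X₂]
    [MeasurableSpace Y₁] [MeasurableSpace Y₂] {μ₁ : Measure X₁} {μ₂ : Measure X₂} {ν₁ : Measure Y₁}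
    {ν₂ : Measure Y₂} [SigmaFinite μ₁] [SFinite μ₂] [SFinite ν₁] [SFinite ν₂] {p q : ℝ} (hp : 0 < p)
    (hpq : p ≤ q) {k₁ : X₁ → Y₁ → ℝ≥0∞} {k₂ : X₂ → Y₂ → ℝ≥0∞} {b₁ : Y₁ → ℝ≥0∞} {b₂ : Y₂ → ℝ≥0∞}
    (hk₁ : Measurable (Function.uncurry k₁)) (hk₂ : Measurable (Function.uncurry k₂))
    (hb₁ : Measurable b₁) (hb₂ : Measurable b₂) {C₁ C₂ : ℝ≥0∞}
    (h₁ : ∀ f : Y₁ → ℝ≥0∞, Measurable f →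
      ∫⁻ x, (∫⁻ y, k₁ x y * f y ∂ν₁) ^ q ∂μ₁ ≤ C₁ * (∫⁻ y, f y ^ p * b₁ y ∂ν₁) ^ (q / p))
    (h₂ : ∀ f : Y₂ → ℝ≥0∞, Measurable f →
      ∫⁻ x, (∫⁻ y, k₂ x y * f y ∂ν₂) ^ q ∂μ₂ ≤ C₂ * (∫⁻ y, f y ^ p * b₂ y ∂ν₂) ^ (q / p))
    {f : Y₁ → Y₂ → ℝ≥0∞} (hf : Measurable (Function.uncurry f)) :
    ∫⁻ x₁, ∫⁻ x₂, (∫⁻ y₁, ∫⁻ y₂, k₁ x₁ y₁ * k₂ x₂ y₂ * f y₁ y₂ ∂ν₂ ∂ν₁) ^ q ∂μ₂ ∂μ₁ ≤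
      C₁ * C₂ * (∫⁻ y₁, ∫⁻ y₂, f y₁ y₂ ^ p * (b₁ y₁ * b₂ y₂) ∂ν₂ ∂ν₁) ^ (q / p) := by
  have hq : 0 < q := hp.trans_le hpq
  have hr : 0 < q / p := by positivity
  have hr1 : 1 ≤ q / p := (one_le_div hp).2 hpq
  -- The operator of the first variable applied for frozen `y₂`; the full operator is that of the
  -- second variable applied to `g x₁`.
  set g : X₁ → Y₂ → ℝ≥0∞ := fun x₁ y₂ => ∫⁻ y₁, k₁ x₁ y₁ * f y₁ y₂ ∂ν₁ with hg
  have hgm : Measurable (Function.uncurry g) := by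
    have : Measurable fun z : (X₁ × Y₂) × Y₁ => k₁ z.1.1 z.2 * f z.2 z.1.2 :=
      (hk₁.comp (f := fun z : (X₁ × Y₂) × Y₁ => (z.1.1, z.2)) (by fun_prop)).mul
        (hf.comp (f := fun z : (X₁ × Y₂) × Y₁ => (z.2, z.1.2)) (by fun_prop))
    exact this.lintegral_prod_right'
  have e1 : ∀ x₁ x₂, ∫⁻ y₁, ∫⁻ y₂, k₁ x₁ y₁ * k₂ x₂ y₂ * f y₁ y₂ ∂ν₂ ∂ν₁ =
      ∫⁻ y₂, k₂ x₂ y₂ * g x₁ y₂ ∂ν₂ := by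
    intro x₁ x₂
    rw [lintegral_lintegral_swap]
    · apply lintegral_congr
      intro y₂
      simp only [hg]
      rw [← lintegral_const_mul _ (f := fun y₁ => k₁ x₁ y₁ * f y₁ y₂)
        ((hk₁.of_uncurry_left).mul hf.of_uncurry_right)]
      apply lintegral_congr
      intro y₁
      ring
    · exact (((hk₁.of_uncurry_left.comp measurable_fst).mul
        (hk₂.of_uncurry_left.comp measurable_snd)).mul hf).aemeasurable
  simp_rw [e1]
  have hB : ∀ y₂, (∫⁻ x₁, g x₁ y₂ ^ q ∂μ₁) ^ (1 / (q / p)) ≤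
      C₁ ^ (1 / (q / p)) * ∫⁻ y₁, f y₁ y₂ ^ p * b₁ y₁ ∂ν₁ := by
    intro y₂
    have := ENNReal.rpow_le_rpow (h₁ (fun y₁ => f y₁ y₂) hf.of_uncurry_right)
      (z := 1 / (q / p)) (by positivity)
    rwa [ENNReal.mul_rpow_of_nonneg _ _ (by positivity), ← ENNReal.rpow_mul (∫⁻ y, _ ∂ν₁),
      mul_one_div_cancel hr.ne', ENNReal.rpow_one] at this
  calc _ ≤ ∫⁻ x₁, C₂ * (∫⁻ y₂, g x₁ y₂ ^ p * b₂ y₂ ∂ν₂) ^ (q / p) ∂μ₁ :=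
        lintegral_mono fun x₁ => h₂ _ hgm.of_uncurry_left
    _ = C₂ * ∫⁻ x₁, (∫⁻ y₂, g x₁ y₂ ^ p * b₂ y₂ ∂ν₂) ^ (q / p) ∂μ₁ := by
        apply lintegral_const_mul
        apply Measurable.pow_const
        exact Measurable.lintegral_prod_right' (f := fun z : X₁ × Y₂ => g z.1 z.2 ^ p * b₂ z.2)
          ((hgm.pow_const p).mul (hb₂.comp measurable_snd))
    -- Minkowski with exponent `q / p ≥ 1` moves the `x₁` integral inside the `y₂` integral, where
    -- `h₁` applies for each `y₂`.
    _ ≤ C₂ * (∫⁻ y₂, (∫⁻ x₁, (g x₁ y₂ ^ p * b₂ y₂) ^ (q / p) ∂μ₁) ^ (1 / (q / p)) ∂ν₂) ^ (q / p) := by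
        gcongr
        rw [← ENNReal.rpow_inv_le_iff hr, ← one_div]
        exact lintegral_lintegral_rpow_le hr1
          ((hgm.pow_const p).mul (hb₂.comp measurable_snd))
    _ = C₂ * (∫⁻ y₂, (∫⁻ x₁, g x₁ y₂ ^ q ∂μ₁) ^ (1 / (q / p)) * b₂ y₂ ∂ν₂) ^ (q / p) := by
        congr 3
        ext y₂
        have : ∀ x₁, (g x₁ y₂ ^ p * b₂ y₂) ^ (q / p) = g x₁ y₂ ^ q * b₂ y₂ ^ (q / p) := by
          intro x₁
          rw [ENNReal.mul_rpow_of_nonneg _ _ hr.le, ← ENNReal.rpow_mul, mul_div_cancel₀ _ hp.ne']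
        simp_rw [this]
        rw [lintegral_mul_const _ (hgm.of_uncurry_right.pow_const _),
          ENNReal.mul_rpow_of_nonneg _ _ (by positivity), ← ENNReal.rpow_mul (b₂ y₂),
          mul_one_div_cancel hr.ne', ENNReal.rpow_one]
    _ ≤ C₂ * (∫⁻ y₂, C₁ ^ (1 / (q / p)) * (∫⁻ y₁, f y₁ y₂ ^ p * b₁ y₁ ∂ν₁) * b₂ y₂ ∂ν₂) ^ (q / p) := by
        gcongr with y₂
        exact hB y₂
    _ = C₂ * (C₁ ^ (1 / (q / p)) * ∫⁻ y₂, ∫⁻ y₁, f y₁ y₂ ^ p * (b₁ y₁ * b₂ y₂) ∂ν₁ ∂ν₂) ^ (q / p) := by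
        congr 2
        rw [← lintegral_const_mul]
        · apply lintegral_congr
          intro y₂
          rw [mul_assoc, ← lintegral_mul_const _ (f := fun y₁ => f y₁ y₂ ^ p * b₁ y₁) ((hf.of_uncurry_right.pow_const _).mul hb₁)]
          simp_rw [mul_assoc]
        · exact Measurable.lintegral_prod_right'
            (f := fun z : Y₂ × Y₁ => f z.2 z.1 ^ p * (b₁ z.2 * b₂ z.1))
            (((hf.comp measurable_swap).pow_const _).mul
              ((hb₁.comp measurable_snd).mul (hb₂.comp measurable_fst)))
    _ = _ := by
        rw [ENNReal.mul_rpow_of_nonneg _ _ hr.le, ← ENNReal.rpow_mul, one_div_mul_cancel hr.ne',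
          ENNReal.rpow_one, lintegral_lintegral_swap]
        · ring
        · exact (((hf.comp measurable_swap).pow_const _).mul
              ((hb₁.comp measurable_snd).mul (hb₂.comp measurable_fst))).aemeasurable

lemma lintegral_pi_fin_succ {m : ℕ} {E : Fin (m + 1) → Type*} [∀ i, MeasureSpace (E i)]
    [∀ i, SigmaFinite (volume : Measure (E i))] {F : (∀ i, E i) → ℝ≥0∞} (hF : Measurable F) :
    ∫⁻ x, F x = ∫⁻ x₀, ∫⁻ xs : ∀ j : Fin m, E j.succ, F (Fin.cons x₀ xs) := by
  have h := (volume_preserving_piFinSuccAbove E 0).symm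
  rw [← h.lintegral_comp hF]
  refine (lintegral_prod _ (hF.comp h.measurable).aemeasurable).trans ?_
  apply lintegral_congr
  intro x₀
  apply lintegral_congr
  intro xs
  simp only [Function.comp_apply, MeasurableEquiv.piFinSuccAbove_symm_apply]
  congr 1
  exact Fin.insertNth_zero x₀ xs

lemma measurable_fin_cons {m : ℕ} {E : Fin (m + 1) → Type*} [∀ i, MeasurableSpace (E i)] :
    Measurable fun z : E 0 × (∀ j : Fin m, E j.succ) => (Fin.cons z.1 z.2 : ∀ i, E i) := by
  rw [measurable_pi_iff]
  intro i
  refine Fin.cases ?_ (fun j => ?_) i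
  · simpa using measurable_fst
  · simp only [Fin.cons_succ]
    exact (measurable_pi_apply j).comp measurable_snd

/-- Induction on the number of variables: the remaining coordinates act as a single second variable
with product kernel and product weight. For no variables the space is a point and both sides are `f
^ q`. -/
theorem lintegral_pi_rpow_le {p q : ℝ} (hp : 0 < p) (hpq : p ≤ q) {m : ℕ} {E : Fin m → Type*}
    [∀ i, MeasureSpace (E i)] [∀ i, SigmaFinite (volume : Measure (E i))]
    {k : ∀ i, E i → E i → ℝ≥0∞} {b : ∀ i, E i → ℝ≥0∞} {C : Fin m → ℝ≥0∞}
    (hk : ∀ i, Measurable (Function.uncurry (k i))) (hb : ∀ i, Measurable (b i))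
    (h : ∀ i, ∀ f : E i → ℝ≥0∞, Measurable f →
      ∫⁻ x, (∫⁻ y, k i x y * f y) ^ q ≤ C i * (∫⁻ y, f y ^ p * b i y) ^ (q / p))
    {f : (∀ i, E i) → ℝ≥0∞} (hf : Measurable f) :
    ∫⁻ x : ∀ i, E i, (∫⁻ y, (∏ i, k i (x i) (y i)) * f y) ^ q ≤
      (∏ i, C i) * (∫⁻ y, f y ^ p * ∏ i, b i (y i)) ^ (q / p) := by
  induction m with
  | zero =>
    rw [Measure.volume_pi_eq_dirac (default : ∀ i, E i)]
    simp only [lintegral_dirac, Finset.univ_eq_empty, Finset.prod_empty, one_mul, mul_one]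
    rw [← ENNReal.rpow_mul, mul_div_cancel₀ _ hp.ne']
  | succ m ih =>
    have hkm : ∀ i, Measurable fun z : (∀ i, E i) × (∀ i, E i) => k i (z.1 i) (z.2 i) := fun i =>
      (hk i).comp (f := fun z : (∀ i, E i) × (∀ i, E i) => (z.1 i, z.2 i)) (by fun_prop)
    have hm1 : Measurable fun z : (∀ i, E i) × (∀ i, E i) => (∏ i, k i (z.1 i) (z.2 i)) * f z.2 :=
      (Finset.univ.measurable_fun_prod fun i _ => hkm i).mul (hf.comp measurable_snd)
    have hbm : Measurable fun y : ∀ i, E i => ∏ i, b i (y i) :=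
      Finset.univ.measurable_fun_prod fun i _ => (hb i).comp (measurable_pi_apply i)
    rw [lintegral_pi_fin_succ (F := fun x => (∫⁻ y, (∏ i, k i (x i) (y i)) * f y) ^ q)
        (hm1.lintegral_prod_right'.pow_const q),
      lintegral_pi_fin_succ (F := fun y => f y ^ p * ∏ i, b i (y i)) ((hf.pow_const p).mul hbm)]
    have e1 : ∀ x : ∀ i, E i, ∫⁻ y, (∏ i, k i (x i) (y i)) * f y = ∫⁻ y₀, ∫⁻ ys : ∀ j : Fin m, E j.succ,
        k 0 (x 0) y₀ * (∏ j : Fin m, k j.succ (x j.succ) (ys j)) * f (Fin.cons y₀ ys) := by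
      intro x
      rw [lintegral_pi_fin_succ (F := fun y => (∏ i, k i (x i) (y i)) * f y)
        (hm1.comp (measurable_const.prodMk measurable_id))]
      simp [Fin.prod_univ_succ]
    simp_rw [e1, Fin.cons_zero, Fin.cons_succ]
    simp only [Fin.prod_univ_succ, Fin.cons_zero, Fin.cons_succ]
    apply lintegral_tensor_rpow_le (ν₁ := volume) (ν₂ := volume) (μ₁ := volume) (μ₂ := volume)
      (k₁ := k 0) (k₂ := fun (x y : ∀ j : Fin m, E j.succ) => ∏ j : Fin m, k j.succ (x j) (y j))
      (b₁ := b 0) (b₂ := fun y : ∀ j : Fin m, E j.succ => ∏ j : Fin m, b j.succ (y j))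
      (C₁ := C 0) (C₂ := ∏ j : Fin m, C j.succ) (f := fun y₀ ys => f (Fin.cons y₀ ys)) hp hpq (hk 0)
    · exact Finset.univ.measurable_fun_prod fun j _ => (hk j.succ).comp
        (f := fun z : (∀ j : Fin m, E j.succ) × (∀ j : Fin m, E j.succ) => (z.1 j, z.2 j))
        (by fun_prop)
    · exact hb 0
    · exact Finset.univ.measurable_fun_prod fun j _ => (hb j.succ).comp (measurable_pi_apply j)
    · exact h 0
    · intro f hf
      exact ih (fun i => hk i.succ) (fun i => hb i.succ) (fun i => h i.succ) hf
    · exact hf.comp measurable_fin_cons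

/-- Fubini for products of functions of one variable each. -/
lemma lintegral_pi_prod {m : ℕ} {E : Fin m → Type*}
    [∀ i, MeasureSpace (E i)] [∀ i, SigmaFinite (volume : Measure (E i))]
    {f : ∀ i, E i → ℝ≥0∞} (hf : ∀ i, Measurable (f i)) :
    ∫⁻ x : ∀ i, E i, ∏ i, f i (x i) = ∏ i, ∫⁻ x, f i x := by
  induction m with
  | zero =>
    rw [Measure.volume_pi_eq_dirac (default : ∀ i, E i)]
    simp
  | succ m ih =>
    rw [lintegral_pi_fin_succ (F := fun x => ∏ i, f i (x i))
      (Finset.univ.measurable_fun_prod fun i _ => (hf i).comp (measurable_pi_apply i))]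
    simp only [Fin.prod_univ_succ, Fin.cons_zero, Fin.cons_succ]
    rw [← ih fun i => hf i.succ, ← lintegral_mul_const _ (hf 0)]
    apply lintegral_congr
    intro x₀
    rw [lintegral_const_mul _ (f := fun xs : ∀ j : Fin m, E j.succ => ∏ j, f j.succ (xs j))
      (Finset.univ.measurable_fun_prod fun i _ => (hf i.succ).comp (measurable_pi_apply i))]

end Tensor

/-! ### Polar coordinates and the radial density -/

section Polar
variable {n : ℕ}

/-- The unit sphere of `ℝ^n`, with its surface measure. -/
abbrev sphereMeasure (n : ℕ) : Measure (Metric.sphere (0 : EuclideanSpace ℝ (Fin n)) 1) :=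
  (volume : Measure (EuclideanSpace ℝ (Fin n))).toSphere

lemma sphereMeasure_univ (n : ℕ) :
    sphereMeasure n univ = ENNReal.ofReal (sphereArea n) := by
  rw [sphereArea, ENNReal.ofReal_toReal (measure_ne_top _ _)]

lemma sphereArea_pos (hn : 0 < n) : 0 < sphereArea n := by
  have : Nonempty (Fin n) := ⟨⟨0, hn⟩⟩
  have : Nontrivial (EuclideanSpace ℝ (Fin n)) := inferInstance
  apply ENNReal.toReal_pos
  · rw [Measure.measure_univ_ne_zero]
    exact Measure.toSphere_ne_zero _
  · exact measure_ne_top _ _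

lemma volume_ball_toReal (hn : 0 < n) {r : ℝ} (hr : 0 ≤ r) :
    (volume (Metric.ball (0 : EuclideanSpace ℝ (Fin n)) r)).toReal =
      sphereArea n / n * r ^ (n : ℝ) := by
  have : Nonempty (Fin n) := ⟨⟨0, hn⟩⟩
  have hn' : (n : ℝ) ≠ 0 := by positivity
  rw [Measure.addHaar_ball _ _ hr, sphereArea, Measure.toSphere_apply_univ]
  simp only [finrank_euclideanSpace, Fintype.card_fin, ENNReal.toReal_mul, ENNReal.toReal_natCast]
  rw [ENNReal.toReal_ofReal (by positivity), Real.rpow_natCast]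
  field_simp

/-- Integration in polar coordinates. -/
lemma lintegral_polar (hn : 0 < n) {f : EuclideanSpace ℝ (Fin n) → ℝ≥0∞} (hf : Measurable f) :
    ∫⁻ x, f x = ∫⁻ r in Ioi (0 : ℝ), ENNReal.ofReal (r ^ ((n : ℝ) - 1)) *
      ∫⁻ θ, f (r • (θ : EuclideanSpace ℝ (Fin n))) ∂(sphereMeasure n) := by
  have : Nonempty (Fin n) := ⟨⟨0, hn⟩⟩
  have hmp := (volume : Measure (EuclideanSpace ℝ (Fin n))).measurePreserving_homeomorphUnitSphereProd
  have hfg : Measurable fun z : Metric.sphere (0 : EuclideanSpace ℝ (Fin n)) 1 × Ioi (0 : ℝ) =>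
      f (z.2.1 • z.1.1) := by fun_prop
  have h1 : ∀ r : Ioi (0 : ℝ), r.1 ^ (n - 1) = r.1 ^ ((n : ℝ) - 1) := by
    intro r
    rw [← Real.rpow_natCast, Nat.cast_sub hn, Nat.cast_one]
  calc ∫⁻ x, f x = ∫⁻ x in ({0}ᶜ : Set (EuclideanSpace ℝ (Fin n))), f x := by
        rw [restrict_compl_singleton]
    _ = ∫⁻ x : ({0}ᶜ : Set (EuclideanSpace ℝ (Fin n))), f x.1 ∂(volume.comap Subtype.val) :=
        (lintegral_subtype_comap (measurableSet_singleton _).compl _).symm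
    _ = ∫⁻ x : ({0}ᶜ : Set (EuclideanSpace ℝ (Fin n))),
        f ((homeomorphUnitSphereProd _ x).2.1 • (homeomorphUnitSphereProd _ x).1.1)
          ∂(volume.comap Subtype.val) := by
        apply lintegral_congr
        intro x
        congr 1
        have h0 : ‖x.1‖ ≠ 0 := norm_ne_zero_iff.2 x.2
        simp [smul_smul, h0]
    _ = ∫⁻ z, f (z.2.1 • z.1.1) ∂((sphereMeasure n).prod (Measure.volumeIoiPow (n - 1))) := by
        have := hmp.lintegral_comp hfg
        rwa [finrank_euclideanSpace, Fintype.card_fin] at this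
    _ = ∫⁻ r, ∫⁻ θ, f (r.1 • θ.1) ∂(sphereMeasure n) ∂(Measure.volumeIoiPow (n - 1)) :=
        lintegral_prod_symm' _ hfg
    _ = ∫⁻ r : Ioi (0 : ℝ), ENNReal.ofReal (r.1 ^ ((n : ℝ) - 1)) * ∫⁻ θ, f (r.1 • θ.1)
          ∂(sphereMeasure n) ∂(Measure.comap Subtype.val volume) := by
        rw [Measure.volumeIoiPow, lintegral_withDensity_eq_lintegral_mul _ (by fun_prop)
          (hfg.lintegral_prod_left')]
        apply lintegral_congr
        intro r
        simp only [Pi.mul_apply]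
        rw [h1]
    _ = _ := lintegral_subtype_comap measurableSet_Ioi
        (fun r : ℝ => ENNReal.ofReal (r ^ ((n : ℝ) - 1)) * ∫⁻ θ, f (r • θ.1) ∂(sphereMeasure n))

/-- Integration in polar coordinates, with `‖x‖ ^ c` as the radial variable. -/
lemma lintegral_polar_rpow (hn : 0 < n) {c : ℝ} (hc : 0 < c)
    {f : EuclideanSpace ℝ (Fin n) → ℝ≥0∞} (hf : Measurable f) :
    ∫⁻ x, f x = ∫⁻ u in Ioi (0 : ℝ), ENNReal.ofReal (1 / c * u ^ ((n : ℝ) / c - 1)) *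
      ∫⁻ θ, f (u ^ (1 / c) • (θ : EuclideanSpace ℝ (Fin n))) ∂(sphereMeasure n) := by
  have himg : (fun u : ℝ => u ^ (1 / c)) '' Ioi 0 = Ioi 0 := by
    ext r
    constructor
    · rintro ⟨u, hu, rfl⟩
      exact Real.rpow_pos_of_pos hu _
    · intro hr
      refine ⟨r ^ c, Real.rpow_pos_of_pos hr _, ?_⟩
      simp only
      rw [← Real.rpow_mul (le_of_lt hr), mul_one_div_cancel hc.ne', Real.rpow_one]
  have hinj : InjOn (fun u : ℝ => u ^ (1 / c)) (Ioi 0) := by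
    intro x hx y hy hxy
    exact (Real.rpow_left_inj (le_of_lt hx) (le_of_lt hy) (by positivity)).1 hxy
  have hd : ∀ u ∈ Ioi (0 : ℝ), HasDerivWithinAt (fun u : ℝ => u ^ (1 / c))
      (1 / c * u ^ (1 / c - 1)) (Ioi 0) u := fun u hu =>
    (Real.hasDerivAt_rpow_const (Or.inl (ne_of_gt hu))).hasDerivWithinAt
  have key := lintegral_image_eq_lintegral_abs_deriv_mul measurableSet_Ioi hd hinj
    (fun r => ENNReal.ofReal (r ^ ((n : ℝ) - 1)) *
      ∫⁻ θ, f (r • (θ : EuclideanSpace ℝ (Fin n))) ∂(sphereMeasure n))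
  rw [himg] at key
  rw [lintegral_polar hn hf, key]
  apply setLIntegral_congr_fun measurableSet_Ioi
  intro u hu
  have hu0 : (0 : ℝ) < u := hu
  simp only
  rw [← mul_assoc, abs_of_nonneg (by positivity), ← ENNReal.ofReal_mul (by positivity),
    ← Real.rpow_mul hu0.le, mul_assoc, ← Real.rpow_add hu0]
  congr 4
  field_simp
  ring

/-- The density of the integral of `f` over balls, in the variable `‖x‖ ^ c`. -/
def radialDensity (c : ℝ) (f : EuclideanSpace ℝ (Fin n) → ℝ≥0∞) (u : ℝ) : ℝ≥0∞ :=
  ENNReal.ofReal (1 / c * u ^ ((n : ℝ) / c - 1)) *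
    ∫⁻ θ, f (u ^ (1 / c) • (θ : EuclideanSpace ℝ (Fin n))) ∂(sphereMeasure n)

lemma measurable_radialDensity (c : ℝ) {f : EuclideanSpace ℝ (Fin n) → ℝ≥0∞} (hf : Measurable f) :
    Measurable (radialDensity c f) := by
  unfold radialDensity
  apply Measurable.mul (by fun_prop)
  apply Measurable.lintegral_prod_right'
    (f := fun z : ℝ × Metric.sphere (0 : EuclideanSpace ℝ (Fin n)) 1 => f (z.1 ^ (1 / c) • z.2.1))
  fun_prop

lemma norm_rpow_smul_sphere {c u : ℝ} (hu : 0 < u)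
    (θ : Metric.sphere (0 : EuclideanSpace ℝ (Fin n)) 1) :
    ‖u ^ (1 / c) • (θ : EuclideanSpace ℝ (Fin n))‖ = u ^ (1 / c) := by
  rw [norm_smul, norm_eq_of_mem_sphere, mul_one, Real.norm_of_nonneg (by positivity)]

lemma lintegral_ball_eq (hn : 0 < n) {c r : ℝ} (hc : 0 < c) (hr : 0 < r)
    {f : EuclideanSpace ℝ (Fin n) → ℝ≥0∞} (hf : Measurable f) :
    ∫⁻ x in Metric.ball 0 r, f x = ∫⁻ u in Ioo 0 (r ^ c), radialDensity c f u := by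
  rw [← lintegral_indicator Metric.isOpen_ball.measurableSet,
    lintegral_polar_rpow hn hc (hf.indicator Metric.isOpen_ball.measurableSet),
    ← lintegral_indicator measurableSet_Ioi, ← lintegral_indicator measurableSet_Ioo]
  apply lintegral_congr
  intro u
  by_cases hu : 0 < u
  · have hmem : ∀ θ : Metric.sphere (0 : EuclideanSpace ℝ (Fin n)) 1,
        u ^ (1 / c) • (θ : EuclideanSpace ℝ (Fin n)) ∈ Metric.ball 0 r ↔ u < r ^ c := by
      intro θ
      rw [mem_ball_zero_iff, norm_rpow_smul_sphere hu, one_div,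
        Real.rpow_inv_lt_iff_of_pos hu.le hr.le hc]
    rw [indicator_of_mem (show u ∈ Ioi (0 : ℝ) from hu)]
    by_cases hur : u < r ^ c
    · rw [indicator_of_mem (show u ∈ Ioo (0 : ℝ) (r ^ c) from ⟨hu, hur⟩), radialDensity]
      congr 1
      apply lintegral_congr
      intro θ
      rw [indicator_of_mem ((hmem θ).2 hur)]
    · rw [indicator_of_notMem (fun h => hur h.2)]
      have : ∀ θ : Metric.sphere (0 : EuclideanSpace ℝ (Fin n)) 1, (Metric.ball 0 r).indicator f
          (u ^ (1 / c) • (θ : EuclideanSpace ℝ (Fin n))) = 0 := fun θ =>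
        indicator_of_notMem (fun h => hur ((hmem θ).1 h)) _
      simp_rw [this, lintegral_zero, mul_zero]
  · rw [indicator_of_notMem (show u ∉ Ioi (0 : ℝ) from hu),
      indicator_of_notMem (show u ∉ Ioo (0 : ℝ) (r ^ c) from fun h => hu h.1)]

/-- The relation on `c` says `(n / c - 1) * p = (n / c - 1) + γ / c`. Hence the `p`-th power of the
Jacobian of `u = ‖x‖ ^ c` is, up to a constant, the Jacobian times the weight. -/
lemma lintegral_rpow_weight_eq (hn : 0 < n) {p c γ : ℝ} (hc : 0 < c)
    (hcγ : c * (p - 1) = n * (p - 1) - γ) {f : EuclideanSpace ℝ (Fin n) → ℝ≥0∞}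
    (hf : Measurable f) :
    ENNReal.ofReal (c ^ (1 - p)) * ∫⁻ x, f x ^ p * ENNReal.ofReal (‖x‖ ^ γ) =
      ∫⁻ u in Ioi (0 : ℝ), ENNReal.ofReal (1 / c * u ^ ((n : ℝ) / c - 1)) ^ p *
      ∫⁻ θ, f (u ^ (1 / c) • (θ : EuclideanSpace ℝ (Fin n))) ^ p ∂(sphereMeasure n) := by
  rw [lintegral_polar_rpow hn hc (by fun_prop), ← lintegral_const_mul' _ _ ENNReal.ofReal_ne_top]
  apply setLIntegral_congr_fun measurableSet_Ioi
  intro u hu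
  have hu0 : (0 : ℝ) < u := hu
  simp only
  simp_rw [norm_rpow_smul_sphere hu0]
  rw [lintegral_mul_const' _ _ ENNReal.ofReal_ne_top, mul_comm (∫⁻ θ, _ ∂_), ← mul_assoc, ← mul_assoc,
    ENNReal.ofReal_rpow_of_pos (by positivity), ← ENNReal.ofReal_mul (by positivity),
    ← ENNReal.ofReal_mul (by positivity)]
  congr 2
  rw [Real.mul_rpow (by positivity) (by positivity), ← Real.rpow_mul hu0.le, ← Real.rpow_mul hu0.le,
    one_div, Real.inv_rpow hc.le, Real.rpow_sub hc, Real.rpow_one]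
  have : u ^ (((n : ℝ) / c - 1) * p) = u ^ ((n : ℝ) / c - 1) * u ^ (c⁻¹ * γ) := by
    rw [← Real.rpow_add hu0]
    congr 1
    field_simp
    linarith
  rw [this]
  field_simp

/-- Hölder's inequality against `1` on the sphere. It is an equality for radial functions, as
recorded in `lintegral_radialDensity_rpow_norm`. -/
lemma lintegral_radialDensity_rpow_le (hn : 0 < n) {p c γ : ℝ} (hc : 0 < c) (hp : 1 < p)
    (hcγ : c * (p - 1) = n * (p - 1) - γ) {f : EuclideanSpace ℝ (Fin n) → ℝ≥0∞}
    (hf : Measurable f) :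
    ∫⁻ u in Ioi (0 : ℝ), radialDensity c f u ^ p ≤
      ENNReal.ofReal (c ^ (1 - p) * sphereArea n ^ (p - 1)) *
        ∫⁻ x, f x ^ p * ENNReal.ofReal (‖x‖ ^ γ) := by
  have hp0 : 0 < p := by linarith
  have hω := sphereArea_pos hn
  have hconj : p.HolderConjugate (p / (p - 1)) := Real.HolderConjugate.conjExponent hp
  rw [mul_comm (c ^ (1 - p)), ENNReal.ofReal_mul (by positivity), mul_assoc,
    lintegral_rpow_weight_eq hn hc hcγ hf, ← lintegral_const_mul' _ _ ENNReal.ofReal_ne_top]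
  apply lintegral_mono
  intro u
  simp only [radialDensity]
  rw [ENNReal.mul_rpow_of_nonneg _ _ hp0.le, mul_left_comm]
  gcongr
  have hm : Measurable fun θ : Metric.sphere (0 : EuclideanSpace ℝ (Fin n)) 1 =>
      f (u ^ (1 / c) • θ.1) := by fun_prop
  have h1 := ENNReal.lintegral_mul_le_Lp_mul_Lq (sphereMeasure n) hconj hm.aemeasurable
    (aemeasurable_const (b := (1 : ℝ≥0∞)))
  have h2 := ENNReal.rpow_le_rpow h1 hp0.le
  simp only [Pi.mul_apply, mul_one, ENNReal.one_rpow, lintegral_one, sphereMeasure_univ] at h2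
  refine h2.trans_eq ?_
  have : p - 1 ≠ 0 := by linarith
  rw [ENNReal.mul_rpow_of_nonneg _ _ hp0.le, ← ENNReal.rpow_mul, ← ENNReal.rpow_mul,
    one_div_mul_cancel hp0.ne', ENNReal.rpow_one, ENNReal.ofReal_rpow_of_pos hω, mul_comm,
    show 1 / (p / (p - 1)) * p = p - 1 by field_simp]

lemma radialDensity_norm {c u : ℝ} (hu : 0 < u) (φ : ℝ → ℝ≥0∞) :
    radialDensity c (fun x : EuclideanSpace ℝ (Fin n) => φ ‖x‖) u =
      ENNReal.ofReal (1 / c * u ^ ((n : ℝ) / c - 1)) *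
        (φ (u ^ (1 / c)) * ENNReal.ofReal (sphereArea n)) := by
  unfold radialDensity
  simp_rw [norm_rpow_smul_sphere hu]
  rw [lintegral_const, sphereMeasure_univ]

lemma lintegral_radialDensity_rpow_norm (hn : 0 < n) {p c γ : ℝ} (hc : 0 < c) (hp : 1 < p)
    (hcγ : c * (p - 1) = n * (p - 1) - γ) {φ : ℝ → ℝ≥0∞} (hφ : Measurable φ) :
    ∫⁻ u in Ioi (0 : ℝ), radialDensity c (fun x : EuclideanSpace ℝ (Fin n) => φ ‖x‖) u ^ p =
      ENNReal.ofReal (c ^ (1 - p) * sphereArea n ^ (p - 1)) *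
        ∫⁻ x : EuclideanSpace ℝ (Fin n), φ ‖x‖ ^ p * ENNReal.ofReal (‖x‖ ^ γ) := by
  have hp0 : 0 < p := by linarith
  have hω := sphereArea_pos hn
  rw [mul_comm (c ^ (1 - p)), ENNReal.ofReal_mul (by positivity), mul_assoc,
    lintegral_rpow_weight_eq hn hc hcγ (f := fun x => φ ‖x‖) (by fun_prop),
    ← lintegral_const_mul' _ _ ENNReal.ofReal_ne_top]
  apply setLIntegral_congr_fun measurableSet_Ioi
  intro u hu
  simp only
  rw [radialDensity_norm hu, ENNReal.mul_rpow_of_nonneg _ _ hp0.le, mul_left_comm]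
  congr 1
  simp_rw [norm_rpow_smul_sphere (mem_Ioi.1 hu)]
  rw [lintegral_const, sphereMeasure_univ, ENNReal.mul_rpow_of_nonneg _ _ hp0.le, mul_left_comm]
  congr 1
  rw [ENNReal.ofReal_rpow_of_pos hω, ← ENNReal.ofReal_mul (by positivity), Real.rpow_sub hω,
    Real.rpow_one]
  congr 1
  field_simp

end Polar

/-! ### The sharp inequality in one variable -/

section OneVariable
variable {n : ℕ}

/-- The weight in front of the integral in the Hardy operator in one variable. -/
def hardyWeight (n : ℕ) (β : ℝ) (x : EuclideanSpace ℝ (Fin n)) : ℝ :=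
  1 / (volume (Metric.ball (0 : EuclideanSpace ℝ (Fin n)) ‖x‖)).toReal ^ (1 - β / (n : ℝ))

lemma hardyWeight_nonneg (n : ℕ) (β : ℝ) (x : EuclideanSpace ℝ (Fin n)) :
    0 ≤ hardyWeight n β x := by
  unfold hardyWeight; positivity

lemma hardyWeight_eq (hn : 0 < n) (β : ℝ) (x : EuclideanSpace ℝ (Fin n)) :
    hardyWeight n β x = 1 / (sphereArea n / n * ‖x‖ ^ (n : ℝ)) ^ (1 - β / (n : ℝ)) := by
  rw [hardyWeight, volume_ball_toReal hn (norm_nonneg x)]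

lemma measurable_hardyWeight (hn : 0 < n) (β : ℝ) : Measurable (hardyWeight n β) := by
  have : hardyWeight n β = fun x => 1 / (sphereArea n / n * ‖x‖ ^ (n : ℝ)) ^ (1 - β / (n : ℝ)) :=
    funext (hardyWeight_eq hn β)
  rw [this]; fun_prop

/-- The factor of `sharpConst` that belongs to one variable. -/
def sharpFactor (n : ℕ) (β γ p q : ℝ) : ℝ :=
  sphereArea n ^ (1 / q - 1 / p + β / (n : ℝ)) * (n : ℝ) ^ (1 / p - 1 / q - β / (n : ℝ)) *
    ((n : ℝ) * (p - 1) / ((n : ℝ) * (p - 1) - γ)) ^ (1 / p.conjExponent + 1 / q) *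
    blissFactor p q

lemma sharpFactor_pos (hn : 0 < n) {β γ p q : ℝ} (hp : 1 < p) (hpq : p ≤ q)
    (hγ : γ < n * (p - 1)) : 0 < sharpFactor n β γ p q := by
  have := sphereArea_pos hn
  have := blissFactor_pos hp hpq
  have : 0 < n * (p - 1) - γ := by linarith
  have : 0 < p - 1 := by linarith
  unfold sharpFactor
  positivity

/-- The factors on the right are those produced by the reduction: the polar Jacobian with the ball
volumes, the Bliss factor, and the constant from Hölder on the sphere. -/
lemma sharpFactor_rpow (hn : 0 < n) {β γ p q c : ℝ} (hp : 1 < p) (hpq : p ≤ q)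
    (hc : 0 < c) (hcγ : c * (p - 1) = n * (p - 1) - γ) :
    sharpFactor n β γ p q ^ q = sphereArea n / c * (sphereArea n / n) ^ (-(1 - β / n) * q) *
      blissFactor p q ^ q * (c ^ (1 - p) * sphereArea n ^ (p - 1)) ^ (q / p) := by
  have hω := sphereArea_pos hn
  have hA := blissFactor_pos hp hpq
  have hp0 : 0 < p := by linarith
  have hq0 : 0 < q := by linarith
  have hp1 : 0 < p - 1 := by linarith
  have hn0 : (0 : ℝ) < n := by positivity
  rw [sharpFactor, ← hcγ, mul_div_mul_right _ _ hp1.ne']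
  obtain ⟨a, ha⟩ : ∃ a, sphereArea n = Real.exp a := ⟨_, (Real.exp_log hω).symm⟩
  obtain ⟨b, hb⟩ : ∃ b, (n : ℝ) = Real.exp b := ⟨_, (Real.exp_log hn0).symm⟩
  obtain ⟨d, hd⟩ : ∃ d, blissFactor p q = Real.exp d := ⟨_, (Real.exp_log hA).symm⟩
  obtain ⟨e, rfl⟩ : ∃ e, c = Real.exp e := ⟨_, (Real.exp_log hc).symm⟩
  generalize β / (n : ℝ) = t
  rw [ha, hb, hd, Real.conjExponent]
  simp only [← Real.exp_sub, ← Real.exp_mul, ← Real.exp_add]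
  congr 1
  field_simp
  ring

/-- Reduction of the left-hand side to one dimension. -/
lemma lintegral_hardyWeight_mul_rpow (hn : 0 < n) {p q c α β γ : ℝ} (hp : 1 < p) (hpq : p ≤ q)
    (hc : 0 < c) (hcγ : c * (p - 1) = n * (p - 1) - γ) (hbal : β + (α + n) / q = (γ + n) / p)
    {f : EuclideanSpace ℝ (Fin n) → ℝ≥0∞} (hf : Measurable f) :
    ∫⁻ x : EuclideanSpace ℝ (Fin n), (ENNReal.ofReal (hardyWeight n β x) *
        ∫⁻ y in Metric.ball 0 ‖x‖, f y) ^ q * ENNReal.ofReal (‖x‖ ^ α) =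
      ENNReal.ofReal (sphereArea n / c * (sphereArea n / n) ^ (-(1 - β / n) * q)) *
      ∫⁻ u in Ioi (0 : ℝ), (∫⁻ t in Ioo 0 u, radialDensity c f t) ^ q *
        ENNReal.ofReal (u ^ (-1 - q * ((p - 1) / p))) := by
  have hω := sphereArea_pos hn
  have hp0 : 0 < p := by linarith
  have hq0 : 0 < q := by linarith
  have hn0 : (0 : ℝ) < n := by positivity
  set g : EuclideanSpace ℝ (Fin n) → ℝ≥0∞ := fun x =>
    (ENNReal.ofReal (hardyWeight n β x) * ∫⁻ t in Ioo 0 (‖x‖ ^ c), radialDensity c f t) ^ q *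
      ENNReal.ofReal (‖x‖ ^ α) with hg
  have hgm : Measurable g := by
    apply Measurable.mul _ (by fun_prop)
    apply Measurable.pow_const
    apply (measurable_hardyWeight hn β).ennreal_ofReal.mul
    exact (measurable_lintegral_Ioo (measurable_radialDensity c hf)).comp
      (measurable_norm.pow_const c)
  have : Nonempty (Fin n) := ⟨⟨0, hn⟩⟩
  have hae : ∀ᵐ x : EuclideanSpace ℝ (Fin n), (ENNReal.ofReal (hardyWeight n β x) *
        ∫⁻ y in Metric.ball 0 ‖x‖, f y) ^ q * ENNReal.ofReal (‖x‖ ^ α) = g x := by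
    filter_upwards [Measure.ae_ne volume (0 : EuclideanSpace ℝ (Fin n))] with x hx
    rw [lintegral_ball_eq hn hc (norm_pos_iff.2 hx) hf]
  rw [lintegral_congr_ae hae, lintegral_polar_rpow hn hc hgm,
    ← lintegral_const_mul' _ _ ENNReal.ofReal_ne_top]
  apply setLIntegral_congr_fun measurableSet_Ioi
  intro u hu
  have hu0 : (0 : ℝ) < u := hu
  simp only [hg]
  have h1 : ∀ θ : Metric.sphere (0 : EuclideanSpace ℝ (Fin n)) 1,
      hardyWeight n β (u ^ (1 / c) • (θ : EuclideanSpace ℝ (Fin n))) =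
      1 / (sphereArea n / n * (u ^ (1 / c)) ^ (n : ℝ)) ^ (1 - β / (n : ℝ)) := by
    intro θ
    rw [hardyWeight_eq hn, norm_rpow_smul_sphere hu0]
  simp_rw [h1, norm_rpow_smul_sphere hu0]
  rw [lintegral_const, sphereMeasure_univ, ← Real.rpow_mul hu0.le (1 / c) c,
    one_div_mul_cancel hc.ne', Real.rpow_one, ENNReal.mul_rpow_of_nonneg _ _ hq0.le,
    ENNReal.ofReal_rpow_of_pos (by positivity)]
  set I := (∫⁻ t in Ioo 0 u, radialDensity c f t) ^ q
  calc _ = I * (ENNReal.ofReal (1 / c * u ^ ((n : ℝ) / c - 1)) * (ENNReal.ofReal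
        ((1 / (sphereArea n / n * (u ^ (1 / c)) ^ (n : ℝ)) ^ (1 - β / (n : ℝ))) ^ q) *
          ENNReal.ofReal ((u ^ (1 / c)) ^ α) * ENNReal.ofReal (sphereArea n))) := by ring
    _ = I * (ENNReal.ofReal (sphereArea n / c * (sphereArea n / n) ^ (-(1 - β / n) * q)) *
        ENNReal.ofReal (u ^ (-1 - q * ((p - 1) / p)))) := by
      congr 1
      rw [← ENNReal.ofReal_mul (by positivity), ← ENNReal.ofReal_mul (by positivity),
        ← ENNReal.ofReal_mul (by positivity), ← ENNReal.ofReal_mul (by positivity)]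
      congr 1
      have e1 : (1 / (sphereArea n / n * (u ^ (1 / c)) ^ (n : ℝ)) ^ (1 - β / (n : ℝ))) ^ q =
          (sphereArea n / n) ^ (-(1 - β / n) * q) * u ^ (1 / c * n * (-(1 - β / n) * q)) := by
        rw [one_div, ← Real.rpow_neg (by positivity), ← Real.rpow_mul (by positivity),
          Real.mul_rpow (by positivity) (by positivity), ← Real.rpow_mul hu0.le,
          ← Real.rpow_mul hu0.le]
      -- The balance condition is used here: Jacobian, ball volume and target weight combine to the
      -- exponent of the half-line inequality.
      have e2 : u ^ (-1 - q * ((p - 1) / p)) = u ^ ((n : ℝ) / c - 1) *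
          u ^ (1 / c * n * (-(1 - β / n) * q)) * u ^ (1 / c * α) := by
        rw [← Real.rpow_add hu0, ← Real.rpow_add hu0]
        congr 1
        field_simp at hbal ⊢
        linear_combination (-q) * hcγ - hbal
      rw [e1, e2, ← Real.rpow_mul hu0.le]
      ring
    _ = _ := by ring

/-- The sharp inequality in one variable. -/
theorem lintegral_hardyWeight_mul_rpow_le (hn : 0 < n) {p q α β γ : ℝ} (hp : 1 < p) (hpq : p ≤ q)
    (hγ : γ < n * (p - 1)) (hbal : β + (α + n) / q = (γ + n) / p)
    {f : EuclideanSpace ℝ (Fin n) → ℝ≥0∞} (hf : Measurable f) :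
    ∫⁻ x : EuclideanSpace ℝ (Fin n), (ENNReal.ofReal (hardyWeight n β x) *
        ∫⁻ y in Metric.ball 0 ‖x‖, f y) ^ q * ENNReal.ofReal (‖x‖ ^ α) ≤
      ENNReal.ofReal (sharpFactor n β γ p q) ^ q *
        (∫⁻ x, f x ^ p * ENNReal.ofReal (‖x‖ ^ γ)) ^ (q / p) := by
  have hω := sphereArea_pos hn
  have hA := blissFactor_pos hp hpq
  have hp1 : 0 < p - 1 := by linarith
  have hq0 : 0 < q := by linarith
  have hn0 : (0 : ℝ) < n := by positivity
  -- This is `c = n - γ / (p - 1)`; the upper bound on `γ` is what makes it positive.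
  obtain ⟨c, hcγ⟩ : ∃ c, c * (p - 1) = n * (p - 1) - γ :=
    ⟨(n * (p - 1) - γ) / (p - 1), div_mul_cancel₀ _ hp1.ne'⟩
  have hc : 0 < c := by
    have : 0 < c * (p - 1) := by linarith
    exact (pos_iff_pos_of_mul_pos this).2 hp1
  rw [lintegral_hardyWeight_mul_rpow hn hp hpq hc hcγ hbal hf,
    ENNReal.ofReal_rpow_of_pos (sharpFactor_pos hn hp hpq hγ),
    sharpFactor_rpow hn hp hpq hc hcγ]
  calc _ ≤ ENNReal.ofReal (sphereArea n / c * (sphereArea n / n) ^ (-(1 - β / n) * q)) *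
        (ENNReal.ofReal (blissFactor p q) ^ q * (∫⁻ u in Ioi 0, radialDensity c f u ^ p) ^ (q / p)) := by
        gcongr
        exact lintegral_primitive_rpow_le hp hpq (measurable_radialDensity c hf)
    _ ≤ ENNReal.ofReal (sphereArea n / c * (sphereArea n / n) ^ (-(1 - β / n) * q)) *
        (ENNReal.ofReal (blissFactor p q) ^ q *
          (ENNReal.ofReal (c ^ (1 - p) * sphereArea n ^ (p - 1)) *
        ∫⁻ x, f x ^ p * ENNReal.ofReal (‖x‖ ^ γ)) ^ (q / p)) := by
        gcongr
        exact lintegral_radialDensity_rpow_le hn hc hp hcγ hf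
    _ = _ := by
        rw [ENNReal.mul_rpow_of_nonneg _ _ (by positivity), ENNReal.ofReal_rpow_of_pos hA,
          ENNReal.ofReal_rpow_of_pos (by positivity), ← mul_assoc, ← mul_assoc, ← ENNReal.ofReal_mul (by positivity),
          ← ENNReal.ofReal_mul (by positivity)]

/-- Sharpness of the inequality in one variable. -/
theorem exists_le_lintegral_hardyWeight_mul_rpow (hn : 0 < n) {p q α β γ C : ℝ} (hp : 1 < p)
    (hpq : p ≤ q) (hγ : γ < n * (p - 1)) (hbal : β + (α + n) / q = (γ + n) / p) (hC0 : 0 < C)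
    (hC : C < sharpFactor n β γ p q) :
    ∃ f : EuclideanSpace ℝ (Fin n) → ℝ, Measurable f ∧ (∀ x, 0 ≤ f x) ∧
      ∫⁻ x, ENNReal.ofReal (f x) ^ p * ENNReal.ofReal (‖x‖ ^ γ) ≠ 0 ∧
      ∫⁻ x, ENNReal.ofReal (f x) ^ p * ENNReal.ofReal (‖x‖ ^ γ) ≠ ⊤ ∧
      ENNReal.ofReal C ^ q *
        (∫⁻ x, ENNReal.ofReal (f x) ^ p * ENNReal.ofReal (‖x‖ ^ γ)) ^ (q / p) ≤
      ∫⁻ x : EuclideanSpace ℝ (Fin n), (ENNReal.ofReal (hardyWeight n β x) *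
        ∫⁻ y in Metric.ball 0 ‖x‖, ENNReal.ofReal (f y)) ^ q * ENNReal.ofReal (‖x‖ ^ α) := by
  have hω := sphereArea_pos hn
  have hA := blissFactor_pos hp hpq
  have hS := sharpFactor_pos (β := β) hn hp hpq hγ
  have hp0 : 0 < p := by linarith
  have hp1 : 0 < p - 1 := by linarith
  have hq0 : 0 < q := by linarith
  have hn0 : (0 : ℝ) < n := by positivity
  obtain ⟨c, hcγ⟩ : ∃ c, c * (p - 1) = n * (p - 1) - γ :=
    ⟨(n * (p - 1) - γ) / (p - 1), div_mul_cancel₀ _ hp1.ne'⟩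
  have hc : 0 < c := by
    have : 0 < c * (p - 1) := by linarith
    exact (pos_iff_pos_of_mul_pos this).2 hp1
  -- The same relative loss `s` is passed to the half-line problem, since all other factors are
  -- exact for radial functions.
  set s := C / sharpFactor n β γ p q with hs
  have hs0 : 0 < s := by positivity
  have hs1 : s < 1 := (div_lt_one hS).2 hC
  obtain ⟨h, hhm, hh0, hne, hnt, hle⟩ := exists_le_lintegral_primitive_rpow hp hpq
    (c := s * blissFactor p q) (by positivity) (by nlinarith)
  -- The radial profile whose radial density is exactly `h`. The absolute value only matters for
  -- negative arguments.
  set φ : ℝ → ℝ := fun r => |c * r ^ (c - n) / sphereArea n| * h (r ^ c) with hφ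
  have hφm : Measurable φ := by simp only [hφ]; fun_prop
  have hM : ∀ u ∈ Ioi (0 : ℝ), radialDensity c
      (fun x : EuclideanSpace ℝ (Fin n) => ENNReal.ofReal (φ ‖x‖)) u = ENNReal.ofReal (h u) := by
    intro u hu
    have hu0 : (0 : ℝ) < u := hu
    rw [radialDensity_norm hu0 (fun r => ENNReal.ofReal (φ r)), mul_comm (ENNReal.ofReal (φ _)),
      ← ENNReal.ofReal_mul hω.le,
      ← ENNReal.ofReal_mul (by positivity)]
    congr 1
    simp only [hφ]
    rw [← Real.rpow_mul hu0.le, ← Real.rpow_mul hu0.le, one_div_mul_cancel hc.ne', Real.rpow_one,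
      abs_of_nonneg (by positivity)]
    have : u ^ ((n : ℝ) / c - 1) * u ^ (1 / c * (c - n)) = 1 := by
      rw [← Real.rpow_add hu0]
      convert Real.rpow_zero u using 2
      field_simp
      ring
    calc _ = (u ^ ((n : ℝ) / c - 1) * u ^ (1 / c * (c - n))) * h u := by field_simp
      _ = h u := by rw [this, one_mul]
  have hN := lintegral_radialDensity_rpow_norm hn hc hp hcγ (φ := fun r => ENNReal.ofReal (φ r))
    hφm.ennreal_ofReal
  rw [setLIntegral_congr_fun (g := fun u => ENNReal.ofReal (h u) ^ p) measurableSet_Ioi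
    (fun u hu => by simp only; rw [hM u hu])] at hN
  have hK : 0 < c ^ (1 - p) * sphereArea n ^ (p - 1) := by positivity
  set N := ∫⁻ x : EuclideanSpace ℝ (Fin n), ENNReal.ofReal (φ ‖x‖) ^ p * ENNReal.ofReal (‖x‖ ^ γ)
  refine ⟨fun x => φ ‖x‖, by fun_prop, fun x => mul_nonneg (abs_nonneg _) (hh0 _), ?_, ?_, ?_⟩
  · intro h0
    change N = 0 at h0
    rw [hN, h0, mul_zero] at hne
    exact hne rfl
  · intro h0
    change N = ⊤ at h0
    rw [hN, h0, ENNReal.mul_top (by simpa using hK)] at hnt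
    exact hnt rfl
  · rw [lintegral_hardyWeight_mul_rpow hn hp hpq hc hcγ hbal (by fun_prop)]
    have hI : ∀ u, ∫⁻ t in Ioo 0 u, radialDensity c
        (fun x : EuclideanSpace ℝ (Fin n) => ENNReal.ofReal (φ ‖x‖)) t =
        ∫⁻ t in Ioo 0 u, ENNReal.ofReal (h t) := fun u =>
      setLIntegral_congr_fun measurableSet_Ioo fun t ht => hM t ht.1
    simp_rw [hI]
    calc _ = ENNReal.ofReal (sphereArea n / c * (sphereArea n / n) ^ (-(1 - β / n) * q)) *
          (ENNReal.ofReal (s * blissFactor p q) ^ q *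
            (∫⁻ u in Ioi 0, ENNReal.ofReal (h u) ^ p) ^ (q / p)) := by
          rw [hN, ENNReal.mul_rpow_of_nonneg _ _ (by positivity), ENNReal.ofReal_rpow_of_pos hK,
            ENNReal.ofReal_rpow_of_pos (mul_pos hs0 hA), ENNReal.ofReal_rpow_of_pos hC0, ← mul_assoc,
            ← mul_assoc, ← ENNReal.ofReal_mul (by positivity), ← ENNReal.ofReal_mul (by positivity)]
          congr 2
          have : C = s * sharpFactor n β γ p q := by rw [hs]; field_simp
          rw [this, Real.mul_rpow hs0.le hS.le, sharpFactor_rpow hn hp hpq hc hcγ,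
            Real.mul_rpow hs0.le hA.le]
          ring
      _ ≤ _ := by gcongr

end OneVariable

/-! ### The operator on the product space -/

variable {m : ℕ} {n : Fin m → ℕ}

lemma measurableSet_ballBox_prod :
    MeasurableSet {z : ProdSpace n × ProdSpace n | z.2 ∈ ballBox z.1} := by
  have : {z : ProdSpace n × ProdSpace n | z.2 ∈ ballBox z.1} =
      ⋂ i, {z : ProdSpace n × ProdSpace n | ‖z.2 i‖ < ‖z.1 i‖} := by
    ext z; simp [ballBox]
  rw [this]
  exact MeasurableSet.iInter fun i => measurableSet_lt (by fun_prop) (by fun_prop)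

lemma measurableSet_ballBox (x : ProdSpace n) : MeasurableSet (ballBox x) :=
  measurable_prodMk_left (x := x) measurableSet_ballBox_prod

/-- The Hardy operator for functions with values in `[0, ∞]`. -/
def hardyLintegral (β : Fin m → ℝ) (f : ProdSpace n → ℝ≥0∞) (x : ProdSpace n) : ℝ≥0∞ :=
  (∏ i, ENNReal.ofReal (hardyWeight (n i) (β i) (x i))) * ∫⁻ y in ballBox x, f y

lemma hardyOp_eq {𝕜 : Type*} [RCLike 𝕜] (β : Fin m → ℝ) (f : ProdSpace n → 𝕜) (x : ProdSpace n) :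
    hardyOp β f x = (∏ i, hardyWeight (n i) (β i) (x i)) • ∫ y in ballBox x, f y := rfl

lemma prod_hardyWeight_nonneg (β : Fin m → ℝ) (x : ProdSpace n) :
    0 ≤ ∏ i, hardyWeight (n i) (β i) (x i) :=
  Finset.prod_nonneg fun _ _ => hardyWeight_nonneg _ _ _

lemma enorm_hardyOp_le {𝕜 : Type*} [RCLike 𝕜] (β : Fin m → ℝ) (f : ProdSpace n → 𝕜)
    (x : ProdSpace n) : ‖hardyOp β f x‖ₑ ≤ hardyLintegral β (fun y => ‖f y‖ₑ) x := by
  rw [hardyOp_eq, enorm_smul, Real.enorm_of_nonneg (prod_hardyWeight_nonneg β x),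
    ENNReal.ofReal_prod_of_nonneg fun _ _ => hardyWeight_nonneg _ _ _, hardyLintegral]
  gcongr
  exact enorm_integral_le_lintegral_enorm _

lemma enorm_hardyOp_of_nonneg (β : Fin m → ℝ) {f : ProdSpace n → ℝ} (hf : ∀ x, 0 ≤ f x)
    {x : ProdSpace n} (hfi : IntegrableOn f (ballBox x)) :
    ‖hardyOp β f x‖ₑ = hardyLintegral β (fun y => ENNReal.ofReal (f y)) x := by
  rw [hardyOp_eq, enorm_smul, Real.enorm_of_nonneg (prod_hardyWeight_nonneg β x),
    ENNReal.ofReal_prod_of_nonneg fun _ _ => hardyWeight_nonneg _ _ _, hardyLintegral,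
    Real.enorm_of_nonneg (integral_nonneg hf),
    ofReal_integral_eq_lintegral_ofReal hfi (Eventually.of_forall hf)]

lemma measurable_hardyLintegral (hn : ∀ i, 0 < n i) (β : Fin m → ℝ) {f : ProdSpace n → ℝ≥0∞}
    (hf : Measurable f) : Measurable (hardyLintegral β f) := by
  apply Measurable.mul
  · exact Finset.univ.measurable_fun_prod fun i _ =>
      ((measurable_hardyWeight (hn i) (β i)).comp (measurable_pi_apply i)).ennreal_ofReal
  · have : (fun x : ProdSpace n => ∫⁻ y in ballBox x, f y) = fun x => ∫⁻ y,
        {z : ProdSpace n × ProdSpace n | z.2 ∈ ballBox z.1}.indicator (fun z => f z.2) (x, y) := by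
      ext x
      rw [← lintegral_indicator (measurableSet_ballBox x)]
      rfl
    rw [this]
    exact Measurable.lintegral_prod_right'
      ((hf.comp measurable_snd).indicator measurableSet_ballBox_prod)

lemma stronglyMeasurable_hardyOp {𝕜 : Type*} [RCLike 𝕜] (hn : ∀ i, 0 < n i) (β : Fin m → ℝ)
    {f : ProdSpace n → 𝕜} (hf : StronglyMeasurable f) : StronglyMeasurable (hardyOp β f) := by
  have h1 : Measurable fun x : ProdSpace n => ∏ i, hardyWeight (n i) (β i) (x i) :=
    Finset.univ.measurable_fun_prod fun i _ =>
      (measurable_hardyWeight (hn i) (β i)).comp (measurable_pi_apply i)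
  have h2 : StronglyMeasurable fun x : ProdSpace n => ∫ y in ballBox x, f y := by
    have : (fun x : ProdSpace n => ∫ y in ballBox x, f y) = fun x => ∫ y,
        {z : ProdSpace n × ProdSpace n | z.2 ∈ ballBox z.1}.indicator (fun z => f z.2) (x, y) := by
      ext x
      rw [← integral_indicator (measurableSet_ballBox x)]
      rfl
    rw [this]
    exact StronglyMeasurable.integral_prod_right'
      ((hf.comp_measurable measurable_snd).indicator measurableSet_ballBox_prod)
  exact h1.stronglyMeasurable.smul h2

lemma lintegral_powerMeasure (γ : Fin m → ℝ) {f : ProdSpace n → ℝ≥0∞} (hf : Measurable f) :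
    ∫⁻ x, f x ∂(powerMeasure n γ) = ∫⁻ x, f x * ∏ i, ENNReal.ofReal (‖x i‖ ^ γ i) := by
  rw [powerMeasure, lintegral_withDensity_eq_lintegral_mul _ _ hf]
  · apply lintegral_congr
    intro x
    simp only [Pi.mul_apply]
    rw [mul_comm, ENNReal.ofReal_prod_of_nonneg fun i _ => by positivity]
  · exact (Finset.univ.measurable_fun_prod fun i _ => by fun_prop).ennreal_ofReal

lemma ae_forall_ne_zero (hn : ∀ i, 0 < n i) : ∀ᵐ x : ProdSpace n, ∀ i, x i ≠ 0 := by
  rw [ae_all_iff]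
  intro i
  have : Nonempty (Fin (n i)) := ⟨⟨0, hn i⟩⟩
  exact (Measure.quasiMeasurePreserving_eval (fun i => (volume : Measure
    (EuclideanSpace ℝ (Fin (n i))))) i).ae (Measure.ae_ne volume 0)

/-- The weight is positive off the null set where some coordinate vanishes. Thus functions equal
almost everywhere for the weighted measure have the same integrals over `ballBox`. -/
lemma volume_absolutelyContinuous_powerMeasure (hn : ∀ i, 0 < n i) (γ : Fin m → ℝ) :
    volume ≪ powerMeasure n γ := by
  apply withDensity_absolutelyContinuous'
  · exact (Finset.univ.measurable_fun_prod fun i _ => by fun_prop).ennreal_ofReal.aemeasurable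
  · filter_upwards [ae_forall_ne_zero hn] with x hx
    rw [ne_eq, ENNReal.ofReal_eq_zero, not_le]
    exact Finset.prod_pos fun i _ => Real.rpow_pos_of_pos (norm_pos_iff.2 (hx i)) _

lemma powerMeasure_absolutelyContinuous (γ : Fin m → ℝ) : powerMeasure n γ ≪ volume :=
  withDensity_absolutelyContinuous _ _

lemma sharpConst_eq (β γ : Fin m → ℝ) (p q : ℝ) :
    sharpConst n β γ p q = ∏ i, sharpFactor (n i) (β i) (γ i) p q := rfl

/-- The kernel in one variable of the operator with the weight of the target space built in. -/
def hardyKernel (n : ℕ) (β α q : ℝ) (x y : EuclideanSpace ℝ (Fin n)) : ℝ≥0∞ :=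
  ENNReal.ofReal (hardyWeight n β x) * ENNReal.ofReal (‖x‖ ^ α) ^ (1 / q) *
    (Metric.ball 0 ‖x‖).indicator 1 y

lemma measurable_hardyKernel {n : ℕ} (hn : 0 < n) (β α q : ℝ) :
    Measurable (Function.uncurry (hardyKernel n β α q)) := by
  have hS : MeasurableSet {z : EuclideanSpace ℝ (Fin n) × EuclideanSpace ℝ (Fin n) |
      ‖z.2‖ < ‖z.1‖} := measurableSet_lt (by fun_prop) (by fun_prop)
  have h1 : Function.uncurry (hardyKernel n β α q) = fun z =>
      ENNReal.ofReal (hardyWeight n β z.1) * ENNReal.ofReal (‖z.1‖ ^ α) ^ (1 / q) *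
      {z : EuclideanSpace ℝ (Fin n) × EuclideanSpace ℝ (Fin n) | ‖z.2‖ < ‖z.1‖}.indicator 1 z := by
    ext z
    simp [Function.uncurry, hardyKernel, indicator]
  rw [h1]
  have h2 : Measurable fun z : EuclideanSpace ℝ (Fin n) × EuclideanSpace ℝ (Fin n) =>
      ENNReal.ofReal (hardyWeight n β z.1) :=
    ((measurable_hardyWeight hn β).comp measurable_fst).ennreal_ofReal
  have h3 : Measurable fun z : EuclideanSpace ℝ (Fin n) × EuclideanSpace ℝ (Fin n) =>
    ENNReal.ofReal (‖z.1‖ ^ α) ^ (1 / q) := by fun_prop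
  exact (h2.mul h3).mul (measurable_one.indicator hS)

lemma prod_indicator_ball_mul (f : ProdSpace n → ℝ≥0∞) (x y : ProdSpace n) :
    (∏ i, (Metric.ball (0 : EuclideanSpace ℝ (Fin (n i))) ‖x i‖).indicator
      (1 : EuclideanSpace ℝ (Fin (n i)) → ℝ≥0∞) (y i)) * f y = (ballBox x).indicator f y := by
  by_cases h : y ∈ ballBox x
  · rw [indicator_of_mem h, Finset.prod_eq_one, one_mul]
    intro i _
    rw [indicator_of_mem (mem_ball_zero_iff.2 (h i))]
    rfl
  · rw [indicator_of_notMem h]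
    obtain ⟨i, hi⟩ := not_forall.1 h
    rw [Finset.prod_eq_zero (Finset.mem_univ i), zero_mul]
    exact indicator_of_notMem (fun hm => hi (mem_ball_zero_iff.1 hm)) _

/-- The sharp inequality for measurable functions with values in `[0, ∞]`. -/
theorem lintegral_hardyLintegral_rpow_le {p q : ℝ} {α β γ : Fin m → ℝ} (hn : ∀ i, 0 < n i)
    (hp : 1 < p) (hpq : p ≤ q) (hγ : ∀ i, γ i < (n i : ℝ) * (p - 1))
    (hbal : ∀ i, β i + (α i + (n i : ℝ)) / q = (γ i + (n i : ℝ)) / p)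
    {f : ProdSpace n → ℝ≥0∞} (hf : Measurable f) :
    ∫⁻ x, hardyLintegral β f x ^ q ∂(powerMeasure n α) ≤
      ENNReal.ofReal (sharpConst n β γ p q) ^ q *
        (∫⁻ x, f x ^ p ∂(powerMeasure n γ)) ^ (q / p) := by
  have hp0 : 0 < p := by linarith
  have hq0 : 0 < q := by linarith
  rw [lintegral_powerMeasure _ ((measurable_hardyLintegral hn β hf).pow_const q),
    lintegral_powerMeasure _ (hf.pow_const p), sharpConst_eq,
    ENNReal.ofReal_prod_of_nonneg fun i _ => (sharpFactor_pos (hn i) hp hpq (hγ i)).le,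
    ← ENNReal.prod_rpow_of_nonneg hq0.le]
  have h1 : ∀ x : ProdSpace n, hardyLintegral β f x ^ q * ∏ i, ENNReal.ofReal (‖x i‖ ^ α i) =
      (∫⁻ y, (∏ i, hardyKernel (n i) (β i) (α i) q (x i) (y i)) * f y) ^ q := by
    intro x
    have h2 : ∀ y : ProdSpace n, (∏ i, hardyKernel (n i) (β i) (α i) q (x i) (y i)) * f y =
        ((∏ i, ENNReal.ofReal (hardyWeight (n i) (β i) (x i))) *
          ∏ i, ENNReal.ofReal (‖x i‖ ^ α i) ^ (1 / q)) * (ballBox x).indicator f y := by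
      intro y
      rw [← prod_indicator_ball_mul, ← mul_assoc, ← Finset.prod_mul_distrib,
        ← Finset.prod_mul_distrib]
      rfl
    simp_rw [h2]
    rw [lintegral_const_mul _ (hf.indicator (measurableSet_ballBox x)),
      lintegral_indicator (measurableSet_ballBox x), mul_right_comm, ← hardyLintegral,
      ENNReal.mul_rpow_of_nonneg _ _ hq0.le, ENNReal.prod_rpow_of_nonneg (by positivity),
      ← ENNReal.rpow_mul, one_div_mul_cancel hq0.ne', ENNReal.rpow_one]
  simp_rw [h1]
  -- With the target weight absorbed into the kernels, both operator integrals are against Lebesgue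
  -- measure; the source weights are the `b i`.
  apply lintegral_pi_rpow_le hp0 hpq (k := fun i => hardyKernel (n i) (β i) (α i) q)
    (b := fun i y => ENNReal.ofReal (‖y‖ ^ γ i))
    (C := fun i => ENNReal.ofReal (sharpFactor (n i) (β i) (γ i) p q) ^ q)
    (fun i => measurable_hardyKernel (hn i) _ _ _) (fun i => by fun_prop) _ hf
  intro i g hg
  refine le_of_eq_of_le ?_ (lintegral_hardyWeight_mul_rpow_le (hn i) hp hpq (hγ i) (hbal i) hg)
  apply lintegral_congr
  intro x
  have h2 : ∀ y, hardyKernel (n i) (β i) (α i) q x y * g y =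
      (ENNReal.ofReal (hardyWeight (n i) (β i) x) * ENNReal.ofReal (‖x‖ ^ α i) ^ (1 / q)) *
        (Metric.ball 0 ‖x‖).indicator g y := by
    intro y
    rw [hardyKernel, mul_assoc]
    congr 1
    by_cases hy : y ∈ Metric.ball 0 ‖x‖
    · rw [indicator_of_mem hy, indicator_of_mem hy, Pi.one_apply, one_mul]
    · rw [indicator_of_notMem hy, indicator_of_notMem hy, zero_mul]
  simp_rw [h2]
  rw [lintegral_const_mul _ (hg.indicator Metric.isOpen_ball.measurableSet),
    lintegral_indicator Metric.isOpen_ball.measurableSet, mul_right_comm,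
    ENNReal.mul_rpow_of_nonneg _ _ hq0.le, ← ENNReal.rpow_mul, one_div_mul_cancel hq0.ne',
    ENNReal.rpow_one]

/-- A finite norm gives finiteness only almost everywhere, but the points with all coordinates
longer than those of `x₀` form a nonempty open set, so one of them is good. Its box contains that of
`x₀`, which yields integrability at every point. -/
lemma exists_forall_norm_lt_hardyLintegral_lt_top {β α : Fin m → ℝ} {q : ℝ} (hn : ∀ i, 0 < n i)
    (hq : 0 < q) {f : ProdSpace n → ℝ≥0∞} (hf : Measurable f)
    (hfin : ∫⁻ x, hardyLintegral β f x ^ q ∂(powerMeasure n α) ≠ ⊤) (x₀ : ProdSpace n) :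
    ∃ x : ProdSpace n, (∀ i, ‖x₀ i‖ < ‖x i‖) ∧ hardyLintegral β f x < ⊤ := by
  have hae := (volume_absolutelyContinuous_powerMeasure hn α).ae_le
    (ae_lt_top ((measurable_hardyLintegral hn β hf).pow_const q) hfin)
  have hopen : IsOpen {x : ProdSpace n | ∀ i, ‖x₀ i‖ < ‖x i‖} := by
    simp only [Set.ofPred_forall]
    exact isOpen_iInter_of_finite fun i => isOpen_lt (by fun_prop) (by fun_prop)
  have hne : {x : ProdSpace n | ∀ i, ‖x₀ i‖ < ‖x i‖}.Nonempty := by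
    have : ∀ i, ∃ v : EuclideanSpace ℝ (Fin (n i)), ‖x₀ i‖ < ‖v‖ := by
      intro i
      have : Nonempty (Fin (n i)) := ⟨⟨0, hn i⟩⟩
      exact NormedSpace.exists_lt_norm ℝ _ _
    choose v hv using this
    exact ⟨v, hv⟩
  have hpos := hopen.measure_pos volume hne
  obtain ⟨x, hx, hx2⟩ : ∃ x ∈ {x : ProdSpace n | ∀ i, ‖x₀ i‖ < ‖x i‖},
      hardyLintegral β f x ^ q < ⊤ := by
    by_contra! hcon
    refine hpos.ne' (measure_mono_null (fun x hx => ?_) (ae_iff.1 hae))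
    exact not_lt.2 (hcon x hx)
  exact ⟨x, hx, (ENNReal.rpow_lt_top_iff_of_pos hq).1 hx2⟩

lemma hardyWeight_pos {n : ℕ} (hn : 0 < n) (β : ℝ) {x : EuclideanSpace ℝ (Fin n)} (hx : 0 < ‖x‖) :
    0 < hardyWeight n β x := by
  have := sphereArea_pos hn
  rw [hardyWeight_eq hn]
  positivity

/-- The bound for the Hardy operator, together with the existence of the integrals. -/
theorem memWeightedLp_hardyOp {𝕜 : Type*} [RCLike 𝕜] {p q : ℝ} {α β γ : Fin m → ℝ}
    (hn : ∀ i, 0 < n i) (hp : 1 < p) (hpq : p ≤ q) (hγ : ∀ i, γ i < (n i : ℝ) * (p - 1))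
    (hbal : ∀ i, β i + (α i + (n i : ℝ)) / q = (γ i + (n i : ℝ)) / p)
    {f : ProdSpace n → 𝕜} (hf : MemWeightedLp p γ f) :
    (∀ x, IntegrableOn f (ballBox x)) ∧ MemWeightedLp q α (hardyOp β f) ∧
      weightedNorm q α (hardyOp β f) ≤
        ENNReal.ofReal (sharpConst n β γ p q) * weightedNorm p γ f := by
  have hp0 : 0 < p := by linarith
  have hq0 : 0 < q := by linarith
  -- Passing to a strongly measurable representative leaves `hardyOp β f` unchanged at every point.
  wlog hfm : StronglyMeasurable f generalizing f
  · have hvol := hf.1.mono_ac (volume_absolutelyContinuous_powerMeasure hn γ)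
    have hae := hvol.ae_eq_mk
    have hae' : f =ᵐ[powerMeasure n γ] hvol.mk f := (powerMeasure_absolutelyContinuous γ).ae_le hae
    have hop : hardyOp β f = hardyOp β (hvol.mk f) := by
      ext x
      rw [hardyOp_eq, hardyOp_eq, integral_congr_ae (ae_restrict_of_ae hae)]
    have hnorm : weightedNorm p γ f = weightedNorm p γ (hvol.mk f) := eLpNorm_congr_ae hae'
    obtain ⟨h1, h2, h3⟩ := this ((memLp_congr_ae hae').1 hf) hvol.stronglyMeasurable_mk
    rw [hop, hnorm]
    exact ⟨fun x => (integrable_congr (ae_restrict_of_ae hae)).2 (h1 x), h2, h3⟩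
  have hN : weightedNorm p γ f ^ q = (∫⁻ x, ‖f x‖ₑ ^ p ∂(powerMeasure n γ)) ^ (q / p) :=
    eLpNorm_rpow_eq_lintegral hp0 f q
  have hNfin : weightedNorm p γ f ≠ ⊤ := hf.2.ne
  have hbound := lintegral_hardyLintegral_rpow_le hn hp hpq hγ hbal hfm.enorm
  rw [← hN, ← ENNReal.mul_rpow_of_nonneg _ _ hq0.le] at hbound
  have hKN : ENNReal.ofReal (sharpConst n β γ p q) * weightedNorm p γ f ≠ ⊤ :=
    ENNReal.mul_ne_top ENNReal.ofReal_ne_top hNfin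
  have hfin : ∫⁻ x, hardyLintegral β (fun y => ‖f y‖ₑ) x ^ q ∂(powerMeasure n α) ≠ ⊤ :=
    ne_top_of_le_ne_top (ENNReal.rpow_ne_top_of_nonneg hq0.le hKN) hbound
  have hle : weightedNorm q α (hardyOp β f) ≤
      ENNReal.ofReal (sharpConst n β γ p q) * weightedNorm p γ f := by
    rw [← ENNReal.rpow_le_rpow_iff hq0]
    refine le_trans (le_of_eq_of_le (eLpNorm_rpow_eq_lintegral hq0 _ q) ?_) hbound
    rw [div_self hq0.ne', ENNReal.rpow_one]
    apply lintegral_mono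
    intro x
    exact ENNReal.rpow_le_rpow (enorm_hardyOp_le β f x) hq0.le
  refine ⟨fun x₀ => ?_, ⟨(stronglyMeasurable_hardyOp hn β hfm).aestronglyMeasurable,
    hle.trans_lt hKN.lt_top⟩, hle⟩
  obtain ⟨x, hx, hxfin⟩ := exists_forall_norm_lt_hardyLintegral_lt_top hn hq0 hfm.enorm hfin x₀
  have hw : ∏ i, ENNReal.ofReal (hardyWeight (n i) (β i) (x i)) ≠ 0 :=
    Finset.prod_ne_zero_iff.2 fun i _ => by
      simpa using hardyWeight_pos (hn i) (β i) ((norm_nonneg _).trans_lt (hx i))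
  have hsub : ballBox x₀ ⊆ ballBox x := fun y hy i => (hy i).trans (hx i)
  refine IntegrableOn.mono_set ⟨hfm.aestronglyMeasurable, ?_⟩ hsub
  rw [hasFiniteIntegral_iff_enorm]
  rw [hardyLintegral] at hxfin
  by_contra hcon
  rw [not_lt_top_iff.1 hcon, ENNReal.mul_top hw] at hxfin
  exact lt_irrefl _ hxfin

lemma hardyLintegral_prod (β : Fin m → ℝ) {f : ∀ i, EuclideanSpace ℝ (Fin (n i)) → ℝ≥0∞}
    (hf : ∀ i, Measurable (f i)) (x : ProdSpace n) :
    hardyLintegral β (fun y => ∏ i, f i (y i)) x =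
      ∏ i, (ENNReal.ofReal (hardyWeight (n i) (β i) (x i)) *
        ∫⁻ y in Metric.ball 0 ‖x i‖, f i y) := by
  rw [Finset.prod_mul_distrib, hardyLintegral, ← lintegral_indicator (measurableSet_ballBox x)]
  congr 1
  simp_rw [← lintegral_indicator (Metric.isOpen_ball.measurableSet)]
  rw [← lintegral_pi_prod fun i => (hf i).indicator Metric.isOpen_ball.measurableSet]
  apply lintegral_congr
  intro y
  rw [← prod_indicator_ball_mul, ← Finset.prod_mul_distrib]
  apply Finset.prod_congr rfl
  intro i _
  by_cases hy : y i ∈ Metric.ball 0 ‖x i‖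
  · rw [indicator_of_mem hy, indicator_of_mem hy, Pi.one_apply, one_mul]
  · rw [indicator_of_notMem hy, indicator_of_notMem hy, zero_mul]

/-! ### Sharpness and conclusion -/

/-- Products of near extremals in the variables are near extremals. -/
theorem le_hardyNormNonneg {p q : ℝ} {α β γ : Fin m → ℝ}
    (hn : ∀ i, 0 < n i) (hp : 1 < p) (hpq : p ≤ q) (hγ : ∀ i, γ i < (n i : ℝ) * (p - 1))
    (hbal : ∀ i, β i + (α i + (n i : ℝ)) / q = (γ i + (n i : ℝ)) / p) :
    ENNReal.ofReal (sharpConst n β γ p q) ≤ hardyNormNonneg n β p γ q α := by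
  have hp0 : 0 < p := by linarith
  have hq0 : 0 < q := by linarith
  have hS : ∀ i, 0 < sharpFactor (n i) (β i) (γ i) p q := fun i =>
    sharpFactor_pos (hn i) hp hpq (hγ i)
  -- Each variable loses a factor `t`, since an exact extremal need not exist; the limit `t → 1` is
  -- taken at the end.
  have key : ∀ t : ℝ, 0 < t → t < 1 → ENNReal.ofReal (∏ i, t * sharpFactor (n i) (β i) (γ i) p q) ≤
      hardyNormNonneg n β p γ q α := by
    intro t ht0 ht1
    have hC0 : ∀ i, 0 < t * sharpFactor (n i) (β i) (γ i) p q := fun i => mul_pos ht0 (hS i)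
    choose f hfm hf0 hne hnt hle using fun i => exists_le_lintegral_hardyWeight_mul_rpow (hn i) hp hpq
      (hγ i) (hbal i) (hC0 i) (mul_lt_of_lt_one_left (hS i) ht1)
    set F : ProdSpace n → ℝ := fun x => ∏ i, f i (x i) with hF
    have hFm : Measurable F :=
      Finset.univ.measurable_fun_prod fun i _ => (hfm i).comp (measurable_pi_apply i)
    have hF0 : ∀ x, 0 ≤ F x := fun x => Finset.prod_nonneg fun i _ => hf0 i _
    have hFe : ∀ x, ENNReal.ofReal (F x) = ∏ i, ENNReal.ofReal (f i (x i)) := fun x =>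
      ENNReal.ofReal_prod_of_nonneg fun i _ => hf0 i _
    have hNorm : ∫⁻ x, ‖F x‖ₑ ^ p ∂(powerMeasure n γ) =
        ∏ i, ∫⁻ x, ENNReal.ofReal (f i x) ^ p * ENNReal.ofReal (‖x‖ ^ γ i) := by
      rw [lintegral_powerMeasure _ (hFm.enorm.pow_const p), ← lintegral_pi_prod fun i => by
        have := hfm i
        fun_prop]
      apply lintegral_congr
      intro x
      rw [Real.enorm_of_nonneg (hF0 x), hFe, Finset.prod_mul_distrib,
        ENNReal.prod_rpow_of_nonneg hp0.le]
    have hW : weightedNorm p γ F ^ p = ∏ i, ∫⁻ x, ENNReal.ofReal (f i x) ^ p *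
        ENNReal.ofReal (‖x‖ ^ γ i) := by
      rw [← hNorm, weightedNorm, eLpNorm_rpow_eq_lintegral hp0, div_self hp0.ne', ENNReal.rpow_one]
    have hWq : weightedNorm p γ F ^ q = ∏ i, (∫⁻ x, ENNReal.ofReal (f i x) ^ p *
        ENNReal.ofReal (‖x‖ ^ γ i)) ^ (q / p) := by
      rw [weightedNorm, eLpNorm_rpow_eq_lintegral hp0, hNorm,
        ENNReal.prod_rpow_of_nonneg (by positivity)]
    have hWtop : weightedNorm p γ F ≠ ⊤ := by
      intro h
      rw [h, ENNReal.top_rpow_of_pos hp0] at hW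
      exact ENNReal.prod_ne_top (fun i _ => hnt i) hW.symm
    have hW0 : weightedNorm p γ F ≠ 0 := by
      intro h
      rw [h, ENNReal.zero_rpow_of_pos hp0] at hW
      exact Finset.prod_ne_zero_iff.2 (fun i _ => hne i) hW.symm
    have hmem : MemWeightedLp p γ F := ⟨hFm.aestronglyMeasurable, hWtop.lt_top⟩
    obtain ⟨hint, -, -⟩ := memWeightedLp_hardyOp hn hp hpq hγ hbal hmem
    have hHq : weightedNorm q α (hardyOp β F) ^ q = ∏ i, ∫⁻ x : EuclideanSpace ℝ (Fin (n i)),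
        (ENNReal.ofReal (hardyWeight (n i) (β i) x) *
        ∫⁻ y in Metric.ball 0 ‖x‖, ENNReal.ofReal (f i y)) ^ q * ENNReal.ofReal (‖x‖ ^ α i) := by
      rw [weightedNorm, eLpNorm_rpow_eq_lintegral hq0, div_self hq0.ne', ENNReal.rpow_one]
      simp_rw [fun x => enorm_hardyOp_of_nonneg β hF0 (hint x)]
      rw [lintegral_powerMeasure _ ((measurable_hardyLintegral hn β hFm.ennreal_ofReal).pow_const q)]
      have hmeas : ∀ i, Measurable fun x : EuclideanSpace ℝ (Fin (n i)) =>
          (ENNReal.ofReal (hardyWeight (n i) (β i) x) *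
          ∫⁻ y in Metric.ball 0 ‖x‖, ENNReal.ofReal (f i y)) ^ q * ENNReal.ofReal (‖x‖ ^ α i) := by
        intro i
        apply Measurable.mul _ (by fun_prop)
        apply Measurable.pow_const
        apply (measurable_hardyWeight (hn i) (β i)).ennreal_ofReal.mul
        -- The integral over a ball is monotone in the radius, hence measurable.
        have hball : Measurable fun r : ℝ => ∫⁻ y in Metric.ball
            (0 : EuclideanSpace ℝ (Fin (n i))) r, ENNReal.ofReal (f i y) :=
          Monotone.measurable fun r s hrs => lintegral_mono_set (Metric.ball_subset_ball hrs)
        exact hball.comp measurable_norm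
      rw [← lintegral_pi_prod hmeas]
      apply lintegral_congr
      intro x
      simp_rw [hFe]
      rw [hardyLintegral_prod β fun i => (hfm i).ennreal_ofReal,
        ← ENNReal.prod_rpow_of_nonneg hq0.le, ← Finset.prod_mul_distrib]
    have hratio : ENNReal.ofReal (∏ i, t * sharpFactor (n i) (β i) (γ i) p q) ≤
        weightedNorm q α (hardyOp β F) / weightedNorm p γ F := by
      rw [ENNReal.le_div_iff_mul_le (Or.inl hW0) (Or.inl hWtop), ← ENNReal.rpow_le_rpow_iff hq0,
        ENNReal.mul_rpow_of_nonneg _ _ hq0.le, hWq, hHq,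
        ENNReal.ofReal_prod_of_nonneg fun i _ => (hC0 i).le, ← ENNReal.prod_rpow_of_nonneg hq0.le,
        ← Finset.prod_mul_distrib]
      exact Finset.prod_le_prod' fun i _ => hle i
    exact hratio.trans (le_iSup₂_of_le F ⟨hF0, hmem, hW0⟩ le_rfl)
  have hlim : Tendsto (fun t : ℝ => ENNReal.ofReal (∏ i, t * sharpFactor (n i) (β i) (γ i) p q))
      (𝓝[<] 1) (𝓝 (ENNReal.ofReal (∏ i, 1 * sharpFactor (n i) (β i) (γ i) p q))) := by
    apply Tendsto.mono_left _ nhdsWithin_le_nhds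
    apply Continuous.tendsto
    exact ENNReal.continuous_ofReal.comp (by fun_prop)
  simp only [one_mul] at hlim
  refine le_of_tendsto hlim ?_
  filter_upwards [Ioo_mem_nhdsLT zero_lt_one] with t ht using key t ht.1 ht.2

/-- A real function viewed in `𝕜` keeps its norm, and so does its image under the operator. -/
lemma hardyNormNonneg_le_hardyNorm (𝕜 : Type*) [RCLike 𝕜] (p q : ℝ) (α β γ : Fin m → ℝ) :
    hardyNormNonneg n β p γ q α ≤ hardyNorm 𝕜 n β p γ q α := by
  apply iSup₂_le
  rintro f ⟨-, hmem, hne⟩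
  have h1 : weightedNorm p γ (fun x => (f x : 𝕜)) = weightedNorm p γ f :=
    eLpNorm_congr_norm_ae (Eventually.of_forall fun x => by simp)
  have h2 : weightedNorm q α (hardyOp β fun x => (f x : 𝕜)) = weightedNorm q α (hardyOp β f) := by
    apply eLpNorm_congr_norm_ae (Eventually.of_forall fun x => ?_)
    rw [hardyOp_eq, hardyOp_eq, integral_ofReal, norm_smul, norm_smul, RCLike.norm_ofReal,
      Real.norm_eq_abs (∫ y in ballBox x, f y)]
  rw [← h1, ← h2]
  exact le_iSup₂_of_le (f := fun (f : ProdSpace n → 𝕜) (_ : f ∈ {f : ProdSpace n → 𝕜 |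
    MemWeightedLp p γ f ∧ weightedNorm p γ f ≠ 0}) =>
    weightedNorm q α (hardyOp β f) / weightedNorm p γ f) (fun x => (f x : 𝕜))
    ⟨MemLp.ofReal hmem, h1 ▸ hne⟩ le_rfl

end

theorem theorem2 {𝕜 : Type*} [RCLike 𝕜] {m : ℕ} (n : Fin m → ℕ) (p q : ℝ) (α β γ : Fin m → ℝ)
    (hp : 1 < p) (hpq : p ≤ q)
    (hβ₀ : ∀ i, 0 ≤ β i) (hβn : ∀ i, β i < (n i : ℝ))
    (hγ : ∀ i, γ i < (n i : ℝ) * (p - 1))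
    (hbal : ∀ i, β i + (α i + (n i : ℝ)) / q = (γ i + (n i : ℝ)) / p) :
    (∀ f : ProdSpace n → 𝕜, MemWeightedLp p γ f →
      (∀ x, IntegrableOn f (ballBox x)) ∧
      MemWeightedLp q α (hardyOp β f) ∧
      weightedNorm q α (hardyOp β f) ≤
        ENNReal.ofReal (sharpConst n β γ p q) * weightedNorm p γ f) ∧
    hardyNorm 𝕜 n β p γ q α = ENNReal.ofReal (sharpConst n β γ p q) ∧
    hardyNormNonneg n β p γ q α = ENNReal.ofReal (sharpConst n β γ p q) := by
  -- Positivity of the dimensions is implied by `0 ≤ β i < n i`.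
  have hn : ∀ i, 0 < n i := fun i => by exact_mod_cast (hβ₀ i).trans_lt (hβn i)
  have hupper : hardyNorm 𝕜 n β p γ q α ≤ ENNReal.ofReal (sharpConst n β γ p q) :=
    iSup₂_le fun f hf => ENNReal.div_le_of_le_mul
      (memWeightedLp_hardyOp hn hp hpq hγ hbal hf.1).2.2
  have hlower := le_hardyNormNonneg hn hp hpq hγ hbal
  have hmid := hardyNormNonneg_le_hardyNorm (n := n) 𝕜 p q α β γ
  exact ⟨fun f hf => memWeightedLp_hardyOp hn hp hpq hγ hbal hf,
    le_antisymm hupper (hlower.trans hmid), le_antisymm (hmid.trans hupper) hlower⟩
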